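/- Let $p$ be a prime, $t\ge 1$ and $n\ge t+1$. On $\mathbb{Q}_p^n$ take the Haar measure $|dx|$ with $\mathbb{Z}_p^n$ of measure one. Let $F=(f_1,\dots,f_t)$ with $f_i\in\mathbb{Z}_p[x_1,\dots,x_n]$ be a nonconstant polynomial mapping with $F(0)=0$, and let $g\in\mathbb{Z}_p[x_1,\dots,x_n]$ be a nonconstant polynomial with $g(0)=0$. Put $\|F(x)\|=\max_i|f_i(x)|$. Notation. The Newton polyhedron $\Gamma_g\subset\mathbb{R}_{\ge0}^n$ is the convex hull of $\bigcup_\omega(\omega+\mathbb{R}_{\ge0}^n)$, with $\omega$ running through the exponents of the monomials of $g$ with nonzero coefficient; $\Gamma_F$ is defined in the same way from the union of the supports of $f_1,\dots,f_t$. A face of a polyhedron is the polyhedron itself or its intersection with a supporting hyperplane. For a set $\tau$ and a polynomial $h=\sum a_\omega x^\omega$, let $h_\tau=\sum_{\omega\in\tau}a_\omega x^\omega$, and let $\bar h$ be the reduction of $h$ modulo $p$. For $k\in\mathbb{R}_{\ge0}^n$ and $\Gamma=\Gamma_F$ or $\Gamma_g$, let $m_F(k)$, respectively $m_g(k)$,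 be $\inf_{x\in\Gamma}k\cdot x$, and let $F_\Gamma(k)$ be the face $\{x\in\Gamma\mid k\cdot x=\inf_{y\in\Gamma} k\cdot y\}$. Let $\sigma(k)=k_1+\dots+k_n$. Let $\Delta_{F,g}$ be the partition of $\mathbb{R}_{\ge0}^n$ into the nonempty sets $\delta=\{k\in\mathbb{R}_{\ge0}^n\mid F_{\Gamma_F}(k)=\tau,\ F_{\Gamma_g}(k)=\tau'\}$, with $\tau$ a face of $\Gamma_F$ and $\tau'$ a face of $\Gamma_g$; for such $\delta$ put $f_{i,\delta}=f_{i,\tau}$, $F_\delta=(f_{1,\delta},\dots,f_{t,\delta})$ and $g_\delta=g_{\tau'}$. Assume that (1) $g$ is non-degenerated over $\mathbb{F}_p$: for every face $\tau'$ of $\Gamma_g$, $\overline{g_{\tau'}}$ and all its partial derivatives have no common zero in $(\mathbb{F}_p^\times)^n$; (2) $F$ is strongly non-degenerated over $\mathbb{F}_p$: for every face $\tau$ of $\Gamma_F$, the Jacobian matrix of $\overline{F_\tau}=(\overline{f_{1,\tau}},\dots,\overline{f_{t,\tau}})$ has rank $\min(t,n)$ at every zero of $\overline{F_\tau}$ in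 $(\mathbb{F}_p^\times)^n$; (3) $(F,g)$ is strongly non-degenerated over $\mathbb{F}_p$: for every $\delta\in\Delta_{F,g}$, the Jacobian matrix of $(\overline{F_\delta},\overline{g_\delta})$ has rank $t+1$ at every common zero of $\overline{F_\delta}$ and $\overline{g_\delta}$ in $(\mathbb{F}_p^\times)^n$. Then $\Delta_{F,g}$ is finite and, for $\operatorname{Re}(s)>0$, $$Z(s):=\int_{\mathbb{Z}_p^n}\|F(x)\|^s|g(x)|\,|dx|=\sum_{\delta\in\Delta_{F,g}}L_\delta(s)S_\delta(s),$$ where the integral converges absolutely and $$L_\delta(s)=p^{-n}\left((p-1)^n-p^tN_\delta\frac{p^s-1}{p^{s+t}-1}-P_\delta\frac{p}{p+1}-pQ_\delta\frac{p^{t-1}(p^s(p+1)-1)-1}{(p^{s+t}-1)(p+1)}\right),$$ $$S_\delta(s)=\sum_{k\in\mathbb{N}^n\cap\delta}p^{-m_F(k)s-m_g(k)-\sigma(k)}\quad\text{(absolutely convergent, }0\in\mathbb{N}),$$ and $N_\delta$, $P_\delta$, $Q_\delta$ are the numbers of $a\in(\mathbb{F}_p^\times)^n$ with, respectively, $\overline{F_\delta}(a)=0\ne\overline{g_\delta}(a)$;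 $\overline{F_\delta}(a)\neq0=\overline{g_\delta}(a)$; $\overline{F_\delta}(a)=0$ and $\overline{g_\delta}(a)=0$. Moreover, each $S_\delta$ is, for $\operatorname{Re}(s)>0$, a rational function of $p^{-s}$ with rational coefficients. Explicitly: call $k\in\mathbb{N}^n$ primitive if its components have greatest common divisor one; if $\delta$ is partitioned into finitely many cones $\delta_i=\{\sum_{j}\lambda_jk_{i,j}\mid\lambda_j>0\}$, where for each $i$ the $k_{i,1},\dots,k_{i,r_i}\in\mathbb{N}^n$ are primitive and linearly independent, then for $\operatorname{Re}(s)>0$ $$S_\delta(s)=\sum_i\frac{\sum_hp^{m_F(h)s+m_g(h)+\sigma(h)}}{\prod_{j=1}^{r_i}\left(p^{m_F(k_{i,j})s+m_g(k_{i,j})+\sigma(k_{i,j})}-1\right)},$$ with $h$ running through $\mathbb{Z}^n\cap\{\sum_j\lambda_jk_{i,j}\mid0\le\lambda_j<1\}$. Such a partition exists in which every $k_{i,j}$ is a primitive generator of a ray (one-dimensional cone) in $\Delta_{F,g}$. Consequently $Z$ has a meromorphic continuation to $\mathbb{C}$, and the real part of each of its poles is either $-t$ or $$-\frac{m_g(k)+\sigma(k)}{m_F(k)}$$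 for some primitive generator $k$ of a ray in $\Delta_{F,g}$ with $m_F(k)\neq0$. -/

import Mathlib

noncomputable section

namespace IgusaZeta

open MvPolynomial MeasureTheory
open scoped Matrix Classical

/-! ### Convex geometry: Newton polyhedra, faces, cones -/

section Geometry

variable {n : ℕ}

/-- A vector of natural numbers, seen in `ℝⁿ`. -/
def natVec (k : Fin n → ℕ) : Fin n → ℝ := fun i => (k i : ℝ)

/-- A vector of integers, seen in `ℝⁿ`. -/
def intVec (k : Fin n → ℤ) : Fin n → ℝ := fun i => (k i : ℝ)

/-- The Newton polyhedron of a set `A` of exponents: the convex hull of the union of the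
orthants `ω + ℝ₊ⁿ`, for `ω ∈ A`. -/
def newtonPolyhedron (A : Set (Fin n →₀ ℕ)) : Set (Fin n → ℝ) :=
  convexHull ℝ (⋃ ω ∈ A, {x | ∃ v : Fin n → ℝ, 0 ≤ v ∧ x = natVec ω + v})

/-- `τ` is a face of `Γ`: it is `Γ` itself, or the intersection of `Γ` with a supporting
hyperplane `{x | u · x = c}`. -/
def IsFace (Γ τ : Set (Fin n → ℝ)) : Prop :=
  τ = Γ ∨ ∃ (u : Fin n → ℝ) (c : ℝ), u ≠ 0 ∧ (∀ x ∈ Γ, c ≤ u ⬝ᵥ x) ∧ (∃ x ∈ Γ, u ⬝ᵥ x = c) ∧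
    τ = {x | x ∈ Γ ∧ u ⬝ᵥ x = c}

/-- `m(k) = inf_{x ∈ Γ} k · x`. -/
def mVal (Γ : Set (Fin n → ℝ)) (k : Fin n → ℝ) : ℝ :=
  sInf ((fun x => k ⬝ᵥ x) '' Γ)

/-- The first meet locus `F(k) = {x ∈ Γ | k · x = m(k)}`. -/
def firstMeet (Γ : Set (Fin n → ℝ)) (k : Fin n → ℝ) : Set (Fin n → ℝ) :=
  {x | x ∈ Γ ∧ k ⬝ᵥ x = mVal Γ k}

/-- The cone `{k ∈ ℝ₊ⁿ | F(k) = τ}` associated to the face `τ` of `Γ`. -/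
def faceCone (Γ τ : Set (Fin n → ℝ)) : Set (Fin n → ℝ) :=
  {k | 0 ≤ k ∧ firstMeet Γ k = τ}

/-- The partition of `ℝ₊ⁿ` associated to two polyhedra: all the nonempty intersections of a cone
associated to a face of the first with a cone associated to a face of the second. -/
def conePartition (Γ Γ' : Set (Fin n → ℝ)) : Set (Set (Fin n → ℝ)) :=
  {δ | δ.Nonempty ∧ ∃ τ τ', IsFace Γ τ ∧ IsFace Γ' τ' ∧ δ = faceCone Γ τ ∩ faceCone Γ' τ'}

/-- The face of `Γ` associated to a cone `δ`: the common value of `F(k)` for `k ∈ δ`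
(see `assocFace_left` and `assocFace_right`). -/
def assocFace (Γ δ : Set (Fin n → ℝ)) : Set (Fin n → ℝ) :=
  ⋂ k ∈ δ, firstMeet Γ k

theorem assocFace_left {Γ Γ' τ τ' : Set (Fin n → ℝ)}
    (h : (faceCone Γ τ ∩ faceCone Γ' τ').Nonempty) :
    assocFace Γ (faceCone Γ τ ∩ faceCone Γ' τ') = τ := by
  obtain ⟨k, hk⟩ := h
  ext x
  simp only [assocFace, Set.mem_iInter]
  constructor
  · intro hx
    have := hx k hk
    rwa [hk.1.2] at this
  · intro hx l hl
    rw [hl.1.2]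
    exact hx

theorem assocFace_right {Γ Γ' τ τ' : Set (Fin n → ℝ)}
    (h : (faceCone Γ τ ∩ faceCone Γ' τ').Nonempty) :
    assocFace Γ' (faceCone Γ τ ∩ faceCone Γ' τ') = τ' := by
  rw [Set.inter_comm] at h ⊢
  exact assocFace_left h

/-- The cone `{λ₁ k₁ + ⋯ + λ_r k_r | λ_j > 0}` strictly positively spanned by `k₁, …, k_r`. -/
def spannedCone {r : ℕ} (k : Fin r → Fin n → ℕ) : Set (Fin n → ℝ) :=
  {x | ∃ c : Fin r → ℝ, (∀ j, 0 < c j) ∧ x = ∑ j, c j • natVec (k j)}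

/-- The integer points of the half-open box `{∑ λ_j k_j | 0 ≤ λ_j < 1}`. -/
def boxPoints {r : ℕ} (k : Fin r → Fin n → ℕ) : Set (Fin n → ℤ) :=
  {h | ∃ c : Fin r → ℝ, (∀ j, 0 ≤ c j ∧ c j < 1) ∧ intVec h = ∑ j, c j • natVec (k j)}

/-- A primitive vector of `ℕⁿ`: the gcd of its components is one (so it is not zero). -/
def IsPrimitive (k : Fin n → ℕ) : Prop :=
  Finset.univ.gcd k = 1

/-- `k` is the primitive generator of a ray (a one-dimensional cone) belonging to `Δ`. -/
def IsRayGenerator (Δ : Set (Set (Fin n → ℝ))) (k : Fin n → ℕ) : Prop :=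
  IsPrimitive k ∧ spannedCone (fun _ : Fin 1 => k) ∈ Δ

/-- `σ(k) = k₁ + ⋯ + k_n`. -/
def sigma (k : Fin n → ℝ) : ℝ := ∑ i, k i

/-- A finite partition of the cone `δ` into rational simplicial cones, the `i`-th of which is
strictly positively spanned by the linearly independent primitive vectors `gen i j`. -/
structure SimplicialPartition (δ : Set (Fin n → ℝ)) where
  size : ℕ
  r : Fin size → ℕ
  gen : (i : Fin size) → Fin (r i) → Fin n → ℕ
  primitive : ∀ i j, IsPrimitive (gen i j)
  linearIndependent : ∀ i, LinearIndependent ℝ (fun j => natVec (gen i j))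
  disjoint : ∀ i i', i ≠ i' → Disjoint (spannedCone (gen i)) (spannedCone (gen i'))
  union : ⋃ i, spannedCone (gen i) = δ

end Geometry

/-! ### Polynomial mappings, faces and non-degeneracy -/

section Polynomials

variable {n t p : ℕ} [Fact p.Prime]

/-- The Newton polyhedron of a polynomial `g`. -/
def polyNewton (g : MvPolynomial (Fin n) ℤ_[p]) : Set (Fin n → ℝ) :=
  newtonPolyhedron {ω | coeff ω g ≠ 0}

/-- The Newton polyhedron of a polynomial mapping `F = (f₁, …, f_t)`; the support of `F` is the
union of the supports of the `f_i`. -/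
def mapNewton (F : Fin t → MvPolynomial (Fin n) ℤ_[p]) : Set (Fin n → ℝ) :=
  newtonPolyhedron {ω | ∃ i, coeff ω (F i) ≠ 0}

/-- `f_τ = ∑_{ω ∈ τ} a_ω x^ω`. -/
def restrictFace (τ : Set (Fin n → ℝ)) (f : MvPolynomial (Fin n) ℤ_[p]) :
    MvPolynomial (Fin n) ℤ_[p] :=
  ∑ ω ∈ f.support.filter (fun ω : Fin n →₀ ℕ => natVec ω ∈ τ), monomial ω (coeff ω f)

/-- The reduction of `f_τ` modulo `p`. -/
def reducedFace (τ : Set (Fin n → ℝ)) (f : MvPolynomial (Fin n) ℤ_[p]) :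
    MvPolynomial (Fin n) (ZMod p) :=
  map PadicInt.toZMod (restrictFace τ f)

/-- The point of `𝔽_pⁿ` underlying a point of the torus `(𝔽_p^×)ⁿ`. -/
def torusPoint (a : Fin n → (ZMod p)ˣ) : Fin n → ZMod p := fun i => (a i : ZMod p)

/-- The Jacobian matrix `((∂h_i/∂x_j)(a))_{i,j}`. -/
def jacobian {ι : Type} (h : ι → MvPolynomial (Fin n) (ZMod p)) (a : Fin n → ZMod p) :
    Matrix ι (Fin n) (ZMod p) :=
  Matrix.of fun i j => eval a (pderiv j (h i))

/-- `g` is non-degenerated over `𝔽_p` with respect to all the faces of its Newton polyhedron. -/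
def NonDegenerated (g : MvPolynomial (Fin n) ℤ_[p]) : Prop :=
  ∀ τ, IsFace (polyNewton g) τ → ¬ ∃ a : Fin n → (ZMod p)ˣ,
    eval (torusPoint a) (reducedFace τ g) = 0 ∧
      ∀ j, eval (torusPoint a) (pderiv j (reducedFace τ g)) = 0

/-- `F` is strongly non-degenerated over `𝔽_p` with respect to all the faces of its Newton
polyhedron. -/
def StronglyNonDegenerated (F : Fin t → MvPolynomial (Fin n) ℤ_[p]) : Prop :=
  ∀ τ, IsFace (mapNewton F) τ → ∀ a : Fin n → (ZMod p)ˣ,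
    (∀ i, eval (torusPoint a) (reducedFace τ (F i)) = 0) →
      (jacobian (fun i => reducedFace τ (F i)) (torusPoint a)).rank = min t n

/-- The partition `Δ_{F,g}` of `ℝ₊ⁿ` associated to `F` and `g`. -/
def pairPartition (F : Fin t → MvPolynomial (Fin n) ℤ_[p]) (g : MvPolynomial (Fin n) ℤ_[p]) :
    Set (Set (Fin n → ℝ)) :=
  conePartition (mapNewton F) (polyNewton g)

/-- The reduction modulo `p` of `F_δ = (f_{1,δ}, …, f_{t,δ})`. -/
def mapDelta (F : Fin t → MvPolynomial (Fin n) ℤ_[p]) (δ : Set (Fin n → ℝ)) :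
    Fin t → MvPolynomial (Fin n) (ZMod p) :=
  fun i => reducedFace (assocFace (mapNewton F) δ) (F i)

/-- The reduction modulo `p` of `g_δ`. -/
def polyDelta (g : MvPolynomial (Fin n) ℤ_[p]) (δ : Set (Fin n → ℝ)) :
    MvPolynomial (Fin n) (ZMod p) :=
  reducedFace (assocFace (polyNewton g) δ) g

/-- `(F, g)` is strongly non-degenerated over `𝔽_p` with respect to all the cones of `Δ_{F,g}`:
the Jacobian matrix of `(f_{1,δ}, …, f_{t,δ}, g_δ)` has rank `t + 1` at all the common zeros in
the torus. -/
def PairStronglyNonDegenerated (F : Fin t → MvPolynomial (Fin n) ℤ_[p])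
    (g : MvPolynomial (Fin n) ℤ_[p]) : Prop :=
  ∀ δ ∈ pairPartition F g, ∀ a : Fin n → (ZMod p)ˣ,
    (∀ i, eval (torusPoint a) (mapDelta F δ i) = 0) → eval (torusPoint a) (polyDelta g δ) = 0 →
      (jacobian (Sum.elim (mapDelta F δ) (fun _ : Unit => polyDelta g δ))
        (torusPoint a)).rank = t + 1

/-- `N_δ`: the number of points of the torus where `F_δ` vanishes and `g_δ` does not. -/
def countN (F : Fin t → MvPolynomial (Fin n) ℤ_[p]) (g : MvPolynomial (Fin n) ℤ_[p])
    (δ : Set (Fin n → ℝ)) : ℕ :=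
  Set.ncard {a : Fin n → (ZMod p)ˣ | (∀ i, eval (torusPoint a) (mapDelta F δ i) = 0) ∧
    eval (torusPoint a) (polyDelta g δ) ≠ 0}

/-- `P_δ`: the number of points of the torus where `g_δ` vanishes and `F_δ` does not. -/
def countP (F : Fin t → MvPolynomial (Fin n) ℤ_[p]) (g : MvPolynomial (Fin n) ℤ_[p])
    (δ : Set (Fin n → ℝ)) : ℕ :=
  Set.ncard {a : Fin n → (ZMod p)ˣ | (¬ ∀ i, eval (torusPoint a) (mapDelta F δ i) = 0) ∧
    eval (torusPoint a) (polyDelta g δ) = 0}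

/-- `Q_δ`: the number of points of the torus where both `F_δ` and `g_δ` vanish. -/
def countQ (F : Fin t → MvPolynomial (Fin n) ℤ_[p]) (g : MvPolynomial (Fin n) ℤ_[p])
    (δ : Set (Fin n → ℝ)) : ℕ :=
  Set.ncard {a : Fin n → (ZMod p)ˣ | (∀ i, eval (torusPoint a) (mapDelta F δ i) = 0) ∧
    eval (torusPoint a) (polyDelta g δ) = 0}

/-! ### The zeta function and the terms of the formula -/

/-- `ℤ_pⁿ` as a subset of `ℚ_pⁿ`. -/
def integralBox (p n : ℕ) [Fact p.Prime] : Set (Fin n → ℚ_[p]) :=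
  {x | ∀ i, ‖x i‖ ≤ 1}

/-- The integrand `‖F(x)‖^s |g(x)|`, where `‖F(x)‖ = max_i |f_i(x)|` (the norm of
`Fin t → ℚ_[p]` is the maximum norm). -/
def zetaIntegrand (F : Fin t → MvPolynomial (Fin n) ℤ_[p]) (g : MvPolynomial (Fin n) ℤ_[p])
    (s : ℂ) (x : Fin n → ℚ_[p]) : ℂ :=
  ((‖(fun i => aeval x (F i) : Fin t → ℚ_[p])‖ : ℝ) : ℂ) ^ s * ((‖aeval x g‖ : ℝ) : ℂ)

/-- Igusa's local zeta function `∫_{ℤ_pⁿ} ‖F(x)‖^s |g(x)| |dx|`. -/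
def zeta [MeasurableSpace ℚ_[p]] (μ : Measure (Fin n → ℚ_[p]))
    (F : Fin t → MvPolynomial (Fin n) ℤ_[p]) (g : MvPolynomial (Fin n) ℤ_[p]) (s : ℂ) : ℂ :=
  ∫ x in integralBox p n, zetaIntegrand F g s x ∂μ

/-- The factor `L_δ`. -/
def L (F : Fin t → MvPolynomial (Fin n) ℤ_[p]) (g : MvPolynomial (Fin n) ℤ_[p])
    (δ : Set (Fin n → ℝ)) (s : ℂ) : ℂ :=
  ((p : ℂ) ^ n)⁻¹ *
    (((p : ℂ) - 1) ^ n
      - (p : ℂ) ^ t * (countN F g δ : ℂ) * (((p : ℂ) ^ s - 1) / ((p : ℂ) ^ (s + (t : ℂ)) - 1))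
      - (countP F g δ : ℂ) * ((p : ℂ) / ((p : ℂ) + 1))
      - (p : ℂ) * (countQ F g δ : ℂ) *
          (((p : ℂ) ^ ((t : ℤ) - 1) * ((p : ℂ) ^ s * ((p : ℂ) + 1) - 1) - 1) /
            (((p : ℂ) ^ (s + (t : ℂ)) - 1) * ((p : ℂ) + 1))))

/-- The exponent `m_F(k) s + m_g(k) + σ(k)`. -/
def expo (F : Fin t → MvPolynomial (Fin n) ℤ_[p]) (g : MvPolynomial (Fin n) ℤ_[p])
    (s : ℂ) (k : Fin n → ℝ) : ℂ :=
  (mVal (mapNewton F) k : ℂ) * s + (mVal (polyNewton g) k : ℂ) + (sigma k : ℂ)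

/-- The term `p^{-m_F(k) s - m_g(k) - σ(k)}` of the series `S_δ`, for `k ∈ ℕⁿ ∩ δ`. -/
def STerm (F : Fin t → MvPolynomial (Fin n) ℤ_[p]) (g : MvPolynomial (Fin n) ℤ_[p])
    (δ : Set (Fin n → ℝ)) (s : ℂ) (k : {k : Fin n → ℕ // natVec k ∈ δ}) : ℂ :=
  (p : ℂ) ^ (-expo F g s (natVec k.1))

/-- `S_δ = ∑_{k ∈ ℕⁿ ∩ δ} p^{-m_F(k) s - m_g(k) - σ(k)}`. -/
def S (F : Fin t → MvPolynomial (Fin n) ℤ_[p]) (g : MvPolynomial (Fin n) ℤ_[p])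
    (δ : Set (Fin n → ℝ)) (s : ℂ) : ℂ :=
  ∑' k, STerm F g δ s k

/-- The closed expression for `S_δ` attached to a partition of `δ` into rational simplicial
cones. -/
def closedS (F : Fin t → MvPolynomial (Fin n) ℤ_[p]) (g : MvPolynomial (Fin n) ℤ_[p])
    {δ : Set (Fin n → ℝ)} (D : SimplicialPartition δ) (s : ℂ) : ℂ :=
  ∑ i, (∑ᶠ h ∈ boxPoints (D.gen i), (p : ℂ) ^ expo F g s (intVec h)) /
    ∏ j, ((p : ℂ) ^ expo F g s (natVec (D.gen i j)) - 1)

end Polynomials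

end IgusaZeta

end

open IgusaZeta

noncomputable section
namespace IgusaZeta
open MvPolynomial MeasureTheory
open scoped Matrix Classical

/-! ### Newton polyhedra, their faces, and the cells as cones cut out by integer linear forms -/

section NewtonPolyhedra
variable {n : ℕ}

/-! Analytic half. Up to a null set, `ℤ_pⁿ` is the disjoint union over `k ∈ ℕⁿ` of the shells of
points whose coordinates have valuations `k` (`hasSum_shell`). On such a shell put `x_i = p^{k_i}
u_i` with `u` in the unit torus; this costs a factor `p^{-σ(k)}`. If `k` lies in the cell `δ`, then
`F(x)` is `p^{m_F(k)}` times a polynomial mapping in `u` whose reduction modulo `p` is that of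
`F_δ`, and similarly for `g` (`map_rescale`). Hence the shell contributes `p^{-m_F(k)s - m_g(k) -
σ(k)}` times an integral over the torus, and the latter depends on `δ` only.

To compute it, cut the torus into residue classes modulo `p`. On each class, non-degeneracy and
Hensel's lemma in several variables allow the components that vanish modulo `p` to be replaced by
coordinates (`exists_setIntegral_comp_evalMap`). What remains is the integral of `‖(y_1, …, y_t)‖^s
|y_{t+1}|`, or of one of its factors, over `pℤ_pⁿ`; its value follows from self-similarity under
multiplication by `p` (`integral_norm_cpow_mul`). Each class has measure `p^{-n}` and weight `1`,
`(p^t-1)/(p^{s+t}-1)`, `1/(p+1)`, or the product of the last two. Counting classes gives `L_δ`, and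
summing over `k ∈ δ` gives `L_δ S_δ`.

Convex half. The face selected by `k` is determined by the zero coordinates of `k` and the exponents
minimizing `k · ω`, so there are finitely many cells, and each is the relative interior of a cone
given by integer linear inequalities. The closed cone is generated by its extreme rays
(`mem_of_extreme_mem`), which are rational and are themselves cells. It is triangulated without new
rays: among all nonnegative representations of a point by the generators, take the lexicographically
largest. It is unique, it uses linearly independent generators, and its optimality depends on its
support only; the open cones on these supports partition the cell. On a simplicial cone `m_F` and
`m_g` are linear, and every lattice point is uniquely `∑ (N_j + 1) k_j - h` with `h` in the
half-open box, so `S_δ` becomes a finite sum times a product of geometric series.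

The resulting expression is meromorphic on `ℂ`. Its denominators vanish only where `s + t` or some
`m_F(k)s + m_g(k) + σ(k)` has real part zero, with `k` a ray generator. If `m_F(k) = 0`, the second
is a positive constant, so there is no pole. -/

theorem add_mem_newtonPolyhedron {A : Set (Fin n →₀ ℕ)} {ω : Fin n →₀ ℕ} (hω : ω ∈ A)
    {v : Fin n → ℝ} (hv : 0 ≤ v) : natVec ω + v ∈ newtonPolyhedron A :=
  subset_convexHull ℝ _ (Set.mem_biUnion hω ⟨v, hv, rfl⟩)

theorem natVec_mem_newtonPolyhedron {A : Set (Fin n →₀ ℕ)} {ω : Fin n →₀ ℕ} (hω : ω ∈ A) :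
    natVec ω ∈ newtonPolyhedron A := by
  simpa using add_mem_newtonPolyhedron hω (le_refl (0 : Fin n → ℝ))

theorem natVec_nonneg (k : Fin n → ℕ) : 0 ≤ natVec k := fun i => Nat.cast_nonneg (k i)

/-- A half-space is convex, and since `k ≥ 0` it contains the whole orthant at `ω` as soon as it
contains `ω`. So minima over the polyhedron are minima over the exponents. -/
theorem le_dotProduct_of_mem_newtonPolyhedron {A : Set (Fin n →₀ ℕ)} {k : Fin n → ℝ} (hk : 0 ≤ k)
    {c : ℝ} (h : ∀ ω ∈ A, c ≤ k ⬝ᵥ natVec ω) {x : Fin n → ℝ} (hx : x ∈ newtonPolyhedron A) :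
    c ≤ k ⬝ᵥ x := by
  have hconv : Convex ℝ {x : Fin n → ℝ | c ≤ k ⬝ᵥ x} := by
    intro x hx y hy a b ha hb hab
    simp only [Set.mem_ofPred_eq, dotProduct_add, dotProduct_smul, smul_eq_mul] at *
    have e : a * c + b * c = c := by rw [← add_mul, hab, one_mul]
    linarith [mul_le_mul_of_nonneg_left hx ha, mul_le_mul_of_nonneg_left hy hb]
  refine convexHull_min ?_ hconv hx
  intro y hy
  obtain ⟨ω, hω, v, hv, rfl⟩ := Set.mem_iUnion₂.1 hy
  rw [Set.mem_ofPred_eq, dotProduct_add]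
  have := h ω hω
  have := dotProduct_nonneg_of_nonneg hk hv
  linarith

theorem mVal_eq_of_isMin {A : Set (Fin n →₀ ℕ)} {k : Fin n → ℝ} (hk : 0 ≤ k) {ω : Fin n →₀ ℕ}
    (hω : ω ∈ A) (h : ∀ ω' ∈ A, k ⬝ᵥ natVec ω ≤ k ⬝ᵥ natVec ω') :
    mVal (newtonPolyhedron A) k = k ⬝ᵥ natVec ω := by
  refine IsLeast.csInf_eq ⟨⟨_, natVec_mem_newtonPolyhedron hω, rfl⟩, ?_⟩
  rintro _ ⟨x, hx, rfl⟩
  exact le_dotProduct_of_mem_newtonPolyhedron hk h hx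

theorem exists_mVal_eq {A : Set (Fin n →₀ ℕ)} (hA : A.Finite) (hA' : A.Nonempty) {k : Fin n → ℝ}
    (hk : 0 ≤ k) : ∃ ω ∈ A, mVal (newtonPolyhedron A) k = k ⬝ᵥ natVec ω := by
  obtain ⟨ω, hω, h⟩ := Set.exists_min_image A (fun ω => k ⬝ᵥ natVec ω) hA hA'
  exact ⟨ω, hω, mVal_eq_of_isMin hk hω h⟩

theorem mVal_le {A : Set (Fin n →₀ ℕ)} (hA : A.Finite) {k : Fin n → ℝ}
    (hk : 0 ≤ k) {x : Fin n → ℝ} (hx : x ∈ newtonPolyhedron A) :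
    mVal (newtonPolyhedron A) k ≤ k ⬝ᵥ x := by
  have hA' : A.Nonempty := by
    rw [Set.nonempty_iff_ne_empty]
    rintro rfl
    simp [newtonPolyhedron] at hx
  obtain ⟨ω, hω, h⟩ := Set.exists_min_image A (fun ω => k ⬝ᵥ natVec ω) hA hA'
  rw [mVal_eq_of_isMin hk hω h]
  exact le_dotProduct_of_mem_newtonPolyhedron hk h hx

theorem mVal_le_natVec {A : Set (Fin n →₀ ℕ)} (hA : A.Finite) {k : Fin n → ℝ}
    (hk : 0 ≤ k) {ω : Fin n →₀ ℕ} (hω : ω ∈ A) :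
    mVal (newtonPolyhedron A) k ≤ k ⬝ᵥ natVec ω :=
  mVal_le hA hk (natVec_mem_newtonPolyhedron hω)

/-- The points with `k · x ≥ m` at which `k · x = m` forces `k' · x = m'` form a convex set: a
proper convex combination attains the minimum only if both of its terms do. It therefore suffices to
test the points `ω + v`, where equality forces `v` to be supported on the zero coordinates of `k`.
-/
theorem firstMeet_subset {A : Set (Fin n →₀ ℕ)} (hA : A.Finite) {k k' : Fin n → ℝ}
    (hk : 0 ≤ k) (h0 : ∀ i, k i = 0 → k' i = 0)
    (h : ∀ ω ∈ A, k ⬝ᵥ natVec ω = mVal (newtonPolyhedron A) k →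
      k' ⬝ᵥ natVec ω = mVal (newtonPolyhedron A) k') :
    firstMeet (newtonPolyhedron A) k ⊆ firstMeet (newtonPolyhedron A) k' := by
  set m := mVal (newtonPolyhedron A) k
  set m' := mVal (newtonPolyhedron A) k'
  have hconv : Convex ℝ {x : Fin n → ℝ | m ≤ k ⬝ᵥ x ∧ (k ⬝ᵥ x = m → k' ⬝ᵥ x = m')} := by
    rw [convex_iff_forall_pos]
    rintro x ⟨hx, hx'⟩ y ⟨hy, hy'⟩ a b ha hb hab
    simp only [Set.mem_ofPred_eq, dotProduct_add, dotProduct_smul, smul_eq_mul]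
    have e : a * m + b * m = m := by rw [← add_mul, hab, one_mul]
    have ex := mul_le_mul_of_nonneg_left hx ha.le
    have ey := mul_le_mul_of_nonneg_left hy hb.le
    refine ⟨by linarith, fun hz => ?_⟩
    have h1 : k ⬝ᵥ x = m := mul_left_cancel₀ ha.ne' (by linarith)
    have h2 : k ⬝ᵥ y = m := mul_left_cancel₀ hb.ne' (by linarith)
    rw [hx' h1, hy' h2, ← add_mul, hab, one_mul]
  rintro x ⟨hx, hxm⟩
  refine ⟨hx, ?_⟩
  refine (convexHull_min ?_ hconv hx).2 hxm
  intro y hy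
  obtain ⟨ω, hω, v, hv, rfl⟩ := Set.mem_iUnion₂.1 hy
  have h1 : m ≤ k ⬝ᵥ natVec ω := mVal_le_natVec hA hk hω
  have h2 := dotProduct_nonneg_of_nonneg hk hv
  simp only [Set.mem_ofPred_eq, dotProduct_add]
  refine ⟨by linarith, fun hz => ?_⟩
  have h3 : k ⬝ᵥ v = 0 := by linarith
  have h4 : k' ⬝ᵥ v = 0 := by
    rw [dotProduct, Finset.sum_eq_zero_iff_of_nonneg
      (fun i _ => mul_nonneg (hk i) (hv i))] at h3
    refine Finset.sum_eq_zero fun i hi => ?_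
    rcases mul_eq_zero.1 (h3 i hi) with h5 | h5
    · rw [h0 i h5, zero_mul]
    · rw [h5, mul_zero]
  rw [h4, add_zero]
  exact h ω hω (by linarith)

theorem natVec_mem_firstMeet {A : Set (Fin n →₀ ℕ)} {k : Fin n → ℝ} {ω : Fin n →₀ ℕ}
    (hω : ω ∈ A) : natVec ω ∈ firstMeet (newtonPolyhedron A) k ↔
      k ⬝ᵥ natVec ω = mVal (newtonPolyhedron A) k :=
  ⟨fun h => h.2, fun h => ⟨natVec_mem_newtonPolyhedron hω, h⟩⟩

/-- This reduces a face to finite combinatorial data: its recession directions, which are the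
coordinate directions where `k` vanishes, and the exponents lying on it. -/
theorem firstMeet_eq_iff {A : Set (Fin n →₀ ℕ)} (hA : A.Finite) (hA' : A.Nonempty)
    {k k' : Fin n → ℝ} (hk : 0 ≤ k) (hk' : 0 ≤ k') :
    firstMeet (newtonPolyhedron A) k = firstMeet (newtonPolyhedron A) k' ↔
      (∀ i, k i = 0 ↔ k' i = 0) ∧ ∀ ω ∈ A, k ⬝ᵥ natVec ω = mVal (newtonPolyhedron A) k ↔
        k' ⬝ᵥ natVec ω = mVal (newtonPolyhedron A) k' := by
  constructor
  · intro h
    have key : ∀ {k k' : Fin n → ℝ}, 0 ≤ k → 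
        firstMeet (newtonPolyhedron A) k = firstMeet (newtonPolyhedron A) k' →
        ∀ i, k i = 0 → k' i = 0 := by
      intro k k' hk h i hi
      obtain ⟨ω, hω, hm⟩ := exists_mVal_eq hA hA' hk
      have h1 : natVec ω ∈ firstMeet (newtonPolyhedron A) k :=
        (natVec_mem_firstMeet hω).2 hm.symm
      -- When `k i = 0`, the face is stable under translation by the `i`-th unit vector; the same
      -- must then hold for the face of `k'`.
      have h2 : natVec ω + Pi.single i 1 ∈ firstMeet (newtonPolyhedron A) k := by
        refine ⟨add_mem_newtonPolyhedron hω (by simp), ?_⟩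
        rw [dotProduct_add, hm, dotProduct_single, hi]
        simp
      rw [h] at h1 h2
      have := h2.2
      rw [dotProduct_add, h1.2, dotProduct_single] at this
      linarith
    refine ⟨fun i => ⟨key hk h i, key hk' h.symm i⟩, fun ω hω => ?_⟩
    rw [← natVec_mem_firstMeet hω, ← natVec_mem_firstMeet hω, h]
  · rintro ⟨h1, h2⟩
    exact (firstMeet_subset hA hk (fun i => (h1 i).1) fun ω hω => (h2 ω hω).1).antisymm
      (firstMeet_subset hA hk' (fun i => (h1 i).2) fun ω hω => (h2 ω hω).2)

theorem isFace_firstMeet {A : Set (Fin n →₀ ℕ)} (hA : A.Finite) (hA' : A.Nonempty)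
    {k : Fin n → ℝ} (hk : 0 ≤ k) :
    IsFace (newtonPolyhedron A) (firstMeet (newtonPolyhedron A) k) := by
  obtain ⟨ω, hω, hm⟩ := exists_mVal_eq hA hA' hk
  by_cases h0 : k = 0
  · left
    ext x
    simp only [firstMeet, Set.mem_ofPred_eq, and_iff_left_iff_imp]
    rw [hm, h0]
    simp
  · exact Or.inr ⟨k, mVal (newtonPolyhedron A) k, h0, fun x hx => mVal_le hA hk hx,
      ⟨natVec ω, natVec_mem_newtonPolyhedron hω, hm.symm⟩, rfl⟩

/-- The cell of `ℝ₊ⁿ` containing `k`. -/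
def cellOf (Γ Γ' : Set (Fin n → ℝ)) (k : Fin n → ℝ) : Set (Fin n → ℝ) :=
  faceCone Γ (firstMeet Γ k) ∩ faceCone Γ' (firstMeet Γ' k)

theorem mem_cellOf_self {Γ Γ' : Set (Fin n → ℝ)} {k : Fin n → ℝ} (hk : 0 ≤ k) :
    k ∈ cellOf Γ Γ' k := ⟨⟨hk, rfl⟩, ⟨hk, rfl⟩⟩

theorem mem_cellOf {Γ Γ' : Set (Fin n → ℝ)} {k x : Fin n → ℝ} :
    x ∈ cellOf Γ Γ' k ↔ 0 ≤ x ∧ firstMeet Γ x = firstMeet Γ k ∧ firstMeet Γ' x = firstMeet Γ' k := by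
  simp only [cellOf, faceCone, Set.mem_inter_iff, Set.mem_ofPred_eq]
  tauto

theorem eq_cellOf_of_mem {Γ Γ' δ : Set (Fin n → ℝ)} (hδ : δ ∈ conePartition Γ Γ')
    {k : Fin n → ℝ} (hk : k ∈ δ) : δ = cellOf Γ Γ' k := by
  obtain ⟨-, τ, τ', -, -, rfl⟩ := hδ
  rw [cellOf, hk.1.2, hk.2.2]

theorem nonneg_of_mem {Γ Γ' δ : Set (Fin n → ℝ)} (hδ : δ ∈ conePartition Γ Γ')
    {k : Fin n → ℝ} (hk : k ∈ δ) : 0 ≤ k := by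
  obtain ⟨-, τ, τ', -, -, rfl⟩ := hδ
  exact hk.1.1

theorem cellOf_mem_conePartition {A A' : Set (Fin n →₀ ℕ)} (hA : A.Finite) (hA0 : A.Nonempty)
    (hA' : A'.Finite) (hA0' : A'.Nonempty) {k : Fin n → ℝ} (hk : 0 ≤ k) :
    cellOf (newtonPolyhedron A) (newtonPolyhedron A') k ∈
      conePartition (newtonPolyhedron A) (newtonPolyhedron A') :=
  ⟨⟨k, mem_cellOf_self hk⟩, _, _, isFace_firstMeet hA hA0 hk, isFace_firstMeet hA' hA0' hk, rfl⟩

theorem assocFace_eq_left {Γ Γ' δ : Set (Fin n → ℝ)} (hδ : δ ∈ conePartition Γ Γ')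
    {k : Fin n → ℝ} (hk : k ∈ δ) : assocFace Γ δ = firstMeet Γ k := by
  rw [eq_cellOf_of_mem hδ hk]
  exact assocFace_left ⟨k, mem_cellOf_self (nonneg_of_mem hδ hk)⟩

theorem assocFace_eq_right {Γ Γ' δ : Set (Fin n → ℝ)} (hδ : δ ∈ conePartition Γ Γ')
    {k : Fin n → ℝ} (hk : k ∈ δ) : assocFace Γ' δ = firstMeet Γ' k := by
  rw [eq_cellOf_of_mem hδ hk]
  exact assocFace_right ⟨k, mem_cellOf_self (nonneg_of_mem hδ hk)⟩

theorem conePartition_finite {A A' : Set (Fin n →₀ ℕ)} (hA : A.Finite) (hA0 : A.Nonempty)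
    (hA' : A'.Finite) (hA0' : A'.Nonempty) :
    (conePartition (newtonPolyhedron A) (newtonPolyhedron A')).Finite := by
  -- The invariants of `firstMeet_eq_iff` for both polyhedra; they take finitely many values and
  -- separate the cells.
  let φ : (Fin n → ℝ) → Set (Fin n) × Set (Fin n →₀ ℕ) × Set (Fin n →₀ ℕ) := fun k =>
    ({i | k i = 0}, {ω ∈ A | k ⬝ᵥ natVec ω = mVal (newtonPolyhedron A) k},
      {ω ∈ A' | k ⬝ᵥ natVec ω = mVal (newtonPolyhedron A') k})
  have hfin : (Set.univ ×ˢ ({B | B ⊆ A} ×ˢ {B | B ⊆ A'}) :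
      Set (Set (Fin n) × Set (Fin n →₀ ℕ) × Set (Fin n →₀ ℕ))).Finite :=
    Set.finite_univ.prod (hA.finite_subsets.prod hA'.finite_subsets)
  choose! κ hκ using fun δ (hδ : δ ∈ conePartition (newtonPolyhedron A) (newtonPolyhedron A')) =>
    hδ.1
  refine Set.Finite.of_injOn (f := fun δ => φ (κ δ)) ?_ ?_ hfin
  · intro δ hδ
    exact ⟨Set.mem_univ _, fun ω hω => hω.1, fun ω hω => hω.1⟩
  · intro δ hδ δ' hδ' h
    have h1 := nonneg_of_mem hδ (hκ δ hδ)
    have h2 := nonneg_of_mem hδ' (hκ δ' hδ')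
    simp only [φ, Prod.mk.injEq, Set.ext_iff, Set.mem_ofPred_eq, and_congr_right_iff] at h
    rw [eq_cellOf_of_mem hδ (hκ δ hδ), eq_cellOf_of_mem hδ' (hκ δ' hδ'), cellOf, cellOf,
      (firstMeet_eq_iff hA hA0 h1 h2).2 ⟨h.1, h.2.1⟩,
      (firstMeet_eq_iff hA' hA0' h1 h2).2 ⟨h.1, h.2.2⟩]

/-- `ω` minimizes `k · ω` over `A`. -/
theorem isMin_iff_mVal {A : Set (Fin n →₀ ℕ)} (hA : A.Finite) {k : Fin n → ℝ} (hk : 0 ≤ k)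
    {ω : Fin n →₀ ℕ} (hω : ω ∈ A) : k ⬝ᵥ natVec ω = mVal (newtonPolyhedron A) k ↔
      ∀ ω' ∈ A, k ⬝ᵥ natVec ω ≤ k ⬝ᵥ natVec ω' :=
  ⟨fun h _ hω' => h ▸ mVal_le_natVec hA hk hω', fun h => (mVal_eq_of_isMin hk hω h).symm⟩

/-- The linear forms with integer coefficients cutting out the closure of the cell of a vector
minimized by the exponents `ω₀ ∈ A` and `ω₀' ∈ A'`. -/
def cellForm (A A' : Set (Fin n →₀ ℕ)) (ω₀ ω₀' : Fin n →₀ ℕ) :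
    Fin n ⊕ A ⊕ A' → Fin n → ℤ
  | .inl i => Pi.single i 1
  | .inr (.inl ω) => fun i => (ω.1 i : ℤ) - ω₀ i
  | .inr (.inr ω) => fun i => (ω.1 i : ℤ) - ω₀' i

theorem intVec_single_dotProduct (i : Fin n) (x : Fin n → ℝ) :
    intVec (Pi.single i 1) ⬝ᵥ x = x i := by
  have : intVec (Pi.single i 1) = Pi.single i (1 : ℝ) := by
    ext j
    by_cases h : j = i
    · subst h; simp [intVec]
    · simp [intVec, h]
  rw [this, single_dotProduct, one_mul]

theorem intVec_sub_dotProduct (ω ω' : Fin n →₀ ℕ) (x : Fin n → ℝ) :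
    intVec (fun i => (ω i : ℤ) - ω' i) ⬝ᵥ x = x ⬝ᵥ natVec ω - x ⬝ᵥ natVec ω' := by
  rw [dotProduct_comm, ← dotProduct_sub]
  congr 1
  ext j
  simp [intVec, natVec]

theorem cellForm_nonneg_iff {A A' : Set (Fin n →₀ ℕ)} (hA : A.Finite) (hA' : A'.Finite)
    {ω₀ ω₀' : Fin n →₀ ℕ} (h0 : ω₀ ∈ A) (h0' : ω₀' ∈ A') {k : Fin n → ℝ} :
    (∀ i, 0 ≤ intVec (cellForm A A' ω₀ ω₀' i) ⬝ᵥ k) ↔ 0 ≤ k ∧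
      k ⬝ᵥ natVec ω₀ = mVal (newtonPolyhedron A) k ∧
      k ⬝ᵥ natVec ω₀' = mVal (newtonPolyhedron A') k := by
  simp only [Sum.forall, cellForm, intVec_single_dotProduct, intVec_sub_dotProduct, sub_nonneg,
    Subtype.forall]
  constructor
  · rintro ⟨h1, h2, h3⟩
    exact ⟨h1, (isMin_iff_mVal hA h1 h0).2 h2, (isMin_iff_mVal hA' h1 h0').2 h3⟩
  · rintro ⟨h1, h2, h3⟩
    exact ⟨h1, (isMin_iff_mVal hA h1 h0).1 h2, (isMin_iff_mVal hA' h1 h0').1 h3⟩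

/-- Once a minimizing exponent is fixed for each polyhedron, the zero coordinates and the minimizing
exponents are exactly the forms that vanish. A cell is thus the relative interior of a face of the
cone where all the forms are nonnegative. -/
theorem mem_cellOf_iff_cellForm {A A' : Set (Fin n →₀ ℕ)} (hA : A.Finite) (hA' : A'.Finite)
    {ω₀ ω₀' : Fin n →₀ ℕ} (h0 : ω₀ ∈ A) (h0' : ω₀' ∈ A') {k₀ k : Fin n → ℝ}
    (hk₀ : ∀ i, 0 ≤ intVec (cellForm A A' ω₀ ω₀' i) ⬝ᵥ k₀) :
    k ∈ cellOf (newtonPolyhedron A) (newtonPolyhedron A') k₀ ↔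
      ∀ i, 0 ≤ intVec (cellForm A A' ω₀ ω₀' i) ⬝ᵥ k ∧
        (intVec (cellForm A A' ω₀ ω₀' i) ⬝ᵥ k = 0 ↔
          intVec (cellForm A A' ω₀ ω₀' i) ⬝ᵥ k₀ = 0) := by
  rw [forall_and, cellForm_nonneg_iff hA hA' h0 h0', mem_cellOf]
  obtain ⟨hk₀, hm, hm'⟩ := (cellForm_nonneg_iff hA hA' h0 h0').1 hk₀
  simp only [Sum.forall, cellForm, intVec_single_dotProduct, intVec_sub_dotProduct,
    Subtype.forall]
  constructor
  · rintro ⟨hk, h, h'⟩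
    rw [firstMeet_eq_iff hA ⟨_, h0⟩ hk hk₀] at h
    rw [firstMeet_eq_iff hA' ⟨_, h0'⟩ hk hk₀] at h'
    have e := (h.2 _ h0).2 hm
    have e' := (h'.2 _ h0').2 hm'
    refine ⟨⟨hk, e, e'⟩, h.1, fun ω hω => ?_, fun ω hω => ?_⟩
    · rw [e, hm, sub_eq_zero, sub_eq_zero]
      exact h.2 ω hω
    · rw [e', hm', sub_eq_zero, sub_eq_zero]
      exact h'.2 ω hω
  · rintro ⟨⟨hk, e, e'⟩, h1, h2, h3⟩
    refine ⟨hk, (firstMeet_eq_iff hA ⟨_, h0⟩ hk hk₀).2 ⟨h1, fun ω hω => ?_⟩,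
      (firstMeet_eq_iff hA' ⟨_, h0'⟩ hk hk₀).2 ⟨h1, fun ω hω => ?_⟩⟩
    · have := h2 ω hω
      rwa [e, hm, sub_eq_zero, sub_eq_zero] at this
    · have := h3 ω hω
      rwa [e', hm', sub_eq_zero, sub_eq_zero] at this

end NewtonPolyhedra

/-! ### Triangulating a cone without new rays, by lexicographic optimization -/

section Triangulation
variable {n m : ℕ}

/-- `d` is lexicographically positive. -/
def LexPos (d : Fin m → ℝ) : Prop := ∃ j, (∀ i < j, d i = 0) ∧ 0 < d j

theorem lexPos_or_lexPos_neg {d : Fin m → ℝ} (hd : d ≠ 0) : LexPos d ∨ LexPos (-d) := by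
  obtain ⟨j₀, hj₀⟩ := Function.ne_iff.1 hd
  have hs : (Finset.univ.filter fun j => d j ≠ 0).Nonempty := ⟨j₀, by simpa using hj₀⟩
  set j := (Finset.univ.filter fun j => d j ≠ 0).min' hs
  have hj : d j ≠ 0 := (Finset.mem_filter.1 (Finset.min'_mem _ hs)).2
  have hlt : ∀ i < j, d i = 0 := fun i hi => by
    by_contra h
    exact absurd (Finset.min'_le _ i (by simpa using h)) (not_le.2 hi)
  rcases lt_or_gt_of_ne hj with h | h
  · exact Or.inr ⟨j, fun i hi => by simp [hlt i hi], by simpa using h⟩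
  · exact Or.inl ⟨j, hlt, h⟩

theorem LexPos.smul {d : Fin m → ℝ} (hd : LexPos d) {ε : ℝ} (hε : 0 < ε) : LexPos (ε • d) := by
  obtain ⟨j, h1, h2⟩ := hd
  exact ⟨j, fun i hi => by simp [h1 i hi], by simpa using mul_pos hε h2⟩

/-- A nonempty compact set has a lexicographically maximal element. -/
theorem exists_lexMax {K : Set (Fin m → ℝ)} (hK : IsCompact K) (hK0 : K.Nonempty) :
    ∃ c ∈ K, ∀ c' ∈ K, ¬ LexPos (c' - c) := by
  -- Maximize the coordinates one after another: `S` consists of the points of `K` that are maximal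
  -- for the first `k` coordinates, and each maximization leaves a nonempty compact set.
  have key : ∀ k ≤ m, ∃ S ⊆ K, IsCompact S ∧ S.Nonempty ∧ ∀ c ∈ S, ∀ c' ∈ K,
      ((∀ i : Fin m, i.1 < k → c' i = c i) → c' ∈ S) ∧
      ∀ j : Fin m, j.1 < k → (∀ i < j, c' i = c i) → c' j ≤ c j := by
    intro k
    induction k with
    | zero => exact fun _ => ⟨K, subset_rfl, hK, hK0, fun c _ c' hc' =>
        ⟨fun _ => hc', fun j hj => absurd hj (Nat.not_lt_zero _)⟩⟩
    | succ k ih =>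
      intro hk
      obtain ⟨S, hSK, hS, hS0, h⟩ := ih (by omega)
      let a : Fin m := ⟨k, by omega⟩
      obtain ⟨c₀, hc₀, hmax⟩ := hS.exists_isMaxOn hS0 (continuous_apply a).continuousOn
      refine ⟨S ∩ {c | c a = c₀ a}, fun c hc => hSK hc.1,
        hS.inter_right (isClosed_eq (continuous_apply a) continuous_const), ⟨c₀, hc₀, rfl⟩, ?_⟩
      rintro c ⟨hc, hca⟩ c' hc'
      obtain ⟨h1, h2⟩ := h c hc c' hc'
      refine ⟨fun hi => ⟨h1 fun i hik => hi i (by omega), ?_⟩, fun j hj hi => ?_⟩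
      · exact (hi a (Nat.lt_succ_self k)).trans hca
      · rcases Nat.lt_succ_iff_lt_or_eq.1 hj with hj | hj
        · exact h2 j hj hi
        · have hja : j = a := Fin.ext hj
          have hc'S : c' ∈ S := h1 fun i hik => hi i (by rw [hja]; exact hik)
          rw [hja, show c a = c₀ a from hca]
          exact hmax hc'S
  obtain ⟨S, hSK, -, ⟨c, hc⟩, h⟩ := key m le_rfl
  refine ⟨c, hSK hc, fun c' hc' ⟨j, h1, h2⟩ => ?_⟩
  have := (h c hc c' hc').2 j j.2 fun i hi => sub_eq_zero.1 (h1 i hi)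
  simp only [Pi.sub_apply] at h2
  linarith

/-- `c` is the lexicographically maximal tuple of nonnegative coefficients among those which give
the same combination of the `v j`. -/
def IsLexOptimal (v : Fin m → Fin n → ℝ) (c : Fin m → ℝ) : Prop :=
  0 ≤ c ∧ ∀ c', 0 ≤ c' → ∑ j, c' j • v j = ∑ j, c j • v j → ¬ LexPos (c' - c)

/-- The representations of a given point form a compact set: the generators are nonnegative and
nonzero, so comparing coordinate sums bounds every coefficient. -/
theorem exists_isLexOptimal {v : Fin m → Fin n → ℝ} (hv : ∀ j, 0 ≤ v j) (hv0 : ∀ j, v j ≠ 0)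
    {c : Fin m → ℝ} (hc : 0 ≤ c) :
    ∃ c', IsLexOptimal v c' ∧ ∑ j, c' j • v j = ∑ j, c j • v j := by
  set x := ∑ j, c j • v j
  let K : Set (Fin m → ℝ) := {c' | 0 ≤ c' ∧ ∑ j, c' j • v j = x}
  have hcont : Continuous fun c' : Fin m → ℝ => ∑ j, c' j • v j := by fun_prop
  have hclosed : IsClosed K :=
    (isClosed_le continuous_const continuous_id).inter (isClosed_eq hcont continuous_const)
  have hspos : ∀ j, 0 < ∑ i, v j i := fun j => by
    obtain ⟨i, hi⟩ := Function.ne_iff.1 (hv0 j)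
    exact Finset.sum_pos' (fun i _ => hv j i) ⟨i, Finset.mem_univ i, lt_of_le_of_ne (hv j i) hi.symm⟩
  have hK : IsCompact K := by
    refine (isCompact_Icc (a := (0 : Fin m → ℝ))
      (b := fun j => (∑ i, x i) / ∑ i, v j i)).of_isClosed_subset hclosed ?_
    rintro c' ⟨h0, h1⟩
    refine ⟨h0, fun j => ?_⟩
    rw [le_div_iff₀ (hspos j), ← h1]
    calc c' j * ∑ i, v j i = ∑ i, (c' j • v j) i := by simp [Finset.mul_sum]
      _ ≤ ∑ i, (∑ j, c' j • v j) i := by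
        refine Finset.sum_le_sum fun i _ => ?_
        rw [Finset.sum_apply]
        exact Finset.single_le_sum (f := fun j => (c' j • v j) i)
          (fun j _ => mul_nonneg (h0 j) (hv j i)) (Finset.mem_univ j)
  obtain ⟨c', hc', h⟩ := exists_lexMax hK ⟨c, hc, rfl⟩
  exact ⟨c', ⟨hc'.1, fun c'' h0 h1 => h c'' ⟨h0, h1.trans hc'.2⟩⟩, hc'.2⟩

theorem IsLexOptimal.eq {v : Fin m → Fin n → ℝ} {c c' : Fin m → ℝ} (hc : IsLexOptimal v c)
    (hc' : IsLexOptimal v c') (h : ∑ j, c j • v j = ∑ j, c' j • v j) : c = c' := by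
  by_contra hne
  rcases lexPos_or_lexPos_neg (sub_ne_zero.2 hne) with h1 | h1
  · exact hc'.2 c hc.1 h h1
  · rw [neg_sub] at h1
    exact hc.2 c' hc'.1 h.symm h1

/-- A direction in the relations between the `v j`, nonnegative where `c` vanishes, cannot be
lexicographically positive if `c` is optimal. -/
theorem IsLexOptimal.not_lexPos {v : Fin m → Fin n → ℝ} {c d : Fin m → ℝ}
    (hc : IsLexOptimal v c) (hd : ∑ j, d j • v j = 0) (h : ∀ j, c j = 0 → 0 ≤ d j) :
    ¬ LexPos d := by
  intro hpos
  -- A short enough step from `c` along `d` keeps the coefficients nonnegative: where `c j = 0` the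
  -- direction is inward, elsewhere there is room.
  have hex : ∀ j, ∃ ε > 0, ∀ ε' ≤ ε, 0 ≤ ε' → 0 ≤ c j + ε' * d j := by
    intro j
    by_cases hj : c j = 0
    · exact ⟨1, one_pos, fun ε' _ h' => by rw [hj, zero_add]; exact mul_nonneg h' (h j hj)⟩
    · have hcj : 0 < c j := lt_of_le_of_ne (hc.1 j) (Ne.symm hj)
      refine ⟨c j / (|d j| + 1), by positivity, fun ε' h1 h2 => ?_⟩
      rw [le_div_iff₀ (by positivity)] at h1
      nlinarith [neg_abs_le (d j), mul_le_mul_of_nonneg_left (neg_abs_le (d j)) h2]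
  choose ε hε hε' using hex
  obtain ⟨e, he, he'⟩ : ∃ e > 0, ∀ j, e ≤ ε j := by
    rcases Nat.eq_zero_or_pos m with rfl | hm
    · exact ⟨1, one_pos, fun j => j.elim0⟩
    · have : Nonempty (Fin m) := ⟨⟨0, hm⟩⟩
      obtain ⟨j, hj⟩ := Finite.exists_min ε
      exact ⟨ε j, hε j, hj⟩
  refine hc.2 (c + e • d) (fun j => ?_) ?_ ?_
  · simpa using hε' j e (he' j) he.le
  · simp only [Pi.add_apply, Pi.smul_apply, add_smul, Finset.sum_add_distrib, smul_assoc]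
    rw [← Finset.smul_sum, hd, smul_zero, add_zero]
  · rw [add_sub_cancel_left]
    exact hpos.smul he

/-- Any competitor `c''` of `c'` gives a direction `c'' - c'` which is nonnegative wherever `c`
vanishes, so the optimality of `c` excludes it. Optimality is therefore a property of supports,
inherited by smaller ones. -/
theorem IsLexOptimal.of_support {v : Fin m → Fin n → ℝ} {c c' : Fin m → ℝ}
    (hc : IsLexOptimal v c) (h0 : 0 ≤ c') (h : ∀ j, c j = 0 → c' j = 0) : IsLexOptimal v c' := by
  refine ⟨h0, fun c'' h1 h2 => hc.not_lexPos ?_ fun j hj => ?_⟩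
  · simp [sub_smul, h2]
  · simpa [h j hj] using h1 j

/-- A relation supported where `c` is nonzero is an admissible direction with either sign, and one
of the two signs of a nonzero vector is lexicographically positive. -/
theorem IsLexOptimal.linearIndependent {v : Fin m → Fin n → ℝ} {c : Fin m → ℝ}
    (hc : IsLexOptimal v c) : LinearIndependent ℝ fun j : {j // c j ≠ 0} => v j := by
  rw [Fintype.linearIndependent_iff]
  intro d hd
  let d' : Fin m → ℝ := fun j => if h : c j ≠ 0 then d ⟨j, h⟩ else 0
  have hd' : ∑ j, d' j • v j = 0 := by
    rw [← hd, ← Finset.sum_filter_of_ne (p := fun j => c j ≠ 0),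
      Finset.sum_subtype (p := fun j => c j ≠ 0) _ (by simp)]
    · exact Finset.sum_congr rfl fun j _ => by simp [d', j.2]
    · intro j _ hj hcj
      simp [d', hcj] at hj
  have h0 : d' = 0 := by
    by_contra hne
    rcases lexPos_or_lexPos_neg hne with h | h
    · exact hc.not_lexPos hd' (fun j hj => by simp [d', hj]) h
    · exact hc.not_lexPos (by simp [hd']) (fun j hj => by simp [d', hj]) h
  intro j
  have := congrFun h0 j.1
  simpa [d', j.2] using this

/-- Every point of `δ` has exactly one lexicographically optimal representation, and its support
decides in which open simplicial cone the point lies. Hypothesis `h2` says that membership in `δ`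
depends only on the support of the coefficients, so these cones stay inside `δ`. -/
theorem exists_simplicialPartition_of_generators (v : Fin m → Fin n → ℕ)
    (hv : ∀ j, IsPrimitive (v j)) {δ : Set (Fin n → ℝ)}
    (h1 : ∀ x ∈ δ, ∃ c : Fin m → ℝ, 0 ≤ c ∧ x = ∑ j, c j • natVec (v j))
    (h2 : ∀ c c' : Fin m → ℝ, 0 ≤ c → 0 ≤ c' → (∀ j, c j = 0 ↔ c' j = 0) →
      ∑ j, c j • natVec (v j) ∈ δ → ∑ j, c' j • natVec (v j) ∈ δ) :
    ∃ D : SimplicialPartition δ, ∀ i j, ∃ l, D.gen i j = v l := by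
  set w : Fin m → Fin n → ℝ := fun j => natVec (v j)
  have hw : ∀ j, 0 ≤ w j := fun j => natVec_nonneg _
  have hw0 : ∀ j, w j ≠ 0 := fun j h => by
    have h3 : v j = 0 := by
      ext i
      have := congrFun h i
      simpa [w, natVec] using this
    have h4 := hv j
    rw [IsPrimitive, h3] at h4
    have : (Finset.univ : Finset (Fin n)).gcd (0 : Fin n → ℕ) = 0 :=
      Finset.gcd_eq_zero_iff.2 fun _ _ => rfl
    omega
  -- The cones of the partition are indexed by the supports of the optimal tuples that represent
  -- points of `δ`.
  let Good : Finset (Fin m) → Prop := fun J =>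
    ∃ c, IsLexOptimal w c ∧ ∑ j, c j • w j ∈ δ ∧ ∀ j, c j ≠ 0 ↔ j ∈ J
  let e : {J // Good J} ≃ Fin (Fintype.card {J // Good J}) := Fintype.equivFin _
  let J : Fin (Fintype.card {J // Good J}) → Finset (Fin m) := fun i => (e.symm i).1
  have hJ : ∀ i, Good (J i) := fun i => (e.symm i).2
  have hspan : ∀ i x, x ∈ spannedCone (fun j => v ((J i).equivFin.symm j)) ↔
      ∃ c : Fin m → ℝ, 0 ≤ c ∧ (∀ j, c j ≠ 0 ↔ j ∈ J i) ∧ x = ∑ j, c j • w j := by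
    intro i x
    have hsum : ∀ c : Fin m → ℝ, (∀ j, c j ≠ 0 → j ∈ J i) →
        ∑ j, c j • w j = ∑ j, c ((J i).equivFin.symm j) • w ((J i).equivFin.symm j) := by
      intro c hc
      rw [(J i).equivFin.symm.sum_comp (fun j => c j • w j),
        Finset.sum_coe_sort (J i) (fun j => c j • w j)]
      refine (Finset.sum_subset (Finset.subset_univ _) fun j _ hj => ?_).symm
      rw [not_not.1 (mt (hc j) hj), zero_smul]
    constructor
    · rintro ⟨c, hc, rfl⟩
      refine ⟨fun j => if h : j ∈ J i then c ((J i).equivFin ⟨j, h⟩) else 0, fun j => ?_,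
        fun j => ?_, ?_⟩
      · by_cases h : j ∈ J i
        · simpa [h] using (hc _).le
        · simp [h]
      · by_cases h : j ∈ J i
        · simpa [h] using (hc _).ne'
        · simp [h]
      · rw [hsum _ fun j hj => by by_contra h; simp [h] at hj]
        simp [w]
    · rintro ⟨c, hc0, hc, rfl⟩
      exact ⟨fun j => c ((J i).equivFin.symm j), fun j => lt_of_le_of_ne (hc0 _)
        ((hc _).2 ((J i).equivFin.symm j).2).symm, hsum c fun j => (hc j).1⟩
  refine ⟨⟨_, fun i => (J i).card, fun i j => v ((J i).equivFin.symm j), fun i j => hv _,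
    fun i => ?_, fun i i' hii' => ?_, ?_⟩, fun i j => ⟨_, rfl⟩⟩
  · obtain ⟨c, hc, -, hcJ⟩ := hJ i
    have := hc.linearIndependent
    refine this.comp (fun j => ⟨(J i).equivFin.symm j, (hcJ _).2 ((J i).equivFin.symm j).2⟩) ?_
    intro a b hab
    simpa [Subtype.ext_iff] using hab
  · rw [Set.disjoint_left]
    intro x hx hx'
    obtain ⟨c, hc0, hc, rfl⟩ := (hspan i x).1 hx
    obtain ⟨c', hc0', hc', hcc'⟩ := (hspan i' _).1 hx'
    obtain ⟨b, hb, -, hbJ⟩ := hJ i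
    obtain ⟨b', hb', -, hbJ'⟩ := hJ i'
    have ho : IsLexOptimal w c := hb.of_support hc0 fun j hj => by
      by_contra h
      exact (hbJ j).2 ((hc j).1 h) hj
    have ho' : IsLexOptimal w c' := hb'.of_support hc0' fun j hj => by
      by_contra h
      exact (hbJ' j).2 ((hc' j).1 h) hj
    have := ho.eq ho' hcc'
    subst this
    apply hii'
    apply e.symm.injective
    apply Subtype.ext
    ext j
    exact (hc j).symm.trans (hc' j)
  · ext x
    simp only [Set.mem_iUnion, hspan]
    constructor
    · rintro ⟨i, c, hc0, hc, rfl⟩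
      obtain ⟨b, hb, hbδ, hbJ⟩ := hJ i
      exact h2 b c hb.1 hc0 (fun j => not_iff_not.1 ((hbJ j).trans (hc j).symm)) hbδ
    · intro hx
      obtain ⟨c, hc0, rfl⟩ := h1 x hx
      obtain ⟨c', hc', hcc'⟩ := exists_isLexOptimal hw hw0 hc0
      refine ⟨e ⟨Finset.univ.filter fun j => c' j ≠ 0, c', hc', by rwa [hcc'], by simp⟩, c', hc'.1,
        fun j => ?_, hcc'.symm⟩
      simp [J]

end Triangulation

/-! ### Rational polyhedral cones in the orthant and their extreme rays -/

section ExtremeRays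
variable {n : ℕ} {ι : Type*}

theorem IsPrimitive.ne_zero {k : Fin n → ℕ} (hk : IsPrimitive k) : k ≠ 0 := by
  rintro rfl
  have : (Finset.univ : Finset (Fin n)).gcd (0 : Fin n → ℕ) = 0 :=
    Finset.gcd_eq_zero_iff.2 fun _ _ => rfl
  rw [IsPrimitive, this] at hk
  omega

theorem natVec_injective : Function.Injective (natVec : (Fin n → ℕ) → Fin n → ℝ) := by
  intro k k' h
  ext i
  exact Nat.cast_injective (R := ℝ) (congrFun h i)

/-- Proportionality gives `k_i k'_j = k'_i k_j`; taking the gcd over `j` on both sides gives `k_i =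
k'_i`. -/
theorem IsPrimitive.eq_of_smul {k k' : Fin n → ℕ} (hk : IsPrimitive k) (hk' : IsPrimitive k')
    {c : ℝ} (h : natVec k' = c • natVec k) : k = k' := by
  have hi : ∀ i, (k' i : ℝ) = c * k i := fun i => congrFun h i
  have hij : ∀ i j, k i * k' j = k' i * k j := fun i j => by
    have : (k i : ℝ) * k' j = k' i * k j := by rw [hi, hi]; ring
    exact_mod_cast this
  ext i
  have h1 : Finset.univ.gcd (fun j => k i * k' j) = k i := by
    rw [Finset.gcd_mul_left, show Finset.univ.gcd k' = 1 from hk']; simp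
  have h2 : Finset.univ.gcd (fun j => k' i * k j) = k' i := by
    rw [Finset.gcd_mul_left, show Finset.univ.gcd k = 1 from hk]; simp
  rw [← h1, ← h2]
  simp only [hij]

/-- Clear denominators and divide by the gcd. Absolute values are taken because the rational vector
to which this is applied is known only up to a real factor of unknown sign. -/
theorem exists_primitive_of_rat {q : Fin n → ℚ} (hq : q ≠ 0) :
    ∃ k : Fin n → ℕ, IsPrimitive k ∧ ∃ c : ℝ, 0 < c ∧ ∀ i, (|q i| : ℝ) = c * k i := by
  let N : ℕ := ∏ j, (q j).den
  have hN : (N : ℝ) ≠ 0 := by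
    simp only [N, Nat.cast_ne_zero, Finset.prod_ne_zero_iff]
    exact fun j _ => (q j).den_nz
  let w : Fin n → ℕ := fun i => (q i).num.natAbs * ∏ j ∈ Finset.univ.erase i, (q j).den
  have hw : ∀ i, |(q i : ℝ)| * N = w i := fun i => by
    have h1 : (N : ℝ) = (q i).den * ∏ j ∈ Finset.univ.erase i, ((q j).den : ℝ) := by
      simp only [N]
      push_cast
      exact (Finset.mul_prod_erase Finset.univ (fun j => ((q j).den : ℝ)) (Finset.mem_univ i)).symm
    have h2 : |(q i : ℝ)| * (q i).den = ((q i).num.natAbs : ℝ) := by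
      rw [Nat.cast_natAbs, Int.cast_abs]
      have : (q i : ℝ) * (q i).den = (q i).num := by exact_mod_cast Rat.mul_den_eq_num (q i)
      rw [← this, abs_mul, Nat.abs_cast]
    simp only [w]
    push_cast
    rw [h1, ← mul_assoc, h2]
  have hne : (Finset.univ : Finset (Fin n)).Nonempty := by
    obtain ⟨i, -⟩ := Function.ne_iff.1 hq
    exact ⟨i, Finset.mem_univ i⟩
  obtain ⟨k, hk, hk1⟩ := Finset.extract_gcd w hne
  set d := Finset.univ.gcd w
  have hd : d ≠ 0 := by
    obtain ⟨i, hi⟩ := Function.ne_iff.1 hq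
    intro hd
    have h1 := Finset.gcd_eq_zero_iff.1 hd i (Finset.mem_univ i)
    have h2 := hw i
    rw [h1] at h2
    simp only [Nat.cast_zero, mul_eq_zero, hN, or_false, abs_eq_zero, Rat.cast_eq_zero] at h2
    exact hi h2
  refine ⟨k, hk1, d / N, by positivity, fun i => ?_⟩
  have h1 := hw i
  rw [hk i (Finset.mem_univ i)] at h1
  push_cast at h1
  field_simp
  linarith

/-- `v` spans an extreme ray of the cone `{x | a i · x ≥ 0}`. -/
def IsExtreme (a : ι → Fin n → ℤ) (v : Fin n → ℝ) : Prop :=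
  (∀ i, 0 ≤ intVec (a i) ⬝ᵥ v) ∧ v ≠ 0 ∧
    ∀ y, (∀ i, intVec (a i) ⬝ᵥ v = 0 → intVec (a i) ⬝ᵥ y = 0) → ∃ c : ℝ, y = c • v

theorem IsExtreme.smul {a : ι → Fin n → ℤ} {v : Fin n → ℝ} (hv : IsExtreme a v) {c : ℝ}
    (hc : 0 < c) : IsExtreme a (c • v) := by
  refine ⟨fun i => ?_, smul_ne_zero hc.ne' hv.2.1, fun y hy => ?_⟩
  · rw [dotProduct_smul]
    exact mul_nonneg hc.le (hv.1 i)
  · obtain ⟨d, rfl⟩ := hv.2.2 y fun i hi => hy i (by rw [dotProduct_smul, hi, smul_zero])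
    exact ⟨d / c, by rw [smul_smul, div_mul_cancel₀ _ hc.ne']⟩

/-- Rationality of extreme rays without solving linear systems: a `ℚ`-linear functional `φ : ℝ → ℚ`,
applied to each coordinate of `v`, preserves every integer linear relation. The image is then a
rational vector killed by the forms that kill `v`, hence a multiple of `v` by extremality. -/
theorem IsExtreme.exists_primitive {a : ι → Fin n → ℤ} {v : Fin n → ℝ} (hv : IsExtreme a v)
    (h0 : 0 ≤ v) : ∃ k : Fin n → ℕ, IsPrimitive k ∧ ∃ c : ℝ, 0 < c ∧ v = c • natVec k := by
  obtain ⟨j, hj⟩ := Function.ne_iff.1 hv.2.1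
  obtain ⟨φ, hφ⟩ : ∃ φ : Module.Dual ℚ ℝ, φ (v j) ≠ 0 := by
    by_contra! h
    exact hj ((Module.forall_dual_apply_eq_zero_iff ℚ (v j)).1 h)
  let q : Fin n → ℚ := fun i => φ (v i)
  have hq0 : q ≠ 0 := fun h => hφ (congrFun h j)
  obtain ⟨c, hc⟩ := hv.2.2 (fun i => (q i : ℝ)) fun i hi => by
    have h1 : φ (intVec (a i) ⬝ᵥ v) = ∑ l, (a i l : ℚ) * q l := by
      rw [dotProduct, map_sum]
      refine Finset.sum_congr rfl fun l _ => ?_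
      have : intVec (a i) l * v l = (a i l : ℚ) • v l := by
        rw [Rat.smul_def]; simp [intVec]
      rw [this, map_smul, smul_eq_mul]
    rw [hi, map_zero] at h1
    have h2 : ((∑ l, (a i l : ℚ) * q l : ℚ) : ℝ) = 0 := by rw [← h1]; simp
    rw [← h2]
    simp [dotProduct, intVec]
  obtain ⟨k, hk, d, hd, hdk⟩ := exists_primitive_of_rat hq0
  have hci : ∀ i, (q i : ℝ) = c * v i := fun i => congrFun hc i
  have hc0 : c ≠ 0 := by
    rintro rfl
    apply hq0
    ext i
    have := hci i
    simpa using this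
  refine ⟨k, hk, d / |c|, by positivity, ?_⟩
  ext i
  have h3 := hdk i
  rw [hci i, abs_mul, abs_of_nonneg (h0 i)] at h3
  have : |c| ≠ 0 := abs_ne_zero.2 hc0
  simp only [Pi.smul_apply, natVec, smul_eq_mul]
  field_simp
  linarith

theorem IsExtreme.eq_of_zeros {a : ι → Fin n → ℤ} {k k' : Fin n → ℕ} (hk : IsPrimitive k)
    (hk' : IsPrimitive k') (hv : IsExtreme a (natVec k))
    (h : ∀ i, intVec (a i) ⬝ᵥ natVec k = 0 → intVec (a i) ⬝ᵥ natVec k' = 0) : k = k' := by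
  obtain ⟨c, hc⟩ := hv.2.2 _ h
  exact hk.eq_of_smul hk' hc

theorem finite_extreme [Finite ι] (a : ι → Fin n → ℤ) :
    {k : Fin n → ℕ | IsPrimitive k ∧ IsExtreme a (natVec k)}.Finite := by
  refine Set.Finite.of_injOn (f := fun k => {i | intVec (a i) ⬝ᵥ natVec k = 0})
    (t := Set.univ) (fun _ _ => Set.mem_univ _) ?_ Set.finite_univ
  rintro k ⟨hk, hv⟩ k' ⟨hk', -⟩ h
  exact hv.eq_of_zeros hk hk' fun i hi => (Set.ext_iff.1 h i).1 hi

/-- Moving from a point of the cone in a direction which leaves the cone, until one more linear form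
vanishes. -/
theorem exists_move [Finite ι] {a : ι → Fin n → ℤ} {x z : Fin n → ℝ}
    (hx : ∀ i, 0 ≤ intVec (a i) ⬝ᵥ x)
    (hz : ∀ i, intVec (a i) ⬝ᵥ x = 0 → intVec (a i) ⬝ᵥ z = 0)
    (hz' : ∃ i, intVec (a i) ⬝ᵥ z < 0) :
    ∃ c : ℝ, 0 < c ∧ (∀ i, 0 ≤ intVec (a i) ⬝ᵥ (x + c • z)) ∧
      (∀ i, intVec (a i) ⬝ᵥ x = 0 → intVec (a i) ⬝ᵥ (x + c • z) = 0) ∧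
      ∃ i, intVec (a i) ⬝ᵥ x ≠ 0 ∧ intVec (a i) ⬝ᵥ (x + c • z) = 0 := by
  -- The ratio test: among the forms decreasing along `z`, pick the one which reaches zero first.
  obtain ⟨i₀, hi₀, hmin⟩ := Set.exists_min_image {i | intVec (a i) ⬝ᵥ z < 0}
    (fun i => intVec (a i) ⬝ᵥ x / -(intVec (a i) ⬝ᵥ z)) (Set.toFinite _) hz'
  have hi₀' : intVec (a i₀) ⬝ᵥ z < 0 := hi₀
  have hx0 : 0 < intVec (a i₀) ⬝ᵥ x :=
    lt_of_le_of_ne (hx i₀) fun h => hi₀'.ne (hz i₀ h.symm)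
  have hc : 0 < intVec (a i₀) ⬝ᵥ x / -(intVec (a i₀) ⬝ᵥ z) := div_pos hx0 (by linarith)
  have hadd : ∀ (c : ℝ) i, intVec (a i) ⬝ᵥ (x + c • z) =
      intVec (a i) ⬝ᵥ x + c * (intVec (a i) ⬝ᵥ z) := fun c i => by
    rw [dotProduct_add, dotProduct_smul, smul_eq_mul]
  refine ⟨_, hc, fun i => ?_, fun i hi => by rw [hadd, hi, hz i hi]; ring, i₀, hx0.ne', ?_⟩
  · rw [hadd]
    by_cases hi : intVec (a i) ⬝ᵥ z < 0
    · have := hmin i hi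
      rw [le_div_iff₀ (by linarith)] at this
      linarith
    · exact add_nonneg (hx i) (mul_nonneg hc.le (not_lt.1 hi))
  · rw [hadd, div_neg, neg_mul, div_mul_cancel₀ _ hi₀'.ne, add_neg_cancel]

/-- A polyhedral cone contained in the orthant is generated by its extreme rays: more precisely,
each point is a combination of extreme vectors annihilated by the same linear forms. -/
theorem mem_of_extreme_mem [Finite ι] {a : ι → Fin n → ℤ}
    (hpos : ∀ x, (∀ i, 0 ≤ intVec (a i) ⬝ᵥ x) → 0 ≤ x) {Q : Set (Fin n → ℝ)} (h0 : 0 ∈ Q)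
    (hadd : ∀ x ∈ Q, ∀ y ∈ Q, x + y ∈ Q) (hsmul : ∀ c : ℝ, 0 < c → ∀ x ∈ Q, c • x ∈ Q)
    {Z : Set ι} (hQ : ∀ v, IsExtreme a v → (∀ i ∈ Z, intVec (a i) ⬝ᵥ v = 0) → v ∈ Q)
    {x : Fin n → ℝ} (hx : ∀ i, 0 ≤ intVec (a i) ⬝ᵥ x) (hxZ : ∀ i ∈ Z, intVec (a i) ⬝ᵥ x = 0) :
    x ∈ Q := by
  -- Induction on the number of forms not vanishing at `x`. A non-extreme `x` lies on a segment
  -- whose endpoints each annihilate at least one more form.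
  induction hN : {i | intVec (a i) ⬝ᵥ x ≠ 0}.ncard using Nat.strong_induction_on generalizing x with
  | _ N ih =>
    by_cases hx0 : x = 0
    · rwa [hx0]
    by_cases hex : IsExtreme a x
    · exact hQ x hex hxZ
    have hxpos := hpos x hx
    have hs : 0 < ∑ j, x j := by
      obtain ⟨j, hj⟩ := Function.ne_iff.1 hx0
      exact Finset.sum_pos' (fun i _ => hxpos i)
        ⟨j, Finset.mem_univ j, lt_of_le_of_ne (hxpos j) (Ne.symm hj)⟩
    obtain ⟨y, hy, hyx⟩ : ∃ y, (∀ i, intVec (a i) ⬝ᵥ x = 0 → intVec (a i) ⬝ᵥ y = 0) ∧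
        ∀ c : ℝ, y ≠ c • x := by
      by_contra! h
      exact hex ⟨hx, hx0, h⟩
    -- Normalized to coordinate sum zero, so that neither `z` nor `-z` is in the orthant and both
    -- directions leave the cone.
    set z := y - ((∑ j, y j) / ∑ j, x j) • x with hz
    have hz0 : z ≠ 0 := fun h => hyx _ (sub_eq_zero.1 h)
    have hzs : ∑ j, z j = 0 := by
      simp only [hz, Pi.sub_apply, Pi.smul_apply, smul_eq_mul, Finset.sum_sub_distrib,
        ← Finset.mul_sum]
      field_simp
      ring
    have hzx : ∀ i, intVec (a i) ⬝ᵥ x = 0 → intVec (a i) ⬝ᵥ z = 0 := fun i hi => by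
      rw [hz, dotProduct_sub, dotProduct_smul, hi, hy i hi]; simp
    have hleave : ∀ z : Fin n → ℝ, z ≠ 0 → ∑ j, z j = 0 → ∃ i, intVec (a i) ⬝ᵥ z < 0 := by
      intro z hz0 hzs
      by_contra! h
      have h1 := hpos z h
      rw [Finset.sum_eq_zero_iff_of_nonneg fun i _ => h1 i] at hzs
      exact hz0 (funext fun i => hzs i (Finset.mem_univ i))
    have step : ∀ z : Fin n → ℝ, z ≠ 0 → ∑ j, z j = 0 →
        (∀ i, intVec (a i) ⬝ᵥ x = 0 → intVec (a i) ⬝ᵥ z = 0) → ∃ c : ℝ, 0 < c ∧ x + c • z ∈ Q := by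
      intro z hz0 hzs hzx
      obtain ⟨c, hc, h1, h2, i, h3, h4⟩ := exists_move hx hzx (hleave z hz0 hzs)
      refine ⟨c, hc, ih _ ?_ h1 (fun i hi => h2 i (hxZ i hi)) rfl⟩
      rw [← hN]
      refine Set.ncard_lt_ncard ?_ (Set.toFinite _)
      refine ⟨fun j hj hj' => hj (h2 j hj'), fun h => ?_⟩
      exact h h3 h4
    obtain ⟨c, hc, hcQ⟩ := step z hz0 hzs hzx
    obtain ⟨d, hd, hdQ⟩ := step (-z) (neg_ne_zero.2 hz0) (by simp [hzs])
      (fun i hi => by rw [dotProduct_neg, hzx i hi, neg_zero])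
    have : x = (d / (c + d)) • (x + c • z) + (c / (c + d)) • (x + d • (-z)) := by
      ext j
      simp only [Pi.add_apply, Pi.smul_apply, Pi.neg_apply, smul_eq_mul]
      have : c + d ≠ 0 := by positivity
      field_simp
      ring
    rw [this]
    exact hadd _ (hsmul _ (by positivity) _ hcQ) _ (hsmul _ (by positivity) _ hdQ)

/-- The generators are the primitive extreme vectors annihilated by the forms in `Z`. All forms are
nonnegative on them, so a form vanishes on a nonnegative combination iff it vanishes on each
generator actually used; hence membership in `δ` depends on the support only. -/
theorem exists_simplicialPartition_of_forms [Finite ι] {a : ι → Fin n → ℤ}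
    (hpos : ∀ x, (∀ i, 0 ≤ intVec (a i) ⬝ᵥ x) → 0 ≤ x) {δ : Set (Fin n → ℝ)} (Z : Set ι)
    (hδ : ∀ x, x ∈ δ ↔ ∀ i, 0 ≤ intVec (a i) ⬝ᵥ x ∧ (intVec (a i) ⬝ᵥ x = 0 ↔ i ∈ Z)) :
    ∃ D : SimplicialPartition δ, ∀ i j, IsExtreme a (natVec (D.gen i j)) := by
  let R := (finite_extreme a).toFinset.filter fun k => ∀ i ∈ Z, intVec (a i) ⬝ᵥ natVec k = 0
  have hR : ∀ k, k ∈ R ↔ (IsPrimitive k ∧ IsExtreme a (natVec k)) ∧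
      ∀ i ∈ Z, intVec (a i) ⬝ᵥ natVec k = 0 := by simp [R]
  let v : Fin R.card → Fin n → ℕ := fun j => R.equivFin.symm j
  have hv : ∀ j, v j ∈ R := fun j => (R.equivFin.symm j).2
  have hL : ∀ (c : Fin R.card → ℝ) i, intVec (a i) ⬝ᵥ ∑ j, c j • natVec (v j) =
      ∑ j, c j * (intVec (a i) ⬝ᵥ natVec (v j)) := fun c i => by
    simp only [dotProduct_sum, dotProduct_smul, smul_eq_mul]
  have h1 : ∀ x ∈ δ, ∃ c : Fin R.card → ℝ, 0 ≤ c ∧ x = ∑ j, c j • natVec (v j) := by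
    intro x hx
    refine mem_of_extreme_mem (a := a) (Z := Z) hpos
      (Q := {x | ∃ c : Fin R.card → ℝ, 0 ≤ c ∧ x = ∑ j, c j • natVec (v j)})
      ⟨0, le_rfl, by simp⟩ ?_ ?_ ?_ (fun i => ((hδ x).1 hx i).1)
      fun i hi => ((hδ x).1 hx i).2.2 hi
    · rintro _ ⟨c, hc, rfl⟩ _ ⟨d, hd, rfl⟩
      exact ⟨c + d, add_nonneg hc hd, by simp [add_smul, Finset.sum_add_distrib]⟩
    · rintro e he _ ⟨c, hc, rfl⟩
      exact ⟨e • c, smul_nonneg he.le hc, by simp [Finset.smul_sum, smul_smul]⟩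
    · intro y hy hyZ
      obtain ⟨k, hk, c, hc, rfl⟩ := hy.exists_primitive (hpos y hy.1)
      have hk' : IsExtreme a (natVec k) := by
        have := hy.smul (inv_pos.2 hc)
        rwa [smul_smul, inv_mul_cancel₀ hc.ne', one_smul] at this
      have hkR : k ∈ R := (hR k).2 ⟨⟨hk, hk'⟩, fun i hi => by
        have := hyZ i hi
        rw [dotProduct_smul, smul_eq_mul] at this
        exact (mul_eq_zero.1 this).resolve_left hc.ne'⟩
      refine ⟨Pi.single (R.equivFin ⟨k, hkR⟩) c, by simpa using hc.le, ?_⟩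
      rw [Finset.sum_eq_single (R.equivFin ⟨k, hkR⟩)]
      · simp [v]
      · intro j _ hj
        simp [hj]
      · simp
  have h2 : ∀ c c' : Fin R.card → ℝ, 0 ≤ c → 0 ≤ c' → (∀ j, c j = 0 ↔ c' j = 0) →
      ∑ j, c j • natVec (v j) ∈ δ → ∑ j, c' j • natVec (v j) ∈ δ := by
    intro c c' hc hc' hcc' hx
    rw [hδ] at hx ⊢
    intro i
    have hnn : ∀ j, 0 ≤ intVec (a i) ⬝ᵥ natVec (v j) := fun j => ((hR _).1 (hv j)).1.2.1 i
    refine ⟨?_, ?_⟩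
    · rw [hL]
      exact Finset.sum_nonneg fun j _ => mul_nonneg (hc' j) (hnn j)
    · rw [← (hx i).2, hL, hL,
        Finset.sum_eq_zero_iff_of_nonneg fun j _ => mul_nonneg (hc' j) (hnn j),
        Finset.sum_eq_zero_iff_of_nonneg fun j _ => mul_nonneg (hc j) (hnn j)]
      simp only [mul_eq_zero, hcc']
  obtain ⟨D, hD⟩ := exists_simplicialPartition_of_generators v (fun j => ((hR _).1 (hv j)).1.1)
    h1 h2
  refine ⟨D, fun i j => ?_⟩
  obtain ⟨l, hl⟩ := hD i j
  rw [hl]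
  exact ((hR _).1 (hv l)).1.2

end ExtremeRays

/-! ### Simplicial partitions of the cells by rays of the partition -/

section Cells
variable {n : ℕ} {A A' : Set (Fin n →₀ ℕ)}

theorem mem_spannedCone_one {k : Fin n → ℕ} {x : Fin n → ℝ} :
    x ∈ spannedCone (fun _ : Fin 1 => k) ↔ ∃ c : ℝ, 0 < c ∧ x = c • natVec k := by
  constructor
  · rintro ⟨c, hc, rfl⟩
    exact ⟨c 0, hc 0, by simp⟩
  · rintro ⟨c, hc, rfl⟩
    exact ⟨fun _ => c, fun _ => hc, by simp⟩

theorem exists_simplicialPartition (hA : A.Finite) (hA0 : A.Nonempty) (hA' : A'.Finite)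
    (hA0' : A'.Nonempty) {δ : Set (Fin n → ℝ)}
    (hδ : δ ∈ conePartition (newtonPolyhedron A) (newtonPolyhedron A')) :
    ∃ D : SimplicialPartition δ, ∀ i j,
      IsRayGenerator (conePartition (newtonPolyhedron A) (newtonPolyhedron A')) (D.gen i j) := by
  obtain ⟨k₀, hk₀δ⟩ := hδ.1
  have hk₀ := nonneg_of_mem hδ hk₀δ
  obtain ⟨ω₀, h0, hm⟩ := exists_mVal_eq hA hA0 hk₀
  obtain ⟨ω₀', h0', hm'⟩ := exists_mVal_eq hA' hA0' hk₀
  have : Finite A := hA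
  have : Finite A' := hA'
  have hC := (cellForm_nonneg_iff hA hA' h0 h0').2 ⟨hk₀, hm.symm, hm'.symm⟩
  obtain ⟨D, hD⟩ := exists_simplicialPartition_of_forms (a := cellForm A A' ω₀ ω₀') (δ := δ)
    (fun x hx => ((cellForm_nonneg_iff hA hA' h0 h0').1 hx).1)
    {i | intVec (cellForm A A' ω₀ ω₀' i) ⬝ᵥ k₀ = 0} (fun x => by
      rw [eq_cellOf_of_mem hδ hk₀δ, mem_cellOf_iff_cellForm hA hA' h0 h0' hC]
      rfl)
  refine ⟨D, fun i j => ⟨D.primitive i j, ?_⟩⟩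
  set k := D.gen i j
  have hk := hD i j
  have hk0 : natVec k ≠ 0 := hk.2.1
  -- The open ray through an extreme vector is the cell of that vector: a point of the cell
  -- annihilates the same forms, so it is a multiple of `k`. The coordinate forms make the factor
  -- positive.
  have : spannedCone (fun _ : Fin 1 => k) =
      cellOf (newtonPolyhedron A) (newtonPolyhedron A') (natVec k) := by
    ext x
    rw [mem_cellOf_iff_cellForm hA hA' h0 h0' hk.1, mem_spannedCone_one]
    constructor
    · rintro ⟨c, hc, rfl⟩ l
      rw [dotProduct_smul, smul_eq_mul]
      refine ⟨mul_nonneg hc.le (hk.1 l), ?_⟩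
      rw [mul_eq_zero, or_iff_right hc.ne']
    · intro hx
      obtain ⟨c, rfl⟩ := hk.2.2 x fun l hl => (hx l).2.2 hl
      refine ⟨c, ?_, rfl⟩
      have hx0 := ((cellForm_nonneg_iff hA hA' h0 h0').1 fun l => (hx l).1).1
      obtain ⟨l, hl⟩ := Function.ne_iff.1 hk0
      have hl' : 0 < natVec k l := lt_of_le_of_ne (natVec_nonneg k l) (Ne.symm hl)
      have h1 : 0 ≤ c * natVec k l := hx0 l
      have h2 := (hx (.inl l)).2
      simp only [cellForm, intVec_single_dotProduct, Pi.smul_apply, smul_eq_mul] at h2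
      have h3 : c ≠ 0 := fun h => hl'.ne' (h2.1 (by rw [h, zero_mul]))
      exact lt_of_le_of_ne (nonneg_of_mul_nonneg_left h1 hl') h3.symm
  rw [this]
  exact cellOf_mem_conePartition hA hA0 hA' hA0' (natVec_nonneg k)

end Cells

/-! ### Linearity of `m` on simplicial cones -/

section Linear
variable {n : ℕ}

theorem sum_smul_natVec_nonneg {r : ℕ} {v : Fin r → Fin n → ℕ} {c : Fin r → ℝ} (hc : 0 ≤ c) :
    0 ≤ ∑ j, c j • natVec (v j) :=
  Finset.sum_nonneg fun j _ => smul_nonneg (hc j) (natVec_nonneg _)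

/-- `m` is linear on the closed simplicial cones contained in the closure of a cell. -/
theorem mVal_sum {A : Set (Fin n →₀ ℕ)} (hA : A.Finite) (hA0 : A.Nonempty) {r : ℕ}
    {v : Fin r → Fin n → ℕ} {τ : Set (Fin n → ℝ)}
    (hv : spannedCone v ⊆ faceCone (newtonPolyhedron A) τ) {c : Fin r → ℝ} (hc : 0 ≤ c) :
    mVal (newtonPolyhedron A) (∑ j, c j • natVec (v j)) =
      ∑ j, c j * mVal (newtonPolyhedron A) (natVec (v j)) := by
  set k₀ := ∑ j, natVec (v j)
  have hk₀ : k₀ ∈ spannedCone v := ⟨fun _ => 1, fun _ => one_pos, by simp [k₀]⟩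
  obtain ⟨ω, hω, hm⟩ := exists_mVal_eq hA hA0 (hv hk₀).1
  -- An exponent minimal on the open cone is minimal for each generator: `k₀ + M v_l` stays in the
  -- open cone for all `M ≥ 0`, so `ω` minimizes there, and a large `M` isolates the contribution of
  -- `v_l`.
  have hmin : ∀ l, ∀ ω' ∈ A, natVec (v l) ⬝ᵥ natVec ω ≤ natVec (v l) ⬝ᵥ natVec ω' := by
    intro l ω' hω'
    have hM : ∀ M : ℝ, 0 ≤ M → k₀ ⬝ᵥ natVec ω + M * (natVec (v l) ⬝ᵥ natVec ω) ≤
        k₀ ⬝ᵥ natVec ω' + M * (natVec (v l) ⬝ᵥ natVec ω') := by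
      intro M hM
      have hx : k₀ + M • natVec (v l) ∈ spannedCone v := by
        refine ⟨fun j => 1 + if j = l then M else 0, fun j => ?_, ?_⟩
        · dsimp only
          split_ifs <;> linarith
        · simp [k₀, add_smul, Finset.sum_add_distrib, ite_smul]
      have h1 : natVec ω ∈ firstMeet (newtonPolyhedron A) (k₀ + M • natVec (v l)) := by
        rw [(hv hx).2, ← (hv hk₀).2]
        exact (natVec_mem_firstMeet hω).2 hm.symm
      have h2 := (isMin_iff_mVal hA (hv hx).1 hω).1 h1.2 ω' hω'
      simpa [add_dotProduct, smul_dotProduct] using h2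
    by_contra! hlt
    set d := natVec (v l) ⬝ᵥ natVec ω - natVec (v l) ⬝ᵥ natVec ω' with hd
    have hd0 : 0 < d := by linarith
    have h3 := hM ((|k₀ ⬝ᵥ natVec ω' - k₀ ⬝ᵥ natVec ω| + 1) / d) (by positivity)
    have h4 : (|k₀ ⬝ᵥ natVec ω' - k₀ ⬝ᵥ natVec ω| + 1) / d * d ≤
        k₀ ⬝ᵥ natVec ω' - k₀ ⬝ᵥ natVec ω := by
      rw [hd, mul_sub, ← hd]; linarith
    rw [div_mul_cancel₀ _ hd0.ne'] at h4
    linarith [le_abs_self (k₀ ⬝ᵥ natVec ω' - k₀ ⬝ᵥ natVec ω)]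
  rw [mVal_eq_of_isMin (sum_smul_natVec_nonneg hc) hω fun ω' hω' => ?_, sum_dotProduct]
  · refine Finset.sum_congr rfl fun j _ => ?_
    rw [smul_dotProduct, smul_eq_mul, mVal_eq_of_isMin (natVec_nonneg _) hω (hmin j)]
  · simp only [sum_dotProduct, smul_dotProduct, smul_eq_mul]
    exact Finset.sum_le_sum fun j _ => mul_le_mul_of_nonneg_left (hmin j ω' hω') (hc j)

end Linear

/-! ### Products of geometric series over `ℕ^r` -/

section MultiSum

theorem hasSum_mul_of_summable_norm {α β : Type*} {f : α → ℂ} {g : β → ℂ} {b : ℂ}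
    (hf : Summable fun x => ‖f x‖) (hg : Summable fun x => ‖g x‖) (hb : HasSum g b) :
    Summable (fun x : α × β => ‖f x.1 * g x.2‖) ∧
      HasSum (fun x : α × β => f x.1 * g x.2) ((∑' a, f a) * b) :=
  ⟨hf.mul_norm hg, hf.of_norm.hasSum.mul hb (hf.mul_norm hg).of_norm⟩

theorem summable_norm_prod_pi {r : ℕ} (f : Fin r → ℕ → ℂ) (hf : ∀ j, Summable fun a => ‖f j a‖) :
    Summable (fun N : Fin r → ℕ => ‖∏ j, f j (N j)‖) ∧
      HasSum (fun N : Fin r → ℕ => ∏ j, f j (N j)) (∏ j, ∑' a, f j a) := by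
  induction r with
  | zero =>
    refine ⟨(hasSum_fintype _).summable, ?_⟩
    simp
  | succ r ih =>
    obtain ⟨h1, h2⟩ := ih (fun j => f j.succ) fun j => hf _
    let e := Fin.insertNthEquiv (fun _ : Fin (r + 1) => ℕ) 0
    have he : (fun N : Fin (r + 1) → ℕ => ∏ j, f j (N j)) ∘ e =
        fun x : ℕ × (Fin r → ℕ) => f 0 x.1 * ∏ j, f j.succ (x.2 j) := by
      ext x
      simp [e, Fin.prod_univ_succ]
    obtain ⟨h3, h4⟩ := hasSum_mul_of_summable_norm (hf 0) h1 h2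
    refine ⟨?_, ?_⟩
    · rw [← e.summable_iff]
      refine h3.congr fun x => ?_
      exact congrArg norm (congrFun he x).symm
    · rw [← e.hasSum_iff, he, Fin.prod_univ_succ]
      exact h4

theorem hasSum_pow_succ_pi {r : ℕ} (q : Fin r → ℂ) (hq : ∀ j, ‖q j‖ < 1) :
    Summable (fun N : Fin r → ℕ => ‖∏ j, q j ^ (N j + 1)‖) ∧
      HasSum (fun N : Fin r → ℕ => ∏ j, q j ^ (N j + 1)) (∏ j, (q j / (1 - q j))) := by
  have h1 : ∀ j, Summable fun a : ℕ => ‖q j ^ (a + 1)‖ := fun j => by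
    simp only [pow_succ, norm_mul, norm_pow]
    exact (summable_geometric_of_lt_one (norm_nonneg _) (hq j)).mul_right _
  have h2 : ∀ j, ∑' a : ℕ, q j ^ (a + 1) = q j / (1 - q j) := fun j => by
    simp only [pow_succ]
    rw [tsum_mul_right, tsum_geometric_of_norm_lt_one (hq j)]
    ring
  have := summable_norm_prod_pi (fun j a => q j ^ (a + 1)) h1
  simpa only [h2] using this

theorem summable_pow_pi {r : ℕ} (q : ℝ) (hq : 0 ≤ q) (hq1 : q < 1) :
    Summable fun N : Fin r → ℕ => q ^ ∑ j, N j := by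
  have := (summable_norm_prod_pi (r := r) (fun _ a => (q : ℂ) ^ a) fun j => by
    simp only [norm_pow, Complex.norm_real, Real.norm_of_nonneg hq]
    exact summable_geometric_of_lt_one hq hq1).1
  simpa [Finset.prod_pow_eq_pow_sum, abs_of_nonneg hq] using this

end MultiSum

/-! ### Lattice points of an open simplicial cone -/

section Box
variable {n r : ℕ}

theorem boxPoints_finite (v : Fin r → Fin n → ℕ) : (boxPoints v).Finite := by
  refine (Set.finite_Icc (0 : Fin n → ℤ) (fun i => ∑ j, (v j i : ℤ))).subset ?_
  rintro h ⟨c, hc, hh⟩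
  have hi : ∀ i, (h i : ℝ) = ∑ j, c j * v j i := fun i => by
    simpa [intVec, natVec] using congrFun hh i
  refine ⟨fun i => ?_, fun i => ?_⟩
  · have : (0 : ℝ) ≤ h i := by
      rw [hi]; exact Finset.sum_nonneg fun j _ => mul_nonneg (hc j).1 (Nat.cast_nonneg _)
    exact_mod_cast this
  · have : (h i : ℝ) ≤ ∑ j, (v j i : ℝ) := by
      rw [hi]
      exact Finset.sum_le_sum fun j _ => mul_le_of_le_one_left (Nat.cast_nonneg _) (hc j).2.le
    exact_mod_cast this

theorem exists_natVec_eq_of_mem_boxPoints {v : Fin r → Fin n → ℕ} {h : Fin n → ℤ}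
    (hh : h ∈ boxPoints v) : ∃ k : Fin n → ℕ, intVec h = natVec k := by
  obtain ⟨c, hc, hh⟩ := hh
  have h0 : 0 ≤ intVec h := hh ▸ sum_smul_natVec_nonneg fun j => (hc j).1
  refine ⟨fun i => (h i).toNat, ?_⟩
  ext i
  have h1 : (0 : ℝ) ≤ h i := h0 i
  have : 0 ≤ h i := by exact_mod_cast h1
  simp only [intVec, natVec]
  exact_mod_cast (Int.toNat_of_nonneg this).symm

/-- Every integer point of an open simplicial cone is, in a unique way, a combination of the
generators with positive integer coefficients minus a point of the half-open box. -/
theorem exists_box_equiv (v : Fin r → Fin n → ℕ)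
    (hv : LinearIndependent ℝ fun j => natVec (v j)) :
    ∃ e : boxPoints v × (Fin r → ℕ) ≃ {k : Fin n → ℕ // natVec k ∈ spannedCone v},
      ∀ x, natVec (e x).1 = ∑ j, ((x.2 j : ℝ) + 1) • natVec (v j) - intVec x.1.1 := by
  choose b hb hbx using fun h : boxPoints v => h.2
  have hx : ∀ x : boxPoints v × (Fin r → ℕ), ∑ j, ((x.2 j : ℝ) + 1) • natVec (v j) - intVec x.1.1 =
      ∑ j, ((x.2 j : ℝ) + 1 - b x.1 j) • natVec (v j) := fun x => by
    rw [hbx, ← Finset.sum_sub_distrib]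
    simp only [sub_smul]
  have hpos : ∀ x : boxPoints v × (Fin r → ℕ), ∀ j, 0 < (x.2 j : ℝ) + 1 - b x.1 j := fun x j => by
    have := (hb x.1 j).2
    have : (0 : ℝ) ≤ x.2 j := Nat.cast_nonneg _
    linarith
  have hnat : ∀ x : boxPoints v × (Fin r → ℕ), ∃ k : Fin n → ℕ,
      natVec k = ∑ j, ((x.2 j : ℝ) + 1) • natVec (v j) - intVec x.1.1 := fun x => by
    have h0 : 0 ≤ ∑ j, ((x.2 j : ℝ) + 1) • natVec (v j) - intVec x.1.1 := by
      rw [hx]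
      exact sum_smul_natVec_nonneg fun j => (hpos x j).le
    refine ⟨fun i => (∑ j, ((x.2 j : ℤ) + 1) * v j i - x.1.1 i).toNat, ?_⟩
    ext i
    have e1 : (∑ j, ((x.2 j : ℝ) + 1) • natVec (v j) - intVec x.1.1) i =
        ((∑ j, ((x.2 j : ℤ) + 1) * v j i - x.1.1 i : ℤ) : ℝ) := by
      simp [intVec, natVec]
    have h1 : (0 : ℝ) ≤ _ := h0 i
    rw [e1] at h1 ⊢
    have h2 : 0 ≤ ∑ j, ((x.2 j : ℤ) + 1) * v j i - x.1.1 i := by exact_mod_cast h1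
    simp only [natVec]
    exact_mod_cast Int.toNat_of_nonneg h2
  choose K hK using hnat
  let f : boxPoints v × (Fin r → ℕ) → {k : Fin n → ℕ // natVec k ∈ spannedCone v} := fun x =>
    ⟨K x, fun j => (x.2 j : ℝ) + 1 - b x.1 j, hpos x, by rw [hK, hx]⟩
  have hinj : Function.Injective f := by
    intro x y hxy
    have h1 : K x = K y := congrArg Subtype.val hxy
    have h2 : ∑ j, ((x.2 j : ℝ) + 1 - b x.1 j) • natVec (v j) =
        ∑ j, ((y.2 j : ℝ) + 1 - b y.1 j) • natVec (v j) := by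
      rw [← hx, ← hx, ← hK, ← hK, h1]
    have h3 : ∀ j, (x.2 j : ℝ) + 1 - b x.1 j = (y.2 j : ℝ) + 1 - b y.1 j := by
      have h4 := Fintype.linearIndependent_iff.1 hv
        (fun j => ((x.2 j : ℝ) + 1 - b x.1 j) - ((y.2 j : ℝ) + 1 - b y.1 j))
        (by simp only [sub_smul _ ((_ : ℝ) - _), Finset.sum_sub_distrib]; rw [h2, sub_self])
      exact fun j => sub_eq_zero.1 (h4 j)
    -- The coefficient `N + 1 - b` lies in `(N, N + 1]`, so it determines the integer `N`.
    have h5 : x.2 = y.2 := by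
      ext j
      have e := h3 j
      have e1 := hb x.1 j
      have e2 := hb y.1 j
      have a1 : (x.2 j : ℝ) < y.2 j + 1 := by linarith
      have a2 : (y.2 j : ℝ) < x.2 j + 1 := by linarith
      have a1' : x.2 j < y.2 j + 1 := by exact_mod_cast a1
      have a2' : y.2 j < x.2 j + 1 := by exact_mod_cast a2
      omega
    refine Prod.ext (Subtype.ext ?_) h5
    have h6 : intVec x.1.1 = intVec y.1.1 := by
      rw [hbx, hbx]
      refine Finset.sum_congr rfl fun j _ => ?_
      have e := h3 j
      rw [h5] at e
      rw [show b x.1 j = b y.1 j by linarith]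
    ext i
    exact Int.cast_injective (α := ℝ) (congrFun h6 i)
  have hsurj : Function.Surjective f := by
    rintro ⟨k, c, hc, hk⟩
    -- Write `c j` as its ceiling minus a remainder in `[0, 1)`; the remainders are the coefficients
    -- of the box point. As `c j > 0`, the ceiling is at least one, which matches the shift `N_j +
    -- 1`.
    have hN : ∀ j, 1 ≤ ⌈c j⌉₊ := fun j => Nat.one_le_ceil_iff.2 (hc j)
    have hN' : ∀ j, (((⌈c j⌉₊ - 1 : ℕ) : ℝ) + 1) = ⌈c j⌉₊ := fun j => by
      rw [Nat.cast_sub (hN j)]; simp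
    let h : Fin n → ℤ := fun i => ∑ j, (⌈c j⌉₊ : ℤ) * v j i - k i
    have hh : intVec h = ∑ j, ((⌈c j⌉₊ : ℝ) - c j) • natVec (v j) := by
      have : intVec h = ∑ j, (⌈c j⌉₊ : ℝ) • natVec (v j) - natVec k := by
        ext i
        simp [intVec, natVec, h]
      rw [this, hk, ← Finset.sum_sub_distrib]
      simp only [sub_smul]
    refine ⟨(⟨h, fun j => (⌈c j⌉₊ : ℝ) - c j, fun j => ⟨?_, ?_⟩, hh⟩, fun j => ⌈c j⌉₊ - 1), ?_⟩
    · linarith [Nat.le_ceil (c j)]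
    · linarith [Nat.ceil_lt_add_one (hc j).le]
    · refine Subtype.ext (natVec_injective ?_)
      refine (hK _).trans ?_
      simp only [hN']
      rw [hh, hk, ← Finset.sum_sub_distrib]
      refine Finset.sum_congr rfl fun j _ => ?_
      rw [← sub_smul, sub_sub_cancel]
  exact ⟨Equiv.ofBijective f ⟨hinj, hsurj⟩, fun x => hK x⟩

end Box

/-! ### Rational functions of `p^{-s}` with rational coefficients -/

section Rational
variable {p : ℕ}

/-- `f` is a rational function of `p^{-s}` with rational coefficients on the right half plane. -/
def IsRationalIn (p : ℕ) (f : ℂ → ℂ) : Prop :=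
  ∃ A B : Polynomial ℚ, ∀ s : ℂ, 0 < s.re → Polynomial.aeval ((p : ℂ) ^ (-s)) B ≠ 0 ∧
    f s = Polynomial.aeval ((p : ℂ) ^ (-s)) A / Polynomial.aeval ((p : ℂ) ^ (-s)) B

theorem IsRationalIn.const (c : ℚ) : IsRationalIn p fun _ => (c : ℂ) :=
  ⟨Polynomial.C c, 1, fun s _ => by simp⟩

theorem IsRationalIn.add {f f' : ℂ → ℂ} (hf : IsRationalIn p f) (hf' : IsRationalIn p f') :
    IsRationalIn p fun s => f s + f' s := by
  obtain ⟨A, B, h⟩ := hf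
  obtain ⟨A', B', h'⟩ := hf'
  refine ⟨A * B' + B * A', B * B', fun s hs => ?_⟩
  simp only [(h s hs).2, (h' s hs).2, map_mul, map_add]
  exact ⟨mul_ne_zero (h s hs).1 (h' s hs).1, div_add_div _ _ (h s hs).1 (h' s hs).1⟩

theorem IsRationalIn.mul {f f' : ℂ → ℂ} (hf : IsRationalIn p f) (hf' : IsRationalIn p f') :
    IsRationalIn p fun s => f s * f' s := by
  obtain ⟨A, B, h⟩ := hf
  obtain ⟨A', B', h'⟩ := hf'
  refine ⟨A * A', B * B', fun s hs => ?_⟩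
  simp only [(h s hs).2, (h' s hs).2, map_mul]
  exact ⟨mul_ne_zero (h s hs).1 (h' s hs).1, div_mul_div_comm _ _ _ _⟩

theorem IsRationalIn.inv {f : ℂ → ℂ} (hf : IsRationalIn p f) (h0 : ∀ s : ℂ, 0 < s.re → f s ≠ 0) :
    IsRationalIn p fun s => (f s)⁻¹ := by
  obtain ⟨A, B, h⟩ := hf
  refine ⟨B, A, fun s hs => ⟨fun hA => h0 s hs ?_, ?_⟩⟩
  · rw [(h s hs).2, hA, zero_div]
  · simp only [(h s hs).2, inv_div]

theorem IsRationalIn.pow {f : ℂ → ℂ} (hf : IsRationalIn p f) (a : ℕ) :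
    IsRationalIn p fun s => f s ^ a := by
  induction a with
  | zero => simpa using IsRationalIn.const 1
  | succ a ih => simpa only [pow_succ] using ih.mul hf

theorem IsRationalIn.sum {ι : Type*} (I : Finset ι) {f : ι → ℂ → ℂ}
    (hf : ∀ i ∈ I, IsRationalIn p (f i)) : IsRationalIn p fun s => ∑ i ∈ I, f i s := by
  induction I using Finset.induction_on with
  | empty => simpa using IsRationalIn.const 0
  | insert i I hi ih =>
    simp only [Finset.sum_insert hi]
    exact (hf i (Finset.mem_insert_self _ _)).add
      (ih fun j hj => hf j (Finset.mem_insert_of_mem hj))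

theorem IsRationalIn.prod {ι : Type*} (I : Finset ι) {f : ι → ℂ → ℂ}
    (hf : ∀ i ∈ I, IsRationalIn p (f i)) : IsRationalIn p fun s => ∏ i ∈ I, f i s := by
  induction I using Finset.induction_on with
  | empty => simpa using IsRationalIn.const 1
  | insert i I hi ih =>
    simp only [Finset.prod_insert hi]
    exact (hf i (Finset.mem_insert_self _ _)).mul
      (ih fun j hj => hf j (Finset.mem_insert_of_mem hj))

end Rational

/-! ### Convergence and closed form of the series `S_δ` -/

section Series
variable {n t p : ℕ} [Fact p.Prime] {F : Fin t → MvPolynomial (Fin n) ℤ_[p]}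
  {g : MvPolynomial (Fin n) ℤ_[p]}

/-- The support of a polynomial mapping. -/
def mapSupport (F : Fin t → MvPolynomial (Fin n) ℤ_[p]) : Set (Fin n →₀ ℕ) :=
  {ω | ∃ i, coeff ω (F i) ≠ 0}

/-- The support of a polynomial, as a set. -/
def polySupport (g : MvPolynomial (Fin n) ℤ_[p]) : Set (Fin n →₀ ℕ) :=
  {ω | coeff ω g ≠ 0}

theorem mapNewton_eq : mapNewton F = newtonPolyhedron (mapSupport F) := rfl

theorem polyNewton_eq : polyNewton g = newtonPolyhedron (polySupport g) := rfl

theorem polySupport_finite : (polySupport g).Finite :=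
  g.support.finite_toSet.subset fun ω hω => by simpa [polySupport] using hω

theorem mapSupport_finite : (mapSupport F).Finite := by
  refine (Set.finite_iUnion fun i => polySupport_finite (g := F i)).subset fun ω hω => ?_
  exact Set.mem_iUnion.2 hω

theorem polySupport_nonempty (hg : g ≠ 0) : (polySupport g).Nonempty :=
  MvPolynomial.ne_zero_iff.1 hg

theorem mapSupport_nonempty (hF : F ≠ 0) : (mapSupport F).Nonempty := by
  obtain ⟨i, hi⟩ := Function.ne_iff.1 hF
  obtain ⟨ω, hω⟩ := MvPolynomial.ne_zero_iff.1 hi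
  exact ⟨ω, i, hω⟩

theorem one_lt_prime_real : (1 : ℝ) < p := by exact_mod_cast (Fact.out : p.Prime).one_lt

theorem prime_complex_ne_zero : (p : ℂ) ≠ 0 := by
  exact_mod_cast (Fact.out : p.Prime).ne_zero

theorem norm_prime_cpow (z : ℂ) : ‖(p : ℂ) ^ z‖ = (p : ℝ) ^ z.re :=
  Complex.norm_natCast_cpow_of_pos (Fact.out : p.Prime).pos z

theorem prime_cpow_ne_zero (z : ℂ) : (p : ℂ) ^ z ≠ 0 := by
  rw [← norm_ne_zero_iff, norm_prime_cpow]
  have := one_lt_prime_real (p := p)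
  positivity

theorem prime_cpow_sum {r : ℕ} (z : Fin r → ℂ) : (p : ℂ) ^ ∑ j, z j = ∏ j, (p : ℂ) ^ z j := by
  simp only [Complex.cpow_def_of_ne_zero (prime_complex_ne_zero (p := p)), Finset.mul_sum,
    Complex.exp_sum]

theorem exists_mVal_natVec {A : Set (Fin n →₀ ℕ)} (hA : A.Finite) (hA0 : A.Nonempty)
    (k : Fin n → ℕ) : ∃ ω ∈ A, mVal (newtonPolyhedron A) (natVec k) = ((∑ i, k i * ω i : ℕ) : ℝ) := by
  obtain ⟨ω, hω, h⟩ := exists_mVal_eq hA hA0 (natVec_nonneg k)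
  refine ⟨ω, hω, ?_⟩
  rw [h]
  simp [dotProduct, natVec]

theorem sigma_natVec (k : Fin n → ℕ) : sigma (natVec k) = ((∑ i, k i : ℕ) : ℝ) := by
  simp [sigma, natVec]

/-- The minima are attained at exponents, so the exponent is `a s + b` with natural numbers `a`,
`b`. This gives rationality in `p^{-s}`; the bound `σ(k) ≤ b` gives convergence and excludes poles
when `a = 0`. -/
theorem exists_expo_natVec (hF : F ≠ 0) (hg : g ≠ 0) (k : Fin n → ℕ) :
    ∃ a b : ℕ, mVal (mapNewton F) (natVec k) = a ∧ ∑ i, k i ≤ b ∧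
      mVal (polyNewton g) (natVec k) + sigma (natVec k) = b ∧
      ∀ s, expo F g s (natVec k) = a * s + b := by
  obtain ⟨ω, -, h⟩ := exists_mVal_natVec (mapSupport_finite (F := F)) (mapSupport_nonempty hF) k
  obtain ⟨ω', -, h'⟩ := exists_mVal_natVec (polySupport_finite (g := g)) (polySupport_nonempty hg) k
  refine ⟨_, ∑ i, k i * ω' i + ∑ i, k i, h, Nat.le_add_left _ _, ?_, fun s => ?_⟩
  · rw [polyNewton_eq, h', sigma_natVec, Nat.cast_add]
  · rw [expo, mapNewton_eq, polyNewton_eq, h, h', sigma_natVec]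
    push_cast
    ring

theorem expo_re_ge (hF : F ≠ 0) (hg : g ≠ 0) {s : ℂ} (hs : 0 ≤ s.re) (k : Fin n → ℕ) :
    ((∑ i, k i : ℕ) : ℝ) ≤ (expo F g s (natVec k)).re := by
  obtain ⟨a, b, -, hb, -, h⟩ := exists_expo_natVec hF hg k
  rw [h]
  simp only [Complex.add_re, Complex.mul_re, Complex.natCast_re, Complex.natCast_im, zero_mul,
    sub_zero]
  have : ((∑ i, k i : ℕ) : ℝ) ≤ b := Nat.cast_le.2 hb
  have := mul_nonneg (Nat.cast_nonneg (α := ℝ) a) hs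
  linarith

theorem norm_term_le (hF : F ≠ 0) (hg : g ≠ 0) {s : ℂ} (hs : 0 ≤ s.re) (k : Fin n → ℕ) :
    ‖(p : ℂ) ^ (-expo F g s (natVec k))‖ ≤ ((p : ℝ)⁻¹) ^ ∑ i, k i := by
  rw [norm_prime_cpow, inv_pow, ← Real.rpow_natCast, ← Real.rpow_neg (Nat.cast_nonneg p)]
  refine Real.rpow_le_rpow_of_exponent_le one_lt_prime_real.le ?_
  rw [Complex.neg_re]
  exact neg_le_neg (expo_re_ge hF hg hs k)

theorem summable_term (hF : F ≠ 0) (hg : g ≠ 0) {s : ℂ} (hs : 0 ≤ s.re) :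
    Summable fun k : Fin n → ℕ => (p : ℂ) ^ (-expo F g s (natVec k)) :=
  Summable.of_norm_bounded (summable_pow_pi _ (by positivity)
    (inv_lt_one_of_one_lt₀ one_lt_prime_real)) (norm_term_le hF hg hs)

theorem summable_STerm (hF : F ≠ 0) (hg : g ≠ 0) {s : ℂ} (hs : 0 ≤ s.re)
    (δ : Set (Fin n → ℝ)) : Summable (STerm F g δ s) :=
  (summable_term hF hg hs).subtype {k | natVec k ∈ δ}

theorem expo_sum (hF : F ≠ 0) (hg : g ≠ 0) {δ : Set (Fin n → ℝ)} (hδ : δ ∈ pairPartition F g)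
    {r : ℕ} {v : Fin r → Fin n → ℕ} (hv : spannedCone v ⊆ δ) {c : Fin r → ℝ} (hc : 0 ≤ c) (s : ℂ) :
    expo F g s (∑ j, c j • natVec (v j)) = ∑ j, (c j : ℂ) * expo F g s (natVec (v j)) := by
  obtain ⟨-, τ, τ', -, -, rfl⟩ := hδ
  have hs : sigma (∑ j, c j • natVec (v j)) = ∑ j, c j * sigma (natVec (v j)) := by
    simp only [sigma, Finset.sum_apply, Pi.smul_apply, smul_eq_mul, Finset.mul_sum]
    exact Finset.sum_comm
  simp only [expo]
  rw [mapNewton_eq, polyNewton_eq, hs, mVal_sum mapSupport_finite (mapSupport_nonempty hF)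
    (fun x hx => (hv hx).1) hc, mVal_sum polySupport_finite (polySupport_nonempty hg)
    (fun x hx => (hv hx).2) hc]
  push_cast
  rw [Finset.sum_mul, ← Finset.sum_add_distrib, ← Finset.sum_add_distrib]
  refine Finset.sum_congr rfl fun j _ => ?_
  ring

theorem IsPrimitive.sum_pos {k : Fin n → ℕ} (hk : IsPrimitive k) : 0 < ∑ i, k i := by
  obtain ⟨i, hi⟩ := Function.ne_iff.1 hk.ne_zero
  exact Finset.sum_pos' (fun _ _ => Nat.zero_le _) ⟨i, Finset.mem_univ i, Nat.pos_of_ne_zero hi⟩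

theorem prime_cpow_expo_ne_one (hF : F ≠ 0) (hg : g ≠ 0) {s : ℂ} (hs : 0 ≤ s.re) {k : Fin n → ℕ}
    (hk : IsPrimitive k) : (p : ℂ) ^ expo F g s (natVec k) - 1 ≠ 0 := by
  intro h
  have h1 := norm_prime_cpow (p := p) (expo F g s (natVec k))
  rw [sub_eq_zero.1 h, norm_one] at h1
  have h2 : (0 : ℝ) < (expo F g s (natVec k)).re :=
    lt_of_lt_of_le (by exact_mod_cast hk.sum_pos) (expo_re_ge hF hg hs k)
  exact (Real.one_lt_rpow one_lt_prime_real h2).ne h1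

/-- The bijection of `exists_box_equiv` and the linearity of the exponent split each term into a box
factor and powers `q_j^(N_j + 1)`. The geometric series start at exponent one, whence the positive
exponents in the numerator and the factors `q/(1 - q) = 1/(q⁻¹ - 1)`. -/
theorem hasSum_spannedCone (hF : F ≠ 0) (hg : g ≠ 0) {δ : Set (Fin n → ℝ)}
    (hδ : δ ∈ pairPartition F g) {r : ℕ} {v : Fin r → Fin n → ℕ} (hv : spannedCone v ⊆ δ)
    (hprim : ∀ j, IsPrimitive (v j)) (hli : LinearIndependent ℝ fun j => natVec (v j)) {s : ℂ}
    (hs : 0 < s.re) :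
    HasSum (fun k : {k : Fin n → ℕ // natVec k ∈ spannedCone v} =>
      (p : ℂ) ^ (-expo F g s (natVec k.1)))
      ((∑ᶠ h ∈ boxPoints v, (p : ℂ) ^ expo F g s (intVec h)) /
        ∏ j, ((p : ℂ) ^ expo F g s (natVec (v j)) - 1)) := by
  obtain ⟨e, he⟩ := exists_box_equiv v hli
  have hfin := boxPoints_finite v
  have : Finite (boxPoints v) := hfin
  have : Fintype (boxPoints v) := Fintype.ofFinite _
  set q : Fin r → ℂ := fun j => (p : ℂ) ^ (-expo F g s (natVec (v j)))
  have hq : ∀ j, ‖q j‖ < 1 := fun j => by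
    refine (norm_term_le hF hg hs.le (v j)).trans_lt ?_
    exact pow_lt_one₀ (by positivity) (inv_lt_one_of_one_lt₀ one_lt_prime_real)
      (hprim j).sum_pos.ne'
  obtain ⟨hN1, hN2⟩ := hasSum_pow_succ_pi q hq
  have hbox : ∑ᶠ h ∈ boxPoints v, (p : ℂ) ^ expo F g s (intVec h) =
      ∑' h : boxPoints v, (p : ℂ) ^ expo F g s (intVec h.1) := by
    rw [tsum_fintype, finsum_mem_eq_finite_toFinset_sum _ hfin]
    rw [Finset.sum_subtype hfin.toFinset (p := fun h => h ∈ boxPoints v) (by simp)]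
  have hprod : (∏ j, ((p : ℂ) ^ expo F g s (natVec (v j)) - 1))⁻¹ = ∏ j, (q j / (1 - q j)) := by
    rw [← Finset.prod_inv_distrib]
    refine Finset.prod_congr rfl fun j _ => ?_
    have h0 := prime_cpow_ne_zero (p := p) (expo F g s (natVec (v j)))
    have h1 := prime_cpow_expo_ne_one hF hg hs.le (hprim j)
    simp only [q, Complex.cpow_neg]
    have h2 : 1 - ((p : ℂ) ^ expo F g s (natVec (v j)))⁻¹ ≠ 0 := by
      rw [sub_ne_zero] at h1 ⊢
      intro h
      exact h1 (by rw [← inv_inv ((p : ℂ) ^ expo F g s (natVec (v j))), ← h, inv_one])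
    field_simp
  rw [div_eq_mul_inv, hprod, hbox, ← e.hasSum_iff]
  have h3 := (hasSum_mul_of_summable_norm (f := fun h : boxPoints v =>
    (p : ℂ) ^ expo F g s (intVec h.1)) (hasSum_fintype _).summable hN1 hN2).2
  convert h3 using 1
  ext ⟨⟨h, b, hb, hbv⟩, N⟩
  have hx := he ⟨⟨h, b, hb, hbv⟩, N⟩
  simp only at hx
  have hx' : natVec (e ⟨⟨h, b, hb, hbv⟩, N⟩).1 = ∑ j, ((N j : ℝ) + 1 - b j) • natVec (v j) := by
    rw [hx, hbv, ← Finset.sum_sub_distrib]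
    simp only [sub_smul]
  have hneg : -expo F g s (∑ j, ((N j : ℝ) + 1 - b j) • natVec (v j)) =
      expo F g s (∑ j, b j • natVec (v j)) +
        ∑ j, ((N j + 1 : ℕ) : ℂ) * (-expo F g s (natVec (v j))) := by
    rw [expo_sum hF hg hδ hv (c := b) (fun j => (hb j).1),
      expo_sum hF hg hδ hv (c := fun j => (N j : ℝ) + 1 - b j)
        (fun j => by
          have : (0 : ℝ) ≤ N j := Nat.cast_nonneg _
          have := (hb j).2
          show (0 : ℝ) ≤ (N j : ℝ) + 1 - b j
          linarith),
      ← Finset.sum_neg_distrib, ← Finset.sum_add_distrib]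
    refine Finset.sum_congr rfl fun j _ => ?_
    push_cast
    ring
  simp only [Function.comp_apply, hx', hbv]
  rw [hneg, Complex.cpow_add _ _ prime_complex_ne_zero, prime_cpow_sum]
  simp only [Complex.cpow_nat_mul, q]

theorem S_eq_closedS (hF : F ≠ 0) (hg : g ≠ 0) {δ : Set (Fin n → ℝ)}
    (hδ : δ ∈ pairPartition F g) (D : SimplicialPartition δ) {s : ℂ} (hs : 0 < s.re) :
    S F g δ s = closedS F g D s := by
  have hsub : ∀ i, spannedCone (D.gen i) ⊆ δ := fun i => by
    conv_rhs => rw [← D.union]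
    exact Set.subset_iUnion (fun i => spannedCone (D.gen i)) i
  have h1 : ∀ i, HasSum ({k : Fin n → ℕ | natVec k ∈ spannedCone (D.gen i)}.indicator
      fun k => (p : ℂ) ^ (-expo F g s (natVec k))) _ := fun i =>
    hasSum_subtype_iff_indicator.1
      (hasSum_spannedCone hF hg hδ (hsub i) (D.primitive i) (D.linearIndependent i) hs)
  have h2 := hasSum_sum (s := Finset.univ) fun i _ => h1 i
  have h3 : (fun k : Fin n → ℕ => ∑ i, {k : Fin n → ℕ | natVec k ∈ spannedCone (D.gen i)}.indicator
      (fun k => (p : ℂ) ^ (-expo F g s (natVec k))) k) = {k : Fin n → ℕ | natVec k ∈ δ}.indicator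
      fun k => (p : ℂ) ^ (-expo F g s (natVec k)) := by
    ext k
    by_cases hk : natVec k ∈ δ
    · have hk' := hk
      rw [← D.union] at hk'
      obtain ⟨i, hi⟩ := Set.mem_iUnion.1 hk'
      rw [Finset.sum_eq_single i]
      · rw [Set.indicator_of_mem (by exact hi), Set.indicator_of_mem (by exact hk)]
      · intro i' _ hne
        have : k ∉ {k : Fin n → ℕ | natVec k ∈ spannedCone (D.gen i')} := fun h =>
          Set.disjoint_left.1 (D.disjoint i' i hne) h hi
        exact Set.indicator_of_notMem this _
      · simp
    · rw [Set.indicator_of_notMem (by exact hk)]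
      refine Finset.sum_eq_zero fun i _ => ?_
      have : k ∉ {k : Fin n → ℕ | natVec k ∈ spannedCone (D.gen i)} := fun h => hk (hsub i h)
      exact Set.indicator_of_notMem this _
  rw [h3] at h2
  exact (hasSum_subtype_iff_indicator.2 h2).tsum_eq

theorem IsRationalIn.prime_cpow : IsRationalIn p fun s => (p : ℂ) ^ s :=
  ⟨1, Polynomial.X, fun s _ => by
    simp only [Polynomial.aeval_X, map_one]
    exact ⟨prime_cpow_ne_zero _, by rw [Complex.cpow_neg, one_div, inv_inv]⟩⟩

theorem isRationalIn_expo (hF : F ≠ 0) (hg : g ≠ 0) (k : Fin n → ℕ) :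
    IsRationalIn p fun s => (p : ℂ) ^ expo F g s (natVec k) := by
  obtain ⟨a, b, -, -, -, h⟩ := exists_expo_natVec hF hg k
  have : (fun s => (p : ℂ) ^ expo F g s (natVec k)) =
      fun s => ((p : ℂ) ^ s) ^ a * (((p : ℚ) ^ b : ℚ) : ℂ) := by
    ext s
    rw [h, Complex.cpow_add _ _ prime_complex_ne_zero, Complex.cpow_nat_mul, Complex.cpow_natCast]
    push_cast
    rfl
  rw [this]
  exact (IsRationalIn.prime_cpow.pow a).mul (IsRationalIn.const _)

theorem closedS_eq_sum {δ : Set (Fin n → ℝ)} (D : SimplicialPartition δ) (s : ℂ) :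
    closedS F g D s = ∑ i, (∑ h ∈ (boxPoints_finite (D.gen i)).toFinset,
      (p : ℂ) ^ expo F g s (intVec h)) *
        (∏ j, ((p : ℂ) ^ expo F g s (natVec (D.gen i j)) - 1))⁻¹ := by
  rw [closedS]
  refine Finset.sum_congr rfl fun i _ => ?_
  rw [finsum_mem_eq_finite_toFinset_sum _ (boxPoints_finite (D.gen i)), div_eq_mul_inv]

theorem isRationalIn_closedS (hF : F ≠ 0) (hg : g ≠ 0) {δ : Set (Fin n → ℝ)}
    (D : SimplicialPartition δ) : IsRationalIn p (closedS F g D) := by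
  rw [show closedS F g D = _ from funext (closedS_eq_sum D)]
  refine IsRationalIn.sum _ fun i _ => IsRationalIn.mul (IsRationalIn.sum _ fun h hh => ?_)
    (IsRationalIn.inv (IsRationalIn.prod _ fun j _ => ?_) fun s hs => ?_)
  · obtain ⟨k, hk⟩ := exists_natVec_eq_of_mem_boxPoints ((Set.Finite.mem_toFinset _).1 hh)
    simp only [hk]
    exact isRationalIn_expo hF hg k
  · simp only [sub_eq_add_neg]
    refine (isRationalIn_expo hF hg _).add ?_
    simpa using IsRationalIn.const (-1)
  · exact Finset.prod_ne_zero_iff.2 fun j _ =>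
      prime_cpow_expo_ne_one hF hg hs.le (D.primitive i j)

end Series

/-! ### Haar measure on `ℤ_pⁿ`: scalings and isometries -/

section Measure
variable {n p : ℕ} [Fact p.Prime]

/-- The restriction to `ℤ_pⁿ` of a measure on `ℚ_pⁿ`. -/
def coeHom (p n : ℕ) [Fact p.Prime] : (Fin n → ℤ_[p]) →+ (Fin n → ℚ_[p]) where
  toFun x i := x i
  map_zero' := by ext; simp
  map_add' x y := by ext; simp

theorem isOpenEmbedding_coeHom : Topology.IsOpenEmbedding (coeHom p n) :=
  Topology.IsOpenEmbedding.piMap fun _ => PadicInt.isOpenEmbedding_coe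

theorem range_coeHom : Set.range (coeHom p n) = integralBox p n := by
  ext x
  constructor
  · rintro ⟨y, rfl⟩ i
    exact (y i).2
  · intro hx
    exact ⟨fun i => ⟨x i, hx i⟩, rfl⟩

/-- Multiplication by `p^{k_i}` in the `i`-th coordinate. -/
def scale (k : Fin n → ℕ) : (Fin n → ℤ_[p]) →+ (Fin n → ℤ_[p]) where
  toFun x i := (p : ℤ_[p]) ^ k i * x i
  map_zero' := by ext; simp
  map_add' x y := by ext; simp [mul_add]

@[simp] theorem scale_apply (k : Fin n → ℕ) (x : Fin n → ℤ_[p]) (i : Fin n) :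
    scale k x i = (p : ℤ_[p]) ^ k i * x i := rfl

theorem prime_padicInt_ne_zero : (p : ℤ_[p]) ≠ 0 := PadicInt.prime_p.ne_zero

theorem scale_injective (k : Fin n → ℕ) : Function.Injective (scale (p := p) k) := by
  intro x y h
  ext i
  have := congrFun h i
  simp only [scale_apply] at this
  rw [mul_left_cancel₀ (pow_ne_zero _ prime_padicInt_ne_zero) this]

theorem continuous_scale (k : Fin n → ℕ) : Continuous (scale (p := p) k) := by
  refine continuous_pi fun i => ?_
  exact continuous_const.mul (continuous_apply i)

/-- The reduction of the `i`-th coordinate modulo `p^{k_i}`. -/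
def reduceHom (k : Fin n → ℕ) : (Fin n → ℤ_[p]) →+ (∀ i, ZMod (p ^ k i)) where
  toFun x i := PadicInt.toZModPow (k i) (x i)
  map_zero' := by ext; simp
  map_add' x y := by ext; simp

theorem ker_reduceHom (k : Fin n → ℕ) :
    ((reduceHom (p := p) k).ker : Set (Fin n → ℤ_[p])) = Set.range (scale k) := by
  ext x
  have h : ∀ i, PadicInt.toZModPow (k i) (x i) = 0 ↔ ∃ y, (p : ℤ_[p]) ^ k i * y = x i := fun i => by
    rw [← RingHom.mem_ker, PadicInt.ker_toZModPow, Ideal.mem_span_singleton, dvd_def]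
    simp only [eq_comm]
  simp only [SetLike.mem_coe, AddMonoidHom.mem_ker, funext_iff, Set.mem_range, scale_apply]
  exact (forall_congr' h).trans Classical.skolem

theorem index_ker_reduceHom (k : Fin n → ℕ) : (reduceHom (p := p) k).ker.index = p ^ ∑ i, k i := by
  have hsurj : Function.Surjective (reduceHom (p := p) k) := by
    intro y
    choose x hx using fun i => ZMod.ringHom_surjective (PadicInt.toZModPow (p := p) (k i)) (y i)
    exact ⟨x, funext hx⟩
  rw [AddSubgroup.index_ker, AddMonoidHom.range_eq_top.2 hsurj]
  rw [Nat.card_congr (AddSubgroup.topEquiv (G := ∀ i, ZMod (p ^ k i))).toEquiv, Nat.card_pi]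
  simp [Finset.prod_pow_eq_pow_sum]

theorem isClosedEmbedding_scale (k : Fin n → ℕ) : Topology.IsClosedEmbedding (scale (p := p) k) :=
  (continuous_scale k).isClosedEmbedding (scale_injective k)

theorem closedBall_subset_or_disjoint {X : Type*} [PseudoMetricSpace X] [IsUltrametricDist X]
    (x y : X) {r s : ℝ} (h : r ≤ s) : Metric.closedBall x r ⊆ Metric.closedBall y s ∨
      Disjoint (Metric.closedBall x r) (Metric.closedBall y s) := by
  have hrs := Metric.closedBall_subset_closedBall (x := x) h
  rcases IsUltrametricDist.closedBall_eq_or_disjoint x y s with h' | h'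
  · exact Or.inl (h' ▸ hrs)
  · exact Or.inr (h'.mono_left hrs)

theorem integrable_of_bound {X : Type*} [MeasurableSpace X] {ν : Measure X} [IsFiniteMeasure ν]
    {f : X → ℂ} (hf : Measurable f) (h : ∀ x, ‖f x‖ ≤ 1) : Integrable f ν :=
  Integrable.of_bound hf.aestronglyMeasurable 1 (Filter.Eventually.of_forall h)

variable [MeasurableSpace ℤ_[p]] [BorelSpace ℤ_[p]] {ν : Measure (Fin n → ℤ_[p])}
  [ν.IsAddHaarMeasure]

theorem measurableEmbedding_scale (k : Fin n → ℕ) : MeasurableEmbedding (scale (p := p) k) :=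
  (isClosedEmbedding_scale k).measurableEmbedding

/-- The image of the scaling is the kernel of a reduction map, a subgroup of index `p^{σ(k)}` whose
cosets have equal measure. -/
theorem measure_range_scale [IsProbabilityMeasure ν] (k : Fin n → ℕ) :
    ν (Set.range (scale k)) = ((p : ENNReal) ^ ∑ i, k i)⁻¹ := by
  have hp : p ^ (∑ i, k i) ≠ 0 := pow_ne_zero _ (Fact.out : p.Prime).ne_zero
  have : (reduceHom (p := p) k).ker.FiniteIndex := ⟨by rw [index_ker_reduceHom]; exact hp⟩
  have hm : MeasurableSet ((reduceHom (p := p) k).ker : Set (Fin n → ℤ_[p])) := by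
    rw [ker_reduceHom]
    exact (measurableEmbedding_scale k).measurableSet_range
  have h := AddSubgroup.index_mul_measure (reduceHom (p := p) k).ker hm ν
  rw [index_ker_reduceHom, ker_reduceHom, measure_univ] at h
  push_cast at h
  exact ENNReal.eq_inv_of_mul_eq_one_left (by rwa [mul_comm])

/-- Pulling `ν` back along the injective homomorphism `scale k` gives an invariant finite measure,
hence a multiple of `ν`; the total mass identifies the factor. -/
theorem map_scale [IsProbabilityMeasure ν] (k : Fin n → ℕ) :
    ν.restrict (Set.range (scale k)) = ((p : ENNReal) ^ ∑ i, k i)⁻¹ • ν.map (scale k) := by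
  have hme := measurableEmbedding_scale (p := p) k
  have hinv : (ν.comap (scale k)).IsAddLeftInvariant :=
    Measure.IsAddLeftInvariant.comap ν hme
  have hfin : IsFiniteMeasure (ν.comap (scale k)) := ⟨by
    rw [hme.comap_apply]; exact measure_lt_top _ _⟩
  have h := Measure.isAddLeftInvariant_eq_smul (ν.comap (scale k)) ν
  have h1 : ν.comap (scale k) Set.univ = ((p : ENNReal) ^ ∑ i, k i)⁻¹ := by
    rw [hme.comap_apply, Set.image_univ, measure_range_scale]
  have h2 := h1
  rw [h] at h2
  simp only [Measure.smul_apply, measure_univ] at h2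
  have h3 : ν.comap (scale k) = ((p : ENNReal) ^ ∑ i, k i)⁻¹ • ν := by
    rw [h, ← h2]
    ext s hs
    rw [Measure.smul_apply, Measure.smul_apply, ENNReal.smul_def, ENNReal.smul_def, smul_eq_mul,
      smul_eq_mul, smul_eq_mul, mul_one]
  rw [← hme.map_comap, h3, Measure.map_smul]

theorem setIntegral_range_scale [IsProbabilityMeasure ν] (k : Fin n → ℕ) (f : (Fin n → ℤ_[p]) → ℂ) :
    ∫ x in Set.range (scale k), f x ∂ν = ((p : ℂ) ^ ∑ i, k i)⁻¹ * ∫ x, f (scale k x) ∂ν := by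
  rw [map_scale, integral_smul_measure, (measurableEmbedding_scale k).integral_map]
  simp [Complex.real_smul]

/-- Two finite measures which agree on small balls and have the same mass agree. -/
theorem measure_ext_of_closedBall {m m' : Measure (Fin n → ℤ_[p])} [IsFiniteMeasure m]
    {ε : ℝ} (hε : 0 < ε) (h : ∀ x r, 0 < r → r ≤ ε → m (Metric.closedBall x r) =
      m' (Metric.closedBall x r)) (hu : m Set.univ = m' Set.univ) : m = m' := by
  let C : Set (Set (Fin n → ℤ_[p])) := {b | ∃ x r, 0 < r ∧ r ≤ ε ∧ b = Metric.closedBall x r}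
  have hC : TopologicalSpace.IsTopologicalBasis C := by
    refine TopologicalSpace.isTopologicalBasis_of_isOpen_of_nhds ?_ ?_
    · rintro _ ⟨x, r, hr, -, rfl⟩
      exact IsUltrametricDist.isOpen_closedBall x hr.ne'
    · intro x U hx hU
      obtain ⟨r, hr, hrU⟩ := Metric.nhds_basis_closedBall.mem_iff.1 (hU.mem_nhds hx)
      refine ⟨_, ⟨x, min r ε, lt_min hr hε, min_le_right _ _, rfl⟩,
        Metric.mem_closedBall_self (lt_min hr hε).le, ?_⟩
      exact (Metric.closedBall_subset_closedBall (min_le_left _ _)).trans hrU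
  refine ext_of_generate_finite C ?_ ?_ ?_ hu
  · rw [← hC.borel_eq_generateFrom]
    exact BorelSpace.measurable_eq
  -- Ultrametric balls are nested or disjoint, so the small balls form a π-system.
  · rintro _ ⟨x, r, hr, hrε, rfl⟩ _ ⟨y, s, hs, hsε, rfl⟩ hne
    rcases IsUltrametricDist.closedBall_subset_trichotomy x y r s with h | h | h
    · rw [Set.inter_eq_left.2 h]; exact ⟨x, r, hr, hrε, rfl⟩
    · rw [Set.inter_eq_right.2 h]; exact ⟨y, s, hs, hsε, rfl⟩
    · exact absurd h (Set.not_disjoint_iff_nonempty_inter.2 hne)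
  · rintro _ ⟨x, r, hr, hrε, rfl⟩
    exact h x r hr hrε

theorem measure_closedBall_eq (x y : Fin n → ℤ_[p]) (r : ℝ) :
    ν (Metric.closedBall x r) = ν (Metric.closedBall y r) := by
  rw [← measure_preimage_add ν (x - y) (Metric.closedBall x r)]
  congr 1
  ext z
  simp only [Set.mem_preimage, Metric.mem_closedBall, dist_eq_norm]
  rw [show x - y + z - x = z - y by abel]

/-- An isometric bijection between two balls of the same radius preserves the Haar measure. -/
theorem map_restrict_closedBall [IsProbabilityMeasure ν] {H : (Fin n → ℤ_[p]) → Fin n → ℤ_[p]} (hH : Measurable H)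
    {a b : Fin n → ℤ_[p]} {ε : ℝ} (hε : 0 < ε)
    (hiso : ∀ x ∈ Metric.closedBall a ε, ∀ y ∈ Metric.closedBall a ε, ‖H x - H y‖ = ‖x - y‖)
    (hmaps : ∀ x ∈ Metric.closedBall a ε, H x ∈ Metric.closedBall b ε)
    (hsurj : ∀ y ∈ Metric.closedBall b ε, ∃ x ∈ Metric.closedBall a ε, H x = y) :
    (ν.restrict (Metric.closedBall a ε)).map H = ν.restrict (Metric.closedBall b ε) := by
  refine measure_ext_of_closedBall hε (fun z r hr hrε => ?_) ?_
  · rw [Measure.map_apply hH Metric.isClosed_closedBall.measurableSet,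
      Measure.restrict_apply (hH Metric.isClosed_closedBall.measurableSet),
      Measure.restrict_apply Metric.isClosed_closedBall.measurableSet]
    rcases closedBall_subset_or_disjoint z b hrε with hz | hz
    -- The preimage of a ball inside the target is a ball of the same radius about a preimage of its
    -- centre, and balls of equal radius have equal measure.
    · obtain ⟨w, hw, rfl⟩ := hsurj z (hz (Metric.mem_closedBall_self hr.le))
      have hwa : Metric.closedBall w r ⊆ Metric.closedBall a ε := by
        rcases closedBall_subset_or_disjoint w a hrε with h | h
        · exact h
        · exact absurd hw (Set.disjoint_left.1 h (Metric.mem_closedBall_self hr.le))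
      rw [Set.inter_eq_left.2 hz, measure_closedBall_eq (H w) w]
      congr 1
      ext x
      simp only [Set.mem_inter_iff, Set.mem_preimage]
      constructor
      · rintro ⟨h1, h2⟩
        rw [mem_closedBall_iff_norm] at h1 ⊢
        rwa [← hiso x h2 w hw]
      · intro h
        refine ⟨?_, hwa h⟩
        rw [mem_closedBall_iff_norm] at h ⊢
        rwa [hiso x (hwa (by rwa [mem_closedBall_iff_norm])) w hw]
    · rw [hz.inter_eq, Set.eq_empty_of_forall_notMem (s := H ⁻¹' _ ∩ _)]
      rintro x ⟨h1, h2⟩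
      exact Set.disjoint_left.1 hz h1 (hmaps x h2)
  · rw [Measure.map_apply hH MeasurableSet.univ]
    simp only [Set.preimage_univ, Measure.restrict_apply_univ]
    exact measure_closedBall_eq a b ε

end Measure

/-! ### Hensel's lemma in several variables and change of variables -/

section Hensel
variable {n p : ℕ} [Fact p.Prime]

theorem toZMod_eq_zero_iff {x : ℤ_[p]} : PadicInt.toZMod x = 0 ↔ ‖x‖ ≤ (p : ℝ)⁻¹ := by
  rw [← RingHom.mem_ker, PadicInt.ker_toZMod, PadicInt.maximalIdeal_eq_span_p]
  have := PadicInt.norm_le_pow_iff_mem_span_pow x 1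
  simp only [Nat.cast_one, zpow_neg, zpow_one, pow_one] at this
  exact this.symm

theorem isUnit_iff_toZMod {x : ℤ_[p]} : IsUnit x ↔ PadicInt.toZMod x ≠ 0 := by
  rw [Ne, ← RingHom.mem_ker, PadicInt.ker_toZMod, IsLocalRing.mem_maximalIdeal, mem_nonunits_iff,
    not_not]

theorem inv_prime_pos : (0 : ℝ) < (p : ℝ)⁻¹ := inv_pos.2 (by
  have := one_lt_prime_real (p := p)
  linarith)

theorem inv_prime_lt_one : (p : ℝ)⁻¹ < 1 := inv_lt_one_of_one_lt₀ one_lt_prime_real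

theorem norm_sum_mul_le {m : ℕ} (c x : Fin m → ℤ_[p]) : ‖∑ j, c j * x j‖ ≤ ‖x‖ := by
  refine IsUltrametricDist.norm_sum_le_of_forall_le_of_nonneg (norm_nonneg _) fun j _ => ?_
  rw [norm_mul]
  exact (mul_le_of_le_one_left (norm_nonneg _) (PadicInt.norm_le_one _)).trans (norm_le_pi_norm x j)

theorem norm_add_le_of_le {E : Type*} [SeminormedAddCommGroup E] [IsUltrametricDist E] {x y : E}
    {c : ℝ} (hx : ‖x‖ ≤ c) (hy : ‖y‖ ≤ c) : ‖x + y‖ ≤ c :=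
  (IsUltrametricDist.norm_add_le_max x y).trans (max_le hx hy)

theorem norm_sub_le_of_le {E : Type*} [SeminormedAddCommGroup E] [IsUltrametricDist E] {x y : E}
    {c : ℝ} (hx : ‖x‖ ≤ c) (hy : ‖y‖ ≤ c) : ‖x - y‖ ≤ c := by
  rw [sub_eq_add_neg]
  exact norm_add_le_of_le hx (by rwa [norm_neg])

/-- First order approximation of a polynomial on a residue ball by its linear part at the centre. -/
theorem norm_eval_sub_le (h : MvPolynomial (Fin n) ℤ_[p]) {a x y : Fin n → ℤ_[p]}
    (hx : ‖x - a‖ ≤ (p : ℝ)⁻¹) (hy : ‖y - a‖ ≤ (p : ℝ)⁻¹) :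
    ‖eval x h - eval y h - ∑ j, eval a (pderiv j h) * (x - y) j‖ ≤ (p : ℝ)⁻¹ * ‖x - y‖ := by
  have hp := inv_prime_pos (p := p)
  induction h using MvPolynomial.induction_on generalizing x y with
  | C c => simp; positivity
  | add h h' ih ih' =>
    have : eval x (h + h') - eval y (h + h') - ∑ j, eval a (pderiv j (h + h')) * (x - y) j =
        (eval x h - eval y h - ∑ j, eval a (pderiv j h) * (x - y) j) +
        (eval x h' - eval y h' - ∑ j, eval a (pderiv j h') * (x - y) j) := by
      simp only [map_add, add_mul, Finset.sum_add_distrib]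
      ring
    rw [this]
    exact norm_add_le_of_le (ih hx hy) (ih' hx hy)
  | mul_X h i ih =>
    set D := ∑ j, eval a (pderiv j h) * (x - y) j with hD
    have hd : ∑ j, eval a (pderiv j (h * X i)) * (x - y) j = D * a i + eval a h * (x - y) i := by
      have : ∀ j, eval a (pderiv j (h * X i)) * (x - y) j =
          eval a (pderiv j h) * (x - y) j * a i +
            if j = i then eval a h * (x - y) j else 0 := fun j => by
        rw [pderiv_mul, pderiv_X]
        by_cases hj : j = i
        · subst hj
          simp
          ring
        · simp [hj, Ne.symm hj]
          ring
      simp only [this, Finset.sum_add_distrib, ← Finset.sum_mul, Finset.sum_ite_eq',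
        Finset.mem_univ, if_true]
      rfl
    -- Product rule with remainder: each of the three terms has a factor of norm at most `p⁻¹ ‖x -
    -- y‖`, or two factors of norm at most `p⁻¹` and `‖x - y‖`.
    have e : eval x (h * X i) - eval y (h * X i) - ∑ j, eval a (pderiv j (h * X i)) * (x - y) j =
        (eval x h - eval y h - D) * x i + D * (x - a) i + (eval y h - eval a h) * (x - y) i := by
      rw [hd]
      simp only [map_mul, eval_X, Pi.sub_apply]
      ring
    rw [e]
    refine norm_add_le_of_le (norm_add_le_of_le ?_ ?_) ?_
    · rw [norm_mul]
      exact (mul_le_of_le_one_right (norm_nonneg _) (PadicInt.norm_le_one _)).trans (ih hx hy)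
    · rw [norm_mul, mul_comm]
      exact mul_le_mul ((norm_le_pi_norm (x - a) i).trans hx) (norm_sum_mul_le _ _)
        (norm_nonneg _) hp.le
    · rw [norm_mul]
      refine mul_le_mul ?_ (norm_le_pi_norm (x - y) i) (norm_nonneg _) hp.le
      have h1 := ih (x := y) (y := a) hy (by simp)
      have h2 : ‖∑ j, eval a (pderiv j h) * (y - a) j‖ ≤ (p : ℝ)⁻¹ := (norm_sum_mul_le _ _).trans hy
      have h3 : ‖eval y h - eval a h - ∑ j, eval a (pderiv j h) * (y - a) j‖ ≤ (p : ℝ)⁻¹ :=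
        h1.trans ((mul_le_of_le_one_left (norm_nonneg _) inv_prime_lt_one.le).trans hy)
      have := norm_add_le_of_le h3 h2
      rwa [sub_add_cancel] at this

theorem norm_mulVec_le (M : Matrix (Fin n) (Fin n) ℤ_[p]) (x : Fin n → ℤ_[p]) :
    ‖M *ᵥ x‖ ≤ ‖x‖ :=
  (pi_norm_le_iff_of_nonneg (norm_nonneg _)).2 fun i => norm_sum_mul_le (M i) x

/-- Both `M` and its inverse have integral entries, so neither increases norms. -/
theorem norm_mulVec_eq {M : Matrix (Fin n) (Fin n) ℤ_[p]} (hM : IsUnit M.det)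
    (x : Fin n → ℤ_[p]) : ‖M *ᵥ x‖ = ‖x‖ := by
  refine (norm_mulVec_le M x).antisymm ?_
  have := norm_mulVec_le M⁻¹ (M *ᵥ x)
  rwa [Matrix.mulVec_mulVec, Matrix.nonsing_inv_mul _ hM, Matrix.one_mulVec] at this

/-- The polynomial mapping with components `H i`. -/
def evalMap {ι : Type*} (H : ι → MvPolynomial (Fin n) ℤ_[p]) (x : Fin n → ℤ_[p]) : ι → ℤ_[p] :=
  fun i => eval x (H i)

/-- The Jacobian matrix over `ℤ_p`. -/
def jacobianInt (H : Fin n → MvPolynomial (Fin n) ℤ_[p]) (a : Fin n → ℤ_[p]) :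
    Matrix (Fin n) (Fin n) ℤ_[p] :=
  Matrix.of fun i j => eval a (pderiv j (H i))

variable {H : Fin n → MvPolynomial (Fin n) ℤ_[p]} {a : Fin n → ℤ_[p]}

theorem norm_evalMap_sub_le {x y : Fin n → ℤ_[p]}
    (hx : ‖x - a‖ ≤ (p : ℝ)⁻¹) (hy : ‖y - a‖ ≤ (p : ℝ)⁻¹) :
    ‖evalMap H x - evalMap H y - jacobianInt H a *ᵥ (x - y)‖ ≤ (p : ℝ)⁻¹ * ‖x - y‖ := by
  have hp := inv_prime_pos (p := p)
  exact (pi_norm_le_iff_of_nonneg (by positivity)).2 fun i => norm_eval_sub_le (H i) hx hy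

/-- The linear part preserves norms and the remainder is strictly smaller, so by the ultrametric
inequality the mapping is an isometry on the residue ball. -/
theorem norm_evalMap_sub (hdet : IsUnit (jacobianInt H a).det) {x y : Fin n → ℤ_[p]}
    (hx : ‖x - a‖ ≤ (p : ℝ)⁻¹) (hy : ‖y - a‖ ≤ (p : ℝ)⁻¹) :
    ‖evalMap H x - evalMap H y‖ = ‖x - y‖ := by
  rcases eq_or_ne x y with rfl | hxy
  · simp
  have h0 : 0 < ‖x - y‖ := norm_pos_iff.2 (sub_ne_zero.2 hxy)
  have h1 := norm_evalMap_sub_le (H := H) hx hy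
  have h2 := norm_mulVec_eq hdet (x - y)
  have h3 : (p : ℝ)⁻¹ * ‖x - y‖ < ‖x - y‖ := mul_lt_of_lt_one_left h0 inv_prime_lt_one
  have h4 := IsUltrametricDist.norm_add_eq_max_of_norm_ne_norm
    (x := evalMap H x - evalMap H y - jacobianInt H a *ᵥ (x - y))
    (y := jacobianInt H a *ᵥ (x - y)) (by rw [h2]; exact (h1.trans_lt h3).ne)
  rw [sub_add_cancel, h2, max_eq_right (h1.trans h3.le)] at h4
  exact h4

/-- Hensel's lemma in several variables. -/
theorem exists_evalMap_eq (hdet : IsUnit (jacobianInt H a).det) {y : Fin n → ℤ_[p]}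
    (hy : ‖y - evalMap H a‖ ≤ (p : ℝ)⁻¹) : ∃ x, ‖x - a‖ ≤ (p : ℝ)⁻¹ ∧ evalMap H x = y := by
  set M := jacobianInt H a
  let s : Set (Fin n → ℤ_[p]) := Metric.closedBall a (p : ℝ)⁻¹
  -- Newton's iteration with the derivative frozen at the centre; it contracts the residue ball by
  -- the factor `p⁻¹`.
  let T : (Fin n → ℤ_[p]) → Fin n → ℤ_[p] := fun x => x - M⁻¹ *ᵥ (evalMap H x - y)
  have hp := inv_prime_pos (p := p)
  have haa : ‖a - a‖ ≤ (p : ℝ)⁻¹ := by simp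
  have hT : Set.MapsTo T s s := by
    intro x hx
    rw [mem_closedBall_iff_norm] at hx ⊢
    have : T x - a = (x - a) - M⁻¹ *ᵥ (evalMap H x - y) := by simp only [T]; abel
    rw [this]
    refine norm_sub_le_of_le hx ((norm_mulVec_le _ _).trans ?_)
    have h1 : ‖evalMap H x - evalMap H a‖ ≤ (p : ℝ)⁻¹ := by
      rwa [norm_evalMap_sub hdet hx haa]
    have := norm_sub_le_of_le h1 hy
    rwa [sub_sub_sub_cancel_right] at this
  have hc : ContractingWith (⟨(p : ℝ)⁻¹, hp.le⟩ : NNReal) (hT.restrict T s s) := by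
    refine ⟨inv_prime_lt_one, LipschitzWith.of_dist_le_mul fun x x' => ?_⟩
    have hx := mem_closedBall_iff_norm.1 x.2
    have hx' := mem_closedBall_iff_norm.1 x'.2
    rw [Subtype.dist_eq, Subtype.dist_eq, dist_eq_norm, dist_eq_norm]
    have : T x.1 - T x'.1 =
        -(M⁻¹ *ᵥ (evalMap H x.1 - evalMap H x'.1 - M *ᵥ (x.1 - x'.1))) := by
      simp only [T, Matrix.mulVec_sub, Matrix.mulVec_mulVec, Matrix.nonsing_inv_mul _ hdet,
        Matrix.one_mulVec]
      abel
    show ‖T x.1 - T x'.1‖ ≤ (p : ℝ)⁻¹ * ‖x.1 - x'.1‖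
    rw [this, norm_neg]
    exact (norm_mulVec_le _ _).trans (norm_evalMap_sub_le hx hx')
  obtain ⟨x, hxs, hx, -⟩ := hc.exists_fixedPoint' Metric.isClosed_closedBall.isComplete hT
    (Metric.mem_closedBall_self hp.le) (edist_ne_top _ _)
  refine ⟨x, mem_closedBall_iff_norm.1 hxs, ?_⟩
  have h1 : M⁻¹ *ᵥ (evalMap H x - y) = 0 := by
    have : x - M⁻¹ *ᵥ (evalMap H x - y) = x := hx
    simpa using this
  have h2 : M *ᵥ (M⁻¹ *ᵥ (evalMap H x - y)) = 0 := by rw [h1, Matrix.mulVec_zero]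
  rw [Matrix.mulVec_mulVec, Matrix.mul_nonsing_inv _ hdet, Matrix.one_mulVec] at h2
  exact sub_eq_zero.1 h2

theorem continuous_evalMap {ι : Type*} (H : ι → MvPolynomial (Fin n) ℤ_[p]) :
    Continuous (evalMap H) :=
  continuous_pi fun i => MvPolynomial.continuous_eval (H i)

/-- Used for gradients modulo `p`: the independent rows become the rows of an invertible matrix at
the positions `e i`, which are the coordinates that will replace the polynomials. -/
theorem exists_completion {K : Type*} [Field K] {ι : Type} [Fintype ι] {v : ι → Fin n → K}
    (hv : LinearIndependent K v) : ∃ e : ι → Fin n, Function.Injective e ∧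
      ∃ M : Matrix (Fin n) (Fin n) K, IsUnit M.det ∧ ∀ i, M (e i) = v i := by
  let B := Module.Basis.sumExtend hv
  let σ := B.indexEquiv (Pi.basisFun K (Fin n))
  refine ⟨fun i => σ (Sum.inl i), fun i j h => Sum.inl_injective (σ.injective h),
    Matrix.of fun k => B (σ.symm k), ?_, fun i => ?_⟩
  · rw [← Matrix.isUnit_iff_isUnit_det, ← Matrix.linearIndependent_rows_iff_isUnit]
    exact B.linearIndependent.comp σ.symm σ.symm.injective
  · ext j
    simp only [Matrix.of_apply, Equiv.symm_apply_apply, B, Module.Basis.sumExtend,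
      Module.Basis.reindex_apply, Module.Basis.extend_apply_self]
    rfl

theorem toZMod_eval (h : MvPolynomial (Fin n) ℤ_[p]) (a : Fin n → ℤ_[p]) :
    PadicInt.toZMod (eval a h) = eval (fun i => PadicInt.toZMod (a i)) (map PadicInt.toZMod h) := by
  rw [eval_map, eval₂_comp]
  rfl

variable [MeasurableSpace ℤ_[p]] [BorelSpace ℤ_[p]] {ν : Measure (Fin n → ℤ_[p])}
  [ν.IsAddHaarMeasure] [IsProbabilityMeasure ν]

/-- Change of variables on a residue ball on which some polynomials have independent differentials
modulo `p`: they may be replaced by distinct coordinates. -/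
theorem exists_setIntegral_comp_evalMap {ι : Type} [Fintype ι]
    (h : ι → MvPolynomial (Fin n) ℤ_[p]) (a : Fin n → ℤ_[p])
    (h0 : ∀ i, PadicInt.toZMod (eval a (h i)) = 0)
    (hli : LinearIndependent (ZMod p) (jacobian (fun i => map PadicInt.toZMod (h i))
      (fun i => PadicInt.toZMod (a i))).row) :
    ∃ e : ι → Fin n, Function.Injective e ∧ ∀ φ : (ι → ℤ_[p]) → ℂ, Measurable φ →
      ∫ x in Metric.closedBall a (p : ℝ)⁻¹, φ (evalMap h x) ∂ν =
        ∫ y in Metric.closedBall 0 (p : ℝ)⁻¹, φ (fun i => y (e i)) ∂ν := by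
  obtain ⟨e, he, M, hM, hMe⟩ := exists_completion hli
  refine ⟨e, he, fun φ hφ => ?_⟩
  choose m hm using fun i j => ZMod.ringHom_surjective (PadicInt.toZMod (p := p)) (M i j)
  -- The missing components are affine forms vanishing at `a`, with coefficients lifting the added
  -- rows, so the Jacobian of `H` at `a` reduces to `M`.
  let H : Fin n → MvPolynomial (Fin n) ℤ_[p] := fun k =>
    if hk : ∃ i, e i = k then h hk.choose else ∑ j, C (m k j) * (X j - C (a j))
  have hHe : ∀ i, H (e i) = h i := fun i => by
    have hk : ∃ i', e i' = e i := ⟨i, rfl⟩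
    simp only [H, dif_pos hk]
    rw [he hk.choose_spec]
  have hH0 : ∀ k, PadicInt.toZMod (evalMap H a k) = 0 := fun k => by
    by_cases hk : ∃ i, e i = k
    · obtain ⟨i, rfl⟩ := hk
      rw [evalMap, hHe, h0]
    · simp [evalMap, H, dif_neg hk]
  have hjac : (jacobianInt H a).map PadicInt.toZMod = M := by
    ext k j
    by_cases hk : ∃ i, e i = k
    · obtain ⟨i, rfl⟩ := hk
      simp only [jacobianInt, Matrix.map_apply, Matrix.of_apply, hHe, hMe]
      rw [toZMod_eval, ← pderiv_map]
      rfl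
    · simp only [jacobianInt, Matrix.map_apply, Matrix.of_apply, H, dif_neg hk]
      simp [pderiv_X, Pi.single_apply, hm]
  have hdet : IsUnit (jacobianInt H a).det := by
    rw [isUnit_iff_toZMod, RingHom.map_det, RingHom.mapMatrix_apply, hjac]
    exact hM.ne_zero
  -- The value `H(a)` reduces to zero, and every point of an ultrametric ball is a centre.
  have hball : Metric.closedBall (evalMap H a) (p : ℝ)⁻¹ = Metric.closedBall 0 (p : ℝ)⁻¹ := by
    refine IsUltrametricDist.closedBall_eq_of_mem ?_
    rw [mem_closedBall_iff_norm, zero_sub, norm_neg, pi_norm_le_iff_of_nonneg inv_prime_pos.le]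
    exact fun k => toZMod_eq_zero_iff.1 (hH0 k)
  have haa : ‖a - a‖ ≤ (p : ℝ)⁻¹ := by simp
  have hmap := map_restrict_closedBall (ν := ν) (H := evalMap H) (a := a) (b := evalMap H a)
    (continuous_evalMap H).measurable inv_prime_pos
    (fun x hx y hy => norm_evalMap_sub hdet (mem_closedBall_iff_norm.1 hx)
      (mem_closedBall_iff_norm.1 hy))
    (fun x hx => by
      rw [mem_closedBall_iff_norm] at hx ⊢
      rwa [norm_evalMap_sub hdet hx haa])
    (fun y hy => by
      obtain ⟨x, hx, hxy⟩ := exists_evalMap_eq hdet (mem_closedBall_iff_norm.1 hy)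
      exact ⟨x, mem_closedBall_iff_norm.2 hx, hxy⟩)
  rw [hball] at hmap
  have hφ' : Measurable fun y : Fin n → ℤ_[p] => φ (fun i => y (e i)) :=
    hφ.comp (measurable_pi_lambda _ fun i => measurable_pi_apply _)
  rw [← hmap, integral_map (continuous_evalMap H).measurable.aemeasurable
    hφ'.aestronglyMeasurable]
  refine integral_congr_ae (Filter.Eventually.of_forall fun x => ?_)
  simp only [evalMap, hHe]
  rfl

end Hensel

/-! ### Integrals of norms of coordinates, by self-similarity -/

section ScalingIntegrals
variable {n t p : ℕ} [Fact p.Prime]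

theorem mem_range_scale {k : Fin n → ℕ} {x : Fin n → ℤ_[p]} :
    x ∈ Set.range (scale k) ↔ ∀ i, ‖x i‖ ≤ (p : ℝ) ^ (-(k i : ℤ)) := by
  have h : ∀ i, ‖x i‖ ≤ (p : ℝ) ^ (-(k i : ℤ)) ↔ ∃ y, (p : ℤ_[p]) ^ k i * y = x i := fun i => by
    rw [PadicInt.norm_le_pow_iff_mem_span_pow, Ideal.mem_span_singleton, dvd_def]
    simp only [eq_comm]
  simp only [h, Set.mem_range, funext_iff, scale_apply]
  exact ⟨fun ⟨y, hy⟩ i => ⟨y i, hy i⟩, fun h => Classical.skolem.1 h⟩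

theorem closedBall_eq_range_scale :
    Metric.closedBall (0 : Fin n → ℤ_[p]) (p : ℝ)⁻¹ = Set.range (scale fun _ => 1) := by
  ext x
  rw [mem_range_scale, mem_closedBall_zero_iff, pi_norm_le_iff_of_nonneg inv_prime_pos.le]
  simp

theorem norm_eq_one_of_not_le {x : ℤ_[p]} (h : ¬ ‖x‖ ≤ (p : ℝ)⁻¹) : ‖x‖ = 1 := by
  rw [← PadicInt.isUnit_iff, isUnit_iff_toZMod]
  exact fun h' => h (toZMod_eq_zero_iff.1 h')

theorem pi_norm_eq_one_of_not_le {ι : Type*} [Fintype ι] {x : ι → ℤ_[p]}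
    (h : ¬ ‖x‖ ≤ (p : ℝ)⁻¹) : ‖x‖ = 1 := by
  refine le_antisymm ((pi_norm_le_iff_of_nonneg zero_le_one).2 fun _ => PadicInt.norm_le_one _) ?_
  rw [pi_norm_le_iff_of_nonneg inv_prime_pos.le, not_forall] at h
  obtain ⟨i, hi⟩ := h
  rw [← norm_eq_one_of_not_le hi]
  exact norm_le_pi_norm x i

theorem pi_norm_le_one {ι : Type*} [Fintype ι] (x : ι → ℤ_[p]) : ‖x‖ ≤ 1 :=
  (pi_norm_le_iff_of_nonneg zero_le_one).2 fun _ => PadicInt.norm_le_one _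

theorem inv_prime_mul_cpow {r : ℝ} (hr : 0 ≤ r) (s : ℂ) :
    (((p : ℝ)⁻¹ * r : ℝ) : ℂ) ^ s = ((p : ℂ) ^ s)⁻¹ * (r : ℂ) ^ s := by
  rw [Complex.ofReal_mul, Complex.mul_cpow_ofReal_nonneg inv_prime_pos.le hr]
  congr 1
  push_cast
  rw [Complex.inv_cpow]
  rw [Complex.natCast_arg]
  exact Real.pi_ne_zero.symm

theorem norm_cpow_le_one {r : ℝ} (h0 : 0 ≤ r) (h1 : r ≤ 1) {s : ℂ} (hs : 0 < s.re) :
    ‖((r : ℝ) : ℂ) ^ s‖ ≤ 1 := by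
  rw [Complex.norm_cpow_eq_rpow_re_of_nonneg h0 hs.ne']
  exact Real.rpow_le_one h0 h1 hs.le

theorem prime_cpow_add_sub_one_ne_zero {s : ℂ} (hs : 0 ≤ s.re) (ht : 0 < t) :
    (p : ℂ) ^ (s + (t : ℂ)) - 1 ≠ 0 := by
  intro h
  have h1 := norm_prime_cpow (p := p) (s + (t : ℂ))
  rw [sub_eq_zero.1 h, norm_one] at h1
  have h2 : 0 < (s + (t : ℂ)).re := by
    simp only [Complex.add_re, Complex.natCast_re]
    have : (0 : ℝ) < t := by exact_mod_cast ht
    linarith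
  exact (Real.one_lt_rpow one_lt_prime_real h2).ne h1

/-- The exponents of the scaling of the coordinates in the range of `e`. -/
def indicatorExp {ι : Type*} (e : ι → Fin n) : Fin n → ℕ := fun i => if i ∈ Set.range e then 1 else 0

theorem sum_indicatorExp {e : Fin t → Fin n} (he : Function.Injective e) :
    ∑ i, indicatorExp e i = t := by
  rw [← Finset.sum_subset (Finset.subset_univ (Finset.univ.image e)) fun i _ hi => ?_]
  · rw [Finset.sum_image fun i _ j _ h => he h]
    simp [indicatorExp]
  · have : i ∉ Set.range e := by simpa using hi
    simp [indicatorExp, this]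

theorem norm_prime_smul_comp {ι : Type*} [Fintype ι] {k : Fin n → ℕ} {e : ι → Fin n}
    (hk : ∀ i, k (e i) = 1) (x : Fin n → ℤ_[p]) :
    ‖fun i => scale k x (e i)‖ = (p : ℝ)⁻¹ * ‖fun i => x (e i)‖ := by
  have : (fun i => scale k x (e i)) = (p : ℤ_[p]) • fun i => x (e i) := by
    ext i
    simp [hk]
  rw [this, norm_smul, PadicInt.norm_p]

theorem prime_add_one_identity : ((p : ℂ) - 1) / ((p : ℂ) ^ (1 + 1 : ℂ) - 1) = 1 / ((p : ℂ) + 1) := by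
  have h1 : (1 + 1 : ℂ) = ((2 : ℕ) : ℂ) := by norm_num
  rw [h1, Complex.cpow_natCast]
  have h2 : (p : ℂ) + 1 ≠ 0 := by exact_mod_cast Nat.succ_ne_zero p
  have h3 : (p : ℂ) - 1 ≠ 0 := sub_ne_zero.2 (by exact_mod_cast (Fact.out : p.Prime).ne_one)
  have h4 : (p : ℂ) ^ 2 - 1 = ((p : ℂ) - 1) * ((p : ℂ) + 1) := by ring
  rw [h4]
  field_simp

variable [MeasurableSpace ℤ_[p]] [BorelSpace ℤ_[p]] {ν : Measure (Fin n → ℤ_[p])}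
  [ν.IsAddHaarMeasure] [IsProbabilityMeasure ν]

theorem measurable_norm_comp_cpow (e : Fin t → Fin n) (s : ℂ) :
    Measurable fun x : Fin n → ℤ_[p] => ((‖fun i => x (e i)‖ : ℝ) : ℂ) ^ s := by
  refine Measurable.pow_const ?_ s
  refine Complex.measurable_ofReal.comp (Continuous.measurable ?_)
  exact continuous_norm.comp (continuous_pi fun i => continuous_apply (e i))

/-- Let `I` be the integral and `Ψ` that of `ψ`. Where some `x (e i)` is a unit, the norm is one;
the complement is the image of the scaling by `p` in these `t` coordinates, under which `ψ` is
invariant. This gives `I = p^{-s-t} I + (1 - p^{-t}) Ψ`, which is solved for `I`. -/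
theorem integral_norm_cpow_mul (ht : 0 < t) {e : Fin t → Fin n} (he : Function.Injective e)
    {ψ : (Fin n → ℤ_[p]) → ℂ} (hψ : Measurable ψ) (hψ1 : ∀ x, ‖ψ x‖ ≤ 1)
    (hψs : ∀ x, ψ (scale (indicatorExp e) x) = ψ x) {s : ℂ} (hs : 0 < s.re) :
    ∫ x, ((‖fun i => x (e i)‖ : ℝ) : ℂ) ^ s * ψ x ∂ν =
      (p : ℂ) ^ s * (((p : ℂ) ^ t - 1) / ((p : ℂ) ^ (s + (t : ℂ)) - 1)) * ∫ x, ψ x ∂ν := by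
  set k := indicatorExp e with hk
  have hke : ∀ i, k (e i) = 1 := fun i => by simp [hk, indicatorExp]
  set f : (Fin n → ℤ_[p]) → ℂ := fun x => ((‖fun i => x (e i)‖ : ℝ) : ℂ) ^ s * ψ x with hf
  have hfm : Measurable f := (measurable_norm_comp_cpow e s).mul hψ
  have hf1 : ∀ x, ‖f x‖ ≤ 1 := fun x => by
    rw [norm_mul]
    exact mul_le_one₀ (norm_cpow_le_one (norm_nonneg _) (pi_norm_le_one _) hs) (norm_nonneg _)
      (hψ1 x)
  have hfi : Integrable f ν := integrable_of_bound hfm hf1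
  have hψi : Integrable ψ ν := integrable_of_bound hψ hψ1
  have hR : MeasurableSet (Set.range (scale (p := p) k)) :=
    (measurableEmbedding_scale k).measurableSet_range
  have h1 := integral_add_compl hR hfi
  have h2 := integral_add_compl hR hψi
  have h3 : ∫ x in (Set.range (scale (p := p) k))ᶜ, f x ∂ν =
      ∫ x in (Set.range (scale (p := p) k))ᶜ, ψ x ∂ν := by
    refine setIntegral_congr_fun hR.compl fun x hx => ?_
    have : ‖fun i => x (e i)‖ = 1 := by
      refine pi_norm_eq_one_of_not_le fun h => hx (mem_range_scale.2 fun i => ?_)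
      by_cases hi : i ∈ Set.range e
      · obtain ⟨j, rfl⟩ := hi
        rw [hke, Nat.cast_one, zpow_neg_one]
        exact (norm_le_pi_norm (fun i => x (e i)) j).trans h
      · simpa [hk, indicatorExp, hi] using PadicInt.norm_le_one (x i)
    simp [hf, this]
  rw [h3] at h1
  rw [setIntegral_range_scale, sum_indicatorExp he] at h1 h2
  have h4 : ∀ x, f (scale k x) = ((p : ℂ) ^ s)⁻¹ * f x := fun x => by
    simp only [hf]
    rw [norm_prime_smul_comp hke, inv_prime_mul_cpow (norm_nonneg _), hψs, mul_assoc]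
  simp only [h4, hψs] at h1 h2
  rw [integral_const_mul] at h1
  set I := ∫ x, f x ∂ν
  set Ψ := ∫ x, ψ x ∂ν
  set J := ∫ x in (Set.range (scale (p := p) k))ᶜ, ψ x ∂ν
  have h5 := prime_cpow_add_sub_one_ne_zero (p := p) (s := s) hs.le ht
  have h6 := prime_cpow_ne_zero (p := p) s
  have h7 : (p : ℂ) ^ t ≠ 0 := pow_ne_zero _ prime_complex_ne_zero
  rw [Complex.cpow_add _ _ prime_complex_ne_zero, Complex.cpow_natCast] at h5 ⊢
  have h8 : J = Ψ - ((p : ℂ) ^ t)⁻¹ * Ψ := by linear_combination h2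
  rw [h8] at h1
  rw [mul_div_assoc', div_mul_eq_mul_div, eq_div_iff h5]
  field_simp at h1
  linear_combination -h1

/-- Scaling all coordinates by `p` reduces the residue ball to the full space. The factor `p^{-s}`
so produced cancels the `p^s` of `integral_norm_cpow_mul`. -/
theorem setIntegral_norm_cpow_mul (ht : 0 < t) {e : Fin t → Fin n} (he : Function.Injective e)
    {ψ : (Fin n → ℤ_[p]) → ℂ} (hψ : Measurable ψ) (hψ1 : ∀ x, ‖ψ x‖ ≤ 1)
    (hψs : ∀ x, ψ (scale (indicatorExp e) x) = ψ x) {c : ℂ}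
    (hψc : ∀ x, ψ (scale (fun _ => 1) x) = c * ψ x) {s : ℂ} (hs : 0 < s.re) :
    ∫ x in Metric.closedBall 0 (p : ℝ)⁻¹, ((‖fun i => x (e i)‖ : ℝ) : ℂ) ^ s * ψ x ∂ν =
      ((p : ℂ) ^ n)⁻¹ * (((p : ℂ) ^ t - 1) / ((p : ℂ) ^ (s + (t : ℂ)) - 1)) *
        (c * ∫ x, ψ x ∂ν) := by
  rw [closedBall_eq_range_scale, setIntegral_range_scale]
  have : ∀ x : Fin n → ℤ_[p], ((‖fun i => scale (fun _ => 1) x (e i)‖ : ℝ) : ℂ) ^ s *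
      ψ (scale (fun _ => 1) x) =
        (((p : ℂ) ^ s)⁻¹ * c) * (((‖fun i => x (e i)‖ : ℝ) : ℂ) ^ s * ψ x) := fun x => by
    rw [norm_prime_smul_comp (fun _ => rfl), inv_prime_mul_cpow (norm_nonneg _), hψc]
    ring
  simp only [this]
  rw [integral_const_mul, integral_norm_cpow_mul ht he hψ hψ1 hψs hs]
  have h6 := prime_cpow_ne_zero (p := p) s
  simp only [Finset.sum_const, Finset.card_univ, Fintype.card_fin, smul_eq_mul, mul_one]
  field_simp

theorem setIntegral_norm_cpow (ht : 0 < t) {e : Fin t → Fin n} (he : Function.Injective e)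
    {s : ℂ} (hs : 0 < s.re) :
    ∫ x in Metric.closedBall 0 (p : ℝ)⁻¹, ((‖fun i => x (e i)‖ : ℝ) : ℂ) ^ s ∂ν =
      ((p : ℂ) ^ n)⁻¹ * (((p : ℂ) ^ t - 1) / ((p : ℂ) ^ (s + (t : ℂ)) - 1)) := by
  simpa using setIntegral_norm_cpow_mul (ν := ν) ht he (ψ := fun _ => 1) measurable_const
    (by simp) (fun _ => rfl) (c := 1) (by simp) hs

theorem setIntegral_norm_apply (j : Fin n) :
    ∫ x in Metric.closedBall 0 (p : ℝ)⁻¹, ((‖x j‖ : ℝ) : ℂ) ∂ν =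
      ((p : ℂ) ^ n)⁻¹ * (1 / ((p : ℂ) + 1)) := by
  have := setIntegral_norm_cpow (ν := ν) (t := 1) one_pos (e := fun _ => j)
    (Function.injective_of_subsingleton _) (s := 1) (by simp)
  simp only [Complex.cpow_one, pow_one, Nat.cast_one, pi_norm_const] at this
  rw [this, prime_add_one_identity]

theorem integral_norm_apply (j : Fin n) :
    ∫ x : Fin n → ℤ_[p], ((‖x j‖ : ℝ) : ℂ) ∂ν = (p : ℂ) / ((p : ℂ) + 1) := by
  have := integral_norm_cpow_mul (ν := ν) (t := 1) one_pos (e := fun _ => j)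
    (Function.injective_of_subsingleton _) (ψ := fun _ => 1) measurable_const
    (by simp) (fun _ => rfl) (s := 1) (by simp)
  simp only [Complex.cpow_one, pow_one, Nat.cast_one, pi_norm_const, mul_one, integral_const,
    probReal_univ, one_smul] at this
  rw [this, prime_add_one_identity]
  ring

/-- Take `ψ` to be the norm of the extra coordinate: by injectivity of `e` it is unaffected by
scaling the other `t`, and it is multiplied by `c = p⁻¹` when all coordinates are scaled. -/
theorem setIntegral_norm_cpow_mul_norm (ht : 0 < t) {e : Fin t ⊕ Unit → Fin n}
    (he : Function.Injective e) {s : ℂ} (hs : 0 < s.re) :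
    ∫ x in Metric.closedBall 0 (p : ℝ)⁻¹, ((‖fun i => x (e (.inl i))‖ : ℝ) : ℂ) ^ s *
      ((‖x (e (.inr ()))‖ : ℝ) : ℂ) ∂ν =
      ((p : ℂ) ^ n)⁻¹ * (((p : ℂ) ^ t - 1) / ((p : ℂ) ^ (s + (t : ℂ)) - 1)) *
        (1 / ((p : ℂ) + 1)) := by
  rw [setIntegral_norm_cpow_mul (ν := ν) (e := fun i => e (.inl i)) ht
    (he.comp Sum.inl_injective) (ψ := fun x => ((‖x (e (.inr ()))‖ : ℝ) : ℂ))
    (Complex.measurable_ofReal.comp (continuous_norm.comp (continuous_apply _)).measurable)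
    (fun x => ?_) (fun x => ?_) (c := (p : ℂ)⁻¹) (fun x => ?_) hs, integral_norm_apply]
  · have h2 : (p : ℂ) + 1 ≠ 0 := by exact_mod_cast Nat.succ_ne_zero p
    have h3 := prime_complex_ne_zero (p := p)
    field_simp
  · simpa using PadicInt.norm_le_one (x (e (.inr ())))
  · have : e (.inr ()) ∉ Set.range fun i => e (.inl i) := by
      rintro ⟨i, hi⟩
      exact absurd (he hi) (by simp)
    simp [indicatorExp, this]
  · simp

end ScalingIntegrals

/-! ### Integrals over residue classes -/

section LocalIntegrals
variable {n t p : ℕ} [Fact p.Prime]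

theorem linearIndependent_of_rank {K : Type*} [Field K] {ι : Type} [Fintype ι]
    {M : Matrix ι (Fin n) K} (h : M.rank = Fintype.card ι) : LinearIndependent K M.row := by
  rw [linearIndependent_iff_card_eq_finrank_span, Set.finrank, ← Matrix.rank_eq_finrank_span_row, h]

/-- The reduction of a point modulo `p`. -/
def reducePoint (x : Fin n → ℤ_[p]) : Fin n → ZMod p := fun i => PadicInt.toZMod (x i)

theorem reducePoint_eq_iff {x a : Fin n → ℤ_[p]} :
    reducePoint x = reducePoint a ↔ x ∈ Metric.closedBall a (p : ℝ)⁻¹ := by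
  rw [mem_closedBall_iff_norm, pi_norm_le_iff_of_nonneg inv_prime_pos.le, funext_iff]
  refine forall_congr' fun i => ?_
  rw [Pi.sub_apply, ← toZMod_eq_zero_iff, map_sub, sub_eq_zero]
  rfl

theorem eval_reduce (h : MvPolynomial (Fin n) ℤ_[p]) (x : Fin n → ℤ_[p]) :
    eval (reducePoint x) (map PadicInt.toZMod h) = PadicInt.toZMod (eval x h) :=
  (toZMod_eval h x).symm

/-- The integrand `‖f‖^s |g|` on `ℤ_pⁿ`. -/
def intIntegrand (f : Fin t → MvPolynomial (Fin n) ℤ_[p]) (g : MvPolynomial (Fin n) ℤ_[p])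
    (s : ℂ) (x : Fin n → ℤ_[p]) : ℂ :=
  ((‖evalMap f x‖ : ℝ) : ℂ) ^ s * ((‖eval x g‖ : ℝ) : ℂ)

theorem norm_intIntegrand_le (f : Fin t → MvPolynomial (Fin n) ℤ_[p])
    (g : MvPolynomial (Fin n) ℤ_[p]) {s : ℂ} (hs : 0 < s.re) (x : Fin n → ℤ_[p]) :
    ‖intIntegrand f g s x‖ ≤ 1 := by
  rw [intIntegrand, norm_mul]
  refine mul_le_one₀ (norm_cpow_le_one (norm_nonneg _) (pi_norm_le_one _) hs) (norm_nonneg _) ?_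
  simpa using PadicInt.norm_le_one _

/-- The factor of the local integral at a point where `f` reduces to zero. -/
def mapFactor (p t : ℕ) (s : ℂ) : ℂ := ((p : ℂ) ^ t - 1) / ((p : ℂ) ^ (s + (t : ℂ)) - 1)

/-- The points of `ℤ_pⁿ` with invertible coordinates. -/
def unitTorus (p n : ℕ) [Fact p.Prime] : Set (Fin n → ℤ_[p]) := {x | ∀ i, ‖x i‖ = 1}

/-- A lift of a point of the torus over `𝔽_p`. -/
def liftPoint (a : Fin n → (ZMod p)ˣ) : Fin n → ℤ_[p] := fun i => ((a i : ZMod p).val : ℤ_[p])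

theorem reducePoint_liftPoint (a : Fin n → (ZMod p)ˣ) : reducePoint (liftPoint a) = torusPoint a := by
  ext i
  simp [reducePoint, liftPoint, torusPoint]

theorem norm_eq_one_iff_toZMod {x : ℤ_[p]} : ‖x‖ = 1 ↔ PadicInt.toZMod x ≠ 0 := by
  rw [← PadicInt.isUnit_iff, isUnit_iff_toZMod]

theorem unitTorus_eq_iUnion :
    unitTorus p n = ⋃ a : Fin n → (ZMod p)ˣ, Metric.closedBall (liftPoint a) (p : ℝ)⁻¹ := by
  ext x
  simp only [unitTorus, Set.mem_ofPred_eq, Set.mem_iUnion, ← reducePoint_eq_iff,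
    reducePoint_liftPoint, norm_eq_one_iff_toZMod]
  constructor
  · intro h
    exact ⟨fun i => Units.mk0 _ (h i), by ext i; rfl⟩
  · rintro ⟨a, ha⟩ i
    have := congrFun ha i
    simp only [reducePoint, torusPoint] at this
    rw [this]
    exact (a i).ne_zero

theorem pairwise_disjoint_liftPoint : Pairwise (Function.onFun Disjoint
    fun a : Fin n → (ZMod p)ˣ => Metric.closedBall (liftPoint a) (p : ℝ)⁻¹) := by
  intro a b hab
  refine Set.disjoint_left.2 fun x hx hx' => hab ?_
  rw [← reducePoint_eq_iff, reducePoint_liftPoint] at hx hx'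
  ext i
  exact congrFun (hx.symm.trans hx') i

/-- Every point of the torus counts one, corrected by the deficit of its weight; the points where
neither condition holds have none. -/
theorem sum_weights (F' G' : (Fin n → (ZMod p)ˣ) → Prop) [DecidablePred F'] [DecidablePred G']
    (α β : ℂ) :
    ∑ a, (if F' a then α else 1) * (if G' a then β else 1) =
      ((p : ℂ) - 1) ^ n - (Set.ncard {a | F' a ∧ ¬ G' a} : ℂ) * (1 - α) -
        (Set.ncard {a | ¬ F' a ∧ G' a} : ℂ) * (1 - β) -
        (Set.ncard {a | F' a ∧ G' a} : ℂ) * (1 - α * β) := by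
  have hcard : ∀ Q : (Fin n → (ZMod p)ˣ) → Prop, (Set.ncard {a | Q a} : ℂ) =
      ∑ a, if Q a then (1 : ℂ) else 0 := fun Q => by
    rw [Finset.sum_boole, Set.ncard_eq_toFinset_card']
    congr 2
    ext a
    simp
  have htot : ((p : ℂ) - 1) ^ n = ∑ _ : Fin n → (ZMod p)ˣ, (1 : ℂ) := by
    rw [Finset.sum_const, Finset.card_univ, Fintype.card_fun, ZMod.card_units, Fintype.card_fin]
    simp [Nat.cast_sub (Fact.out : p.Prime).one_lt.le]
  rw [hcard, hcard, hcard, htot, Finset.sum_mul, Finset.sum_mul, Finset.sum_mul,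
    ← Finset.sum_sub_distrib, ← Finset.sum_sub_distrib, ← Finset.sum_sub_distrib]
  refine Finset.sum_congr rfl fun a _ => ?_
  by_cases h1 : F' a <;> by_cases h2 : G' a <;> simp [h1, h2]

variable [MeasurableSpace ℤ_[p]] [BorelSpace ℤ_[p]] {ν : Measure (Fin n → ℤ_[p])}

theorem measurable_intIntegrand (f : Fin t → MvPolynomial (Fin n) ℤ_[p])
    (g : MvPolynomial (Fin n) ℤ_[p]) (s : ℂ) : Measurable (intIntegrand f g s) := by
  refine Measurable.mul (Measurable.pow_const (Complex.measurable_ofReal.comp ?_) s)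
    (Complex.measurable_ofReal.comp ?_)
  · exact (continuous_evalMap f).norm.measurable
  · exact (MvPolynomial.continuous_eval g).norm.measurable

variable [ν.IsAddHaarMeasure] [IsProbabilityMeasure ν]

theorem setIntegral_closedBall_const (a : Fin n → ℤ_[p]) (c : ℂ) :
    ∫ _ in Metric.closedBall a (p : ℝ)⁻¹, c ∂ν = ((p : ℂ) ^ n)⁻¹ * c := by
  have h := setIntegral_range_scale (ν := ν) (fun _ => 1) (fun _ => c)
  rw [← closedBall_eq_range_scale] at h
  simp only [integral_const, smul_eq_mul, probReal_univ, one_smul, Finset.sum_const,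
    Finset.card_univ, Fintype.card_fin, mul_one] at h ⊢
  rw [← h, Measure.real, Measure.real, Measure.restrict_apply_univ, Measure.restrict_apply_univ,
    measure_closedBall_eq a 0]

/-- A factor that does not vanish modulo `p` at `a` has norm one on the whole class. For the others,
each of the three vanishing patterns uses its own rank hypothesis to pass to coordinates. -/
theorem setIntegral_intIntegrand (ht : 0 < t) (f : Fin t → MvPolynomial (Fin n) ℤ_[p])
    (g : MvPolynomial (Fin n) ℤ_[p]) (a : Fin n → ℤ_[p]) {s : ℂ} (hs : 0 < s.re)
    (hF : (∀ i, eval (reducePoint a) (map PadicInt.toZMod (f i)) = 0) →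
      (jacobian (fun i => map PadicInt.toZMod (f i)) (reducePoint a)).rank = t)
    (hG : eval (reducePoint a) (map PadicInt.toZMod g) = 0 →
      ∃ j, eval (reducePoint a) (pderiv j (map PadicInt.toZMod g)) ≠ 0)
    (hFG : (∀ i, eval (reducePoint a) (map PadicInt.toZMod (f i)) = 0) →
      eval (reducePoint a) (map PadicInt.toZMod g) = 0 →
      (jacobian (Sum.elim (fun i => map PadicInt.toZMod (f i)) fun _ : Unit =>
        map PadicInt.toZMod g) (reducePoint a)).rank = t + 1) :
    ∫ x in Metric.closedBall a (p : ℝ)⁻¹, intIntegrand f g s x ∂ν =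
      ((p : ℂ) ^ n)⁻¹ *
        (if ∀ i, eval (reducePoint a) (map PadicInt.toZMod (f i)) = 0 then mapFactor p t s else 1) *
        (if eval (reducePoint a) (map PadicInt.toZMod g) = 0 then 1 / ((p : ℂ) + 1) else 1) := by
  have hball : MeasurableSet (Metric.closedBall a (p : ℝ)⁻¹) :=
    Metric.isClosed_closedBall.measurableSet
  have hg1 : eval (reducePoint a) (map PadicInt.toZMod g) ≠ 0 →
      ∀ x ∈ Metric.closedBall a (p : ℝ)⁻¹, ‖eval x g‖ = 1 := by
    intro hg x hx
    rw [← reducePoint_eq_iff.2 hx, eval_reduce] at hg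
    exact norm_eq_one_of_not_le fun h => hg (toZMod_eq_zero_iff.2 h)
  have hf1 : (¬ ∀ i, eval (reducePoint a) (map PadicInt.toZMod (f i)) = 0) →
      ∀ x ∈ Metric.closedBall a (p : ℝ)⁻¹, ‖evalMap f x‖ = 1 := by
    intro hf x hx
    rw [← reducePoint_eq_iff.2 hx] at hf
    simp only [eval_reduce] at hf
    refine pi_norm_eq_one_of_not_le fun h => hf fun i => toZMod_eq_zero_iff.2 ?_
    exact (norm_le_pi_norm (evalMap f x) i).trans h
  by_cases hf : ∀ i, eval (reducePoint a) (map PadicInt.toZMod (f i)) = 0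
  · have hf0 : ∀ i, PadicInt.toZMod (eval a (f i)) = 0 := fun i => by rw [← eval_reduce, hf i]
    by_cases hg : eval (reducePoint a) (map PadicInt.toZMod g) = 0
    · rw [if_pos hf, if_pos hg]
      have hli := linearIndependent_of_rank ((hFG hf hg).trans (by simp))
      have hsum : (fun i => map PadicInt.toZMod (Sum.elim f (fun _ : Unit => g) i)) =
          Sum.elim (fun i => map PadicInt.toZMod (f i)) fun _ : Unit => map PadicInt.toZMod g := by
        ext1 i
        cases i <;> rfl
      obtain ⟨e, he, h⟩ := exists_setIntegral_comp_evalMap (ν := ν)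
        (Sum.elim f (fun _ : Unit => g)) a (by
          rintro (i | i)
          · exact hf0 i
          · exact (eval_reduce g a).symm.trans hg) (by rw [hsum]; exact hli)
      have hφ : Measurable fun y : Fin t ⊕ Unit → ℤ_[p] =>
          ((‖fun i => y (.inl i)‖ : ℝ) : ℂ) ^ s * ((‖y (.inr ())‖ : ℝ) : ℂ) := by
        refine Measurable.mul (Measurable.pow_const (Complex.measurable_ofReal.comp
          (Continuous.measurable ?_)) s) (Complex.measurable_ofReal.comp (Continuous.measurable ?_))
        · exact continuous_norm.comp (continuous_pi fun i => continuous_apply _)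
        · exact continuous_norm.comp (continuous_apply _)
      exact (h _ hφ).trans (setIntegral_norm_cpow_mul_norm ht he hs)
    · rw [if_pos hf, if_neg hg, mul_one]
      have hli := linearIndependent_of_rank ((hF hf).trans (by simp))
      obtain ⟨e, he, h⟩ := exists_setIntegral_comp_evalMap (ν := ν) f a hf0 hli
      have hφ : Measurable fun y : Fin t → ℤ_[p] => ((‖y‖ : ℝ) : ℂ) ^ s :=
        Measurable.pow_const (Complex.measurable_ofReal.comp continuous_norm.measurable) s
      rw [mapFactor, ← setIntegral_norm_cpow (ν := ν) ht he hs, ← h _ hφ]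
      refine setIntegral_congr_fun hball fun x hx => ?_
      simp [intIntegrand, hg1 hg x hx]
  · by_cases hg : eval (reducePoint a) (map PadicInt.toZMod g) = 0
    · rw [if_neg hf, if_pos hg, mul_one]
      obtain ⟨j, hj⟩ := hG hg
      have hli : LinearIndependent (ZMod p) (jacobian (fun _ : Unit => map PadicInt.toZMod g)
          (reducePoint a)).row := by
        refine LinearIndependent.of_subsingleton () fun h => hj ?_
        exact congrFun h j
      obtain ⟨e, he, h⟩ := exists_setIntegral_comp_evalMap (ν := ν) (fun _ : Unit => g) a
        (fun _ => (eval_reduce g a).symm.trans hg) hli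
      have hφ : Measurable fun y : Unit → ℤ_[p] => ((‖y ()‖ : ℝ) : ℂ) :=
        Complex.measurable_ofReal.comp (continuous_norm.comp (continuous_apply _)).measurable
      rw [← setIntegral_norm_apply (ν := ν) (e ()), ← h _ hφ]
      refine setIntegral_congr_fun hball fun x hx => ?_
      simp [intIntegrand, hf1 hf x hx, evalMap]
    · rw [if_neg hf, if_neg hg, mul_one, mul_one, ← mul_one ((p : ℂ) ^ n)⁻¹,
        ← setIntegral_closedBall_const (ν := ν) a 1]
      refine setIntegral_congr_fun hball fun x hx => ?_
      simp [intIntegrand, hf1 hf x hx, hg1 hg x hx]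

end LocalIntegrals

/-! ### Rescaling along `k` and reduction to the face polynomials -/

section Faces
variable {n t p : ℕ} [Fact p.Prime]

/-- The polynomial `p^{-m} f(p^{k₁} x₁, …, p^{k_n} x_n)`. -/
def rescale (k : Fin n → ℕ) (m : ℕ) (f : MvPolynomial (Fin n) ℤ_[p]) : MvPolynomial (Fin n) ℤ_[p] :=
  ∑ ω ∈ f.support, monomial ω (coeff ω f * (p : ℤ_[p]) ^ (∑ i, k i * ω i - m))

theorem eval_scale {k : Fin n → ℕ} {m : ℕ} {f : MvPolynomial (Fin n) ℤ_[p]}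
    (hm : ∀ ω ∈ f.support, m ≤ ∑ i, k i * ω i) (u : Fin n → ℤ_[p]) :
    eval (scale k u) f = (p : ℤ_[p]) ^ m * eval u (rescale k m f) := by
  rw [eval_eq', rescale, map_sum, Finset.mul_sum]
  refine Finset.sum_congr rfl fun ω hω => ?_
  rw [eval_monomial, Finsupp.prod_fintype _ _ (fun i => pow_zero _)]
  simp only [scale_apply, mul_pow, Finset.prod_mul_distrib, ← pow_mul, Finset.prod_pow_eq_pow_sum]
  have : (p : ℤ_[p]) ^ ∑ i, k i * ω i = (p : ℤ_[p]) ^ m * (p : ℤ_[p]) ^ (∑ i, k i * ω i - m) := by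
    rw [← pow_add, Nat.add_sub_cancel' (hm ω hω)]
  rw [this]
  ring

theorem natVec_dotProduct_natVec (k ω : Fin n → ℕ) :
    natVec k ⬝ᵥ natVec ω = ((∑ i, k i * ω i : ℕ) : ℝ) := by
  simp [dotProduct, natVec]

/-- After division by `p^m`, exponents on the face keep their coefficient, and all others carry a
positive power of `p`, which dies in the reduction. -/
theorem map_rescale {A : Set (Fin n →₀ ℕ)} (hA : A.Finite) {k : Fin n → ℕ} {m : ℕ}
    {f : MvPolynomial (Fin n) ℤ_[p]} (hf : ∀ ω ∈ f.support, ω ∈ A)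
    (hm : mVal (newtonPolyhedron A) (natVec k) = m) :
    map PadicInt.toZMod (rescale k m f) =
      reducedFace (firstMeet (newtonPolyhedron A) (natVec k)) f := by
  rw [rescale, reducedFace, restrictFace, map_sum, map_sum, Finset.sum_filter]
  refine Finset.sum_congr rfl fun ω hω => ?_
  have h1 : m ≤ ∑ i, k i * ω i := by
    have := mVal_le_natVec hA (natVec_nonneg k) (hf ω hω)
    rw [hm, natVec_dotProduct_natVec] at this
    exact_mod_cast this
  rw [natVec_mem_firstMeet (hf ω hω), hm, natVec_dotProduct_natVec, Nat.cast_inj]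
  split_ifs with h2
  · rw [h2, Nat.sub_self, pow_zero, mul_one]
  · have h3 : ∑ i, k i * ω i - m ≠ 0 := by omega
    rw [map_monomial, map_mul, map_pow, map_natCast, CharP.cast_eq_zero, zero_pow h3, mul_zero,
      monomial_zero]

theorem exists_nat_mVal {A : Set (Fin n →₀ ℕ)} (hA : A.Finite) (hA0 : A.Nonempty) (k : Fin n → ℕ) :
    ∃ m : ℕ, mVal (newtonPolyhedron A) (natVec k) = m ∧ ∀ ω ∈ A, m ≤ ∑ i, k i * ω i := by
  obtain ⟨ω, -, h⟩ := exists_mVal_natVec hA hA0 k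
  refine ⟨_, h, fun ω' hω' => ?_⟩
  have := mVal_le_natVec hA (natVec_nonneg k) hω'
  rw [h, natVec_dotProduct_natVec] at this
  exact_mod_cast this

theorem inv_prime_pow_mul_cpow {r : ℝ} (hr : 0 ≤ r) (m : ℕ) (s : ℂ) :
    ((((p : ℝ) ^ m)⁻¹ * r : ℝ) : ℂ) ^ s = (((p : ℂ) ^ s) ^ m)⁻¹ * (r : ℂ) ^ s := by
  induction m with
  | zero => simp
  | succ m ih =>
    have h0 : 0 ≤ ((p : ℝ) ^ m)⁻¹ * r := by positivity
    have : ((p : ℝ) ^ (m + 1))⁻¹ * r = (p : ℝ)⁻¹ * (((p : ℝ) ^ m)⁻¹ * r) := by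
      rw [pow_succ, mul_inv]; ring
    rw [this, inv_prime_mul_cpow h0, ih, pow_succ, mul_inv]
    ring

theorem norm_prime_pow (m : ℕ) : ‖(p : ℤ_[p]) ^ m‖ = ((p : ℝ) ^ m)⁻¹ := by
  rw [norm_pow, PadicInt.norm_p, inv_pow]

theorem intIntegrand_scale {F : Fin t → MvPolynomial (Fin n) ℤ_[p]}
    {g : MvPolynomial (Fin n) ℤ_[p]} {k : Fin n → ℕ} {m m' : ℕ}
    (hm : ∀ i, ∀ ω ∈ (F i).support, m ≤ ∑ i, k i * ω i)
    (hm' : ∀ ω ∈ g.support, m' ≤ ∑ i, k i * ω i) (s : ℂ) (u : Fin n → ℤ_[p]) :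
    intIntegrand F g s (scale k u) = (((p : ℂ) ^ s) ^ m)⁻¹ * ((p : ℂ) ^ m')⁻¹ *
      intIntegrand (fun i => rescale k m (F i)) (rescale k m' g) s u := by
  have h1 : evalMap F (scale k u) =
      (p : ℤ_[p]) ^ m • evalMap (fun i => rescale k m (F i)) u := by
    ext i
    simp [evalMap, eval_scale (hm i)]
  rw [intIntegrand, intIntegrand, h1, eval_scale hm', norm_smul, norm_mul, norm_prime_pow,
    norm_prime_pow, inv_prime_pow_mul_cpow (norm_nonneg _)]
  push_cast
  ring

variable {F : Fin t → MvPolynomial (Fin n) ℤ_[p]} {g : MvPolynomial (Fin n) ℤ_[p]}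

theorem L_eq_sum (ht : 0 < t) (δ : Set (Fin n → ℝ)) {s : ℂ} (hs : 0 < s.re) :
    L F g δ s = ((p : ℂ) ^ n)⁻¹ * ∑ a : Fin n → (ZMod p)ˣ,
      (if ∀ i, eval (torusPoint a) (mapDelta F δ i) = 0 then mapFactor p t s else 1) *
        (if eval (torusPoint a) (polyDelta g δ) = 0 then 1 / ((p : ℂ) + 1) else 1) := by
  have h1 := prime_cpow_add_sub_one_ne_zero (p := p) (s := s) hs.le ht
  have h2 : (p : ℂ) + 1 ≠ 0 := by exact_mod_cast Nat.succ_ne_zero p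
  have h3 := prime_complex_ne_zero (p := p)
  have e1 : 1 - mapFactor p t s = (p : ℂ) ^ t * (((p : ℂ) ^ s - 1) / ((p : ℂ) ^ (s + (t : ℂ)) - 1)) := by
    rw [mapFactor]
    field_simp
    rw [Complex.cpow_add _ _ h3, Complex.cpow_natCast]
    ring
  have e2 : 1 - 1 / ((p : ℂ) + 1) = (p : ℂ) / ((p : ℂ) + 1) := by
    field_simp
    ring
  have e3 : 1 - mapFactor p t s * (1 / ((p : ℂ) + 1)) =
      (p : ℂ) * (((p : ℂ) ^ ((t : ℤ) - 1) * ((p : ℂ) ^ s * ((p : ℂ) + 1) - 1) - 1) /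
            (((p : ℂ) ^ (s + (t : ℂ)) - 1) * ((p : ℂ) + 1))) := by
    rw [mapFactor, zpow_sub_one₀ h3, zpow_natCast]
    field_simp
    rw [Complex.cpow_add _ _ h3, Complex.cpow_natCast]
    ring
  rw [L, sum_weights (fun a => ∀ i, eval (torusPoint a) (mapDelta F δ i) = 0)
    (fun a => eval (torusPoint a) (polyDelta g δ) = 0), e1, e2, e3, countN, countP, countQ]
  ring

variable [MeasurableSpace ℤ_[p]] [BorelSpace ℤ_[p]] {ν : Measure (Fin n → ℤ_[p])}
  [ν.IsAddHaarMeasure] [IsProbabilityMeasure ν]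

/-- The contribution of one shell. The rescaled polynomials reduce to `F_δ` and `g_δ` whatever `k ∈
δ` is, so `k` enters only through the power of `p`. -/
theorem setIntegral_unitTorus_scale (ht : 0 < t) (hn : t + 1 ≤ n) (hF : F ≠ 0) (hg : g ≠ 0)
    (hgnd : NonDegenerated g) (hFnd : StronglyNonDegenerated F)
    (hFgnd : PairStronglyNonDegenerated F g) {δ : Set (Fin n → ℝ)} (hδ : δ ∈ pairPartition F g)
    {k : Fin n → ℕ} (hk : natVec k ∈ δ) {s : ℂ} (hs : 0 < s.re) :
    ((p : ℂ) ^ ∑ i, k i)⁻¹ * ∫ u in unitTorus p n, intIntegrand F g s (scale k u) ∂ν =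
      L F g δ s * (p : ℂ) ^ (-expo F g s (natVec k)) := by
  obtain ⟨m, hm, hmF⟩ := exists_nat_mVal (mapSupport_finite (F := F)) (mapSupport_nonempty hF) k
  obtain ⟨m', hm', hmg⟩ := exists_nat_mVal (polySupport_finite (g := g)) (polySupport_nonempty hg) k
  have hsF : ∀ i, ∀ ω ∈ (F i).support, ω ∈ mapSupport F := fun i ω hω => ⟨i, by simpa using hω⟩
  have hsg : ∀ ω ∈ g.support, ω ∈ polySupport g := fun ω hω => by simpa [polySupport] using hω
  have hFδ : ∀ i, map PadicInt.toZMod (rescale k m (F i)) = mapDelta F δ i := fun i => by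
    rw [map_rescale mapSupport_finite (hsF i) hm, mapDelta, assocFace_eq_left hδ hk]
    rfl
  have hgδ : map PadicInt.toZMod (rescale k m' g) = polyDelta g δ := by
    rw [map_rescale polySupport_finite hsg hm', polyDelta, assocFace_eq_right hδ hk]
    rfl
  simp only [intIntegrand_scale (fun i ω hω => hmF ω (hsF i ω hω)) (fun ω hω => hmg ω (hsg ω hω))]
  rw [integral_const_mul, unitTorus_eq_iUnion, integral_iUnion_fintype
    (fun a => Metric.isClosed_closedBall.measurableSet) pairwise_disjoint_liftPoint
    fun a => (integrable_of_bound (measurable_intIntegrand _ _ _)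
      (norm_intIntegrand_le _ _ hs)).integrableOn, L_eq_sum ht δ hs]
  have hloc : ∀ a : Fin n → (ZMod p)ˣ, _ = _ := fun a =>
    setIntegral_intIntegrand (ν := ν) ht (fun i => rescale k m (F i)) (rescale k m' g)
      (liftPoint a) hs
      (by
        simp only [hFδ, reducePoint_liftPoint]
        intro h
        have := hFnd _ (isFace_firstMeet mapSupport_finite (mapSupport_nonempty hF)
          (natVec_nonneg k)) a
        simp only [mapDelta, assocFace_eq_left hδ hk] at h ⊢
        exact (this h).trans (min_eq_left (by omega)))
      (by
        simp only [hgδ, reducePoint_liftPoint]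
        intro h
        by_contra! h'
        refine hgnd _ (isFace_firstMeet polySupport_finite (polySupport_nonempty hg)
          (natVec_nonneg k)) ⟨a, ?_⟩
        simp only [polyDelta, assocFace_eq_right hδ hk] at h h'
        exact ⟨h, h'⟩)
      (by
        simp only [hFδ, hgδ, reducePoint_liftPoint]
        exact hFgnd δ hδ a)
  simp only [hFδ, hgδ, reducePoint_liftPoint] at hloc
  simp only [hloc, mul_assoc]
  rw [← Finset.mul_sum]
  have hexp : (p : ℂ) ^ (-expo F g s (natVec k)) =
      ((p : ℂ) ^ ∑ i, k i)⁻¹ * ((((p : ℂ) ^ s) ^ m)⁻¹ * ((p : ℂ) ^ m')⁻¹) := by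
    rw [expo, mapNewton_eq, polyNewton_eq, hm, hm', sigma_natVec, Complex.cpow_neg,
      Complex.cpow_add _ _ prime_complex_ne_zero, Complex.cpow_add _ _ prime_complex_ne_zero,
      Complex.ofReal_natCast, Complex.ofReal_natCast, Complex.ofReal_natCast,
      Complex.cpow_nat_mul, Complex.cpow_natCast, Complex.cpow_natCast, mul_inv, mul_inv]
    ring
  rw [hexp]
  ring

end Faces

/-! ### Decomposition of `ℤ_pⁿ` by the valuations of the coordinates -/

section Decomposition
variable {n t p : ℕ} [Fact p.Prime]

/-- The points whose coordinates have valuations `k`. -/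
def shell (k : Fin n → ℕ) : Set (Fin n → ℤ_[p]) := scale k '' unitTorus p n

theorem mem_shell {k : Fin n → ℕ} {x : Fin n → ℤ_[p]} (hx : x ∈ shell k) (i : Fin n) :
    ‖x i‖ = ((p : ℝ) ^ k i)⁻¹ := by
  obtain ⟨u, hu, rfl⟩ := hx
  rw [scale_apply, norm_mul, norm_prime_pow, hu i, mul_one]

theorem pairwise_disjoint_shell :
    Pairwise (Function.onFun Disjoint (shell : (Fin n → ℕ) → Set (Fin n → ℤ_[p]))) := by
  intro k k' hkk'
  refine Set.disjoint_left.2 fun x hx hx' => hkk' ?_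
  ext i
  have h := (mem_shell hx i).symm.trans (mem_shell hx' i)
  exact Nat.pow_right_injective (Fact.out : p.Prime).two_le (by exact_mod_cast inv_injective h)

theorem mem_iUnion_shell {x : Fin n → ℤ_[p]} (hx : ∀ i, x i ≠ 0) : x ∈ ⋃ k, shell (p := p) k := by
  refine Set.mem_iUnion.2 ⟨fun i => (x i).valuation, fun i => PadicInt.unitCoeff (hx i),
    fun i => PadicInt.norm_units _, ?_⟩
  ext i
  rw [scale_apply, mul_comm]
  exact (PadicInt.unitCoeff_spec (hx i)).symm

variable {F : Fin t → MvPolynomial (Fin n) ℤ_[p]} {g : MvPolynomial (Fin n) ℤ_[p]}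

theorem pairPartition_finite (hF : F ≠ 0) (hg : g ≠ 0) : (pairPartition F g).Finite :=
  conePartition_finite mapSupport_finite (mapSupport_nonempty hF) polySupport_finite
    (polySupport_nonempty hg)

theorem hasSum_S (hF : F ≠ 0) (hg : g ≠ 0) {s : ℂ} (hs : 0 ≤ s.re) (δ : Set (Fin n → ℝ)) :
    HasSum (fun k : Fin n → ℕ =>
      if natVec k ∈ δ then (p : ℂ) ^ (-expo F g s (natVec k)) else 0) (S F g δ s) :=
  (hasSum_subtype_iff_indicator (s := {k : Fin n → ℕ | natVec k ∈ δ})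
    (f := fun k : Fin n → ℕ => (p : ℂ) ^ (-expo F g s (natVec k)))).1
    (summable_STerm hF hg hs δ).hasSum

variable [MeasurableSpace ℤ_[p]] [BorelSpace ℤ_[p]] {ν : Measure (Fin n → ℤ_[p])}
  [ν.IsAddHaarMeasure] [IsProbabilityMeasure ν]

theorem measurableSet_unitTorus : MeasurableSet (unitTorus p n) := by
  rw [unitTorus_eq_iUnion]
  exact MeasurableSet.iUnion fun a => Metric.isClosed_closedBall.measurableSet

/-- The hyperplane lies in the image of the scaling of one coordinate by `p^m`, of measure `p^{-m}`,
for every `m`. -/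
theorem measure_hyperplane (i : Fin n) : ν {x | x i = 0} = 0 := by
  have h : ∀ m : ℕ, ν {x | x i = 0} ≤ ((p : ENNReal)⁻¹) ^ m := fun m => by
    have := measure_range_scale (ν := ν) (Pi.single i m)
    rw [Finset.sum_pi_single', if_pos (Finset.mem_univ i)] at this
    rw [← ENNReal.inv_pow, ← this]
    refine measure_mono fun x hx => mem_range_scale.2 fun j => ?_
    by_cases hj : j = i
    · subst hj
      rw [show x j = 0 from hx, norm_zero]
      positivity
    · simpa [hj] using PadicInt.norm_le_one (x j)
  have hp : (p : ENNReal)⁻¹ < 1 := by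
    rw [ENNReal.inv_lt_one]
    exact_mod_cast (Fact.out : p.Prime).one_lt
  exact le_antisymm (ge_of_tendsto' (ENNReal.tendsto_pow_atTop_nhds_zero_of_lt_one hp) h) bot_le

theorem iUnion_shell_ae_eq : (⋃ k, shell (p := p) (n := n) k) =ᵐ[ν] Set.univ := by
  rw [ae_eq_univ]
  refine measure_mono_null (t := ⋃ i, {x : Fin n → ℤ_[p] | x i = 0}) (fun x hx => ?_)
    (measure_iUnion_null fun i => measure_hyperplane i)
  by_contra h
  simp only [Set.mem_iUnion, not_exists] at h
  exact hx (mem_iUnion_shell h)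

theorem measurableSet_shell (k : Fin n → ℕ) : MeasurableSet (shell (p := p) k) :=
  (measurableEmbedding_scale k).measurableSet_image.2 measurableSet_unitTorus

theorem setIntegral_shell (k : Fin n → ℕ) (f : (Fin n → ℤ_[p]) → ℂ) :
    ∫ x in shell k, f x ∂ν =
      ((p : ℂ) ^ ∑ i, k i)⁻¹ * ∫ u in unitTorus p n, f (scale k u) ∂ν := by
  have hsub : shell k ⊆ Set.range (scale (p := p) k) := Set.image_subset_range _ _
  have h := setIntegral_range_scale (ν := ν) k ((shell k).indicator f)
  rw [setIntegral_indicator (measurableSet_shell k), Set.inter_eq_right.2 hsub] at h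
  rw [h, ← integral_indicator measurableSet_unitTorus]
  congr 2
  ext u
  by_cases hu : u ∈ unitTorus p n
  · rw [Set.indicator_of_mem hu, Set.indicator_of_mem (s := shell k) (Set.mem_image_of_mem _ hu)]
  · rw [Set.indicator_of_notMem hu, Set.indicator_of_notMem]
    rintro ⟨v, hv, hvu⟩
    exact hu (scale_injective k hvu ▸ hv)

theorem hasSum_shell {f : (Fin n → ℤ_[p]) → ℂ} (hf : Integrable f ν) :
    HasSum (fun k : Fin n → ℕ =>
      ((p : ℂ) ^ ∑ i, k i)⁻¹ * ∫ u in unitTorus p n, f (scale k u) ∂ν) (∫ x, f x ∂ν) := by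
  have h := hasSum_integral_iUnion (μ := ν) (f := f) measurableSet_shell
    (pairwise_disjoint_shell (n := n) (p := p)) hf.integrableOn
  simp only [setIntegral_shell] at h
  rwa [setIntegral_congr_set iUnion_shell_ae_eq, setIntegral_univ] at h

theorem integral_intIntegrand (ht : 0 < t) (hn : t + 1 ≤ n) (hF : F ≠ 0) (hg : g ≠ 0)
    (hgnd : NonDegenerated g) (hFnd : StronglyNonDegenerated F)
    (hFgnd : PairStronglyNonDegenerated F g) {s : ℂ} (hs : 0 < s.re) :
    ∫ x, intIntegrand F g s x ∂ν = ∑ᶠ δ ∈ pairPartition F g, L F g δ s * S F g δ s := by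
  have hfin := pairPartition_finite (F := F) (g := g) hF hg
  have h1 := hasSum_shell (integrable_of_bound (ν := ν) (measurable_intIntegrand F g s)
    (norm_intIntegrand_le F g hs))
  rw [finsum_mem_eq_finite_toFinset_sum _ hfin]
  refine h1.unique ?_
  have h2 := hasSum_sum (s := hfin.toFinset) fun δ _ =>
    (hasSum_S (F := F) (g := g) hF hg hs.le δ).mul_left (L F g δ s)
  refine (congrArg (fun f => HasSum f _) (funext fun k => ?_)).mpr h2
  have hδ : cellOf (mapNewton F) (polyNewton g) (natVec k) ∈ pairPartition F g :=
    cellOf_mem_conePartition mapSupport_finite (mapSupport_nonempty hF) polySupport_finite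
      (polySupport_nonempty hg) (natVec_nonneg k)
  have hk : natVec k ∈ cellOf (mapNewton F) (polyNewton g) (natVec k) :=
    mem_cellOf_self (natVec_nonneg k)
  refine (setIntegral_unitTorus_scale ht hn hF hg hgnd hFnd hFgnd hδ hk hs).trans ?_
  -- Each `k` lies in exactly one cell, so only one summand over `δ` is nonzero.
  rw [Finset.sum_eq_single (cellOf (mapNewton F) (polyNewton g) (natVec k))]
  · rw [if_pos hk]
  · intro δ' hδ' hne
    rw [if_neg fun hk' => hne (eq_cellOf_of_mem (hfin.mem_toFinset.1 hδ') hk'), mul_zero]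
  · intro h
    exact absurd (hfin.mem_toFinset.2 hδ) h

end Decomposition

/-! ### Transfer from `ℤ_pⁿ` to the integral over `ℚ_pⁿ` -/

section Zeta
variable {n t p : ℕ} [Fact p.Prime] {F : Fin t → MvPolynomial (Fin n) ℤ_[p]}
  {g : MvPolynomial (Fin n) ℤ_[p]}

theorem zetaIntegrand_coeHom (s : ℂ) (x : Fin n → ℤ_[p]) :
    zetaIntegrand F g s (coeHom p n x) = intIntegrand F g s x := by
  have h : ∀ f : MvPolynomial (Fin n) ℤ_[p], aeval (coeHom p n x) f = ((eval x f : ℤ_[p]) : ℚ_[p]) :=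
    fun f => aeval_algebraMap_apply ℚ_[p] x f
  have h2 : ‖(fun i => aeval (coeHom p n x) (F i) : Fin t → ℚ_[p])‖ = ‖evalMap F x‖ := by
    simp only [h]
    rfl
  rw [zetaIntegrand, h2, h, intIntegrand, PadicInt.norm_def]

variable [MeasurableSpace ℚ_[p]] [BorelSpace ℚ_[p]] {μ : Measure (Fin n → ℚ_[p])}
  [μ.IsAddHaarMeasure]

theorem integrableOn_and_zeta_eq (hμ : μ (integralBox p n) = 1) (ht : 0 < t) (hn : t + 1 ≤ n)
    (hF : F ≠ 0) (hg : g ≠ 0) (hgnd : NonDegenerated g) (hFnd : StronglyNonDegenerated F)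
    (hFgnd : PairStronglyNonDegenerated F g) {s : ℂ} (hs : 0 < s.re) :
    IntegrableOn (zetaIntegrand F g s) (integralBox p n) μ ∧
      zeta μ F g s = ∑ᶠ δ ∈ pairPartition F g, L F g δ s * S F g δ s := by
  let : MeasurableSpace ℤ_[p] := borel _
  have : BorelSpace ℤ_[p] := ⟨rfl⟩
  have hme : MeasurableEmbedding (coeHom p n) := isOpenEmbedding_coeHom.measurableEmbedding
  let ν := μ.comap (coeHom p n)
  have : ν.IsAddHaarMeasure := Measure.IsAddHaarMeasure.comap (mH := inferInstance) μ isOpenEmbedding_coeHom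
  have : IsProbabilityMeasure ν := ⟨by
    rw [hme.comap_apply, Set.image_univ, range_coeHom, hμ]⟩
  have hmap : μ.restrict (integralBox p n) = ν.map (coeHom p n) := by
    rw [hme.map_comap, range_coeHom]
  have hcomp : zetaIntegrand F g s ∘ coeHom p n = intIntegrand F g s :=
    funext (zetaIntegrand_coeHom s)
  refine ⟨?_, ?_⟩
  · rw [IntegrableOn, hmap, hme.integrable_map_iff, hcomp]
    exact integrable_of_bound (measurable_intIntegrand F g s) (norm_intIntegrand_le F g hs)
  · rw [zeta, hmap, hme.integral_map]
    simp only [zetaIntegrand_coeHom]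
    exact integral_intIntegrand ht hn hF hg hgnd hFnd hFgnd hs

end Zeta

/-! ### Meromorphy of the explicit expressions and the zeros of their denominators -/

section Continuation
variable {n t p : ℕ} [Fact p.Prime] {F : Fin t → MvPolynomial (Fin n) ℤ_[p]}
  {g : MvPolynomial (Fin n) ℤ_[p]}

theorem analyticAt_prime_cpow {f : ℂ → ℂ} {s : ℂ} (hf : AnalyticAt ℂ f s) :
    AnalyticAt ℂ (fun s => (p : ℂ) ^ f s) s := by
  simp only [Complex.cpow_def_of_ne_zero (prime_complex_ne_zero (p := p))]
  exact (analyticAt_const.mul hf).cexp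

theorem analyticAt_expo (k : Fin n → ℝ) (s : ℂ) :
    AnalyticAt ℂ (fun s => (p : ℂ) ^ expo F g s k) s :=
  analyticAt_prime_cpow (((analyticAt_const.mul analyticAt_id).add analyticAt_const).add
    analyticAt_const)

theorem meromorphicAt_L (δ : Set (Fin n → ℝ)) (s : ℂ) : MeromorphicAt (L F g δ) s := by
  have h1 : MeromorphicAt (fun s : ℂ => (p : ℂ) ^ s) s := (analyticAt_prime_cpow analyticAt_id).meromorphicAt
  have h2 : MeromorphicAt (fun s : ℂ => (p : ℂ) ^ (s + (t : ℂ))) s :=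
    (analyticAt_prime_cpow (analyticAt_id.add analyticAt_const)).meromorphicAt
  unfold L
  fun_prop

theorem analyticAt_L (δ : Set (Fin n → ℝ)) {s : ℂ} (hs : (p : ℂ) ^ (s + (t : ℂ)) - 1 ≠ 0) :
    AnalyticAt ℂ (L F g δ) s := by
  have h1 : AnalyticAt ℂ (fun s : ℂ => (p : ℂ) ^ s) s := analyticAt_prime_cpow analyticAt_id
  have h2 : AnalyticAt ℂ (fun s : ℂ => (p : ℂ) ^ (s + (t : ℂ))) s :=
    analyticAt_prime_cpow (analyticAt_id.add analyticAt_const)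
  have h3 : (p : ℂ) + 1 ≠ 0 := by exact_mod_cast Nat.succ_ne_zero p
  have h4 : ((p : ℂ) ^ (s + (t : ℂ)) - 1) * ((p : ℂ) + 1) ≠ 0 := mul_ne_zero hs h3
  unfold L
  fun_prop (disch := assumption)

theorem analyticAt_closedS_summands {δ : Set (Fin n → ℝ)} (D : SimplicialPartition δ) (i) (s : ℂ) :
    AnalyticAt ℂ (fun s => ∑ h ∈ (boxPoints_finite (D.gen i)).toFinset,
      (p : ℂ) ^ expo F g s (intVec h)) s ∧
    AnalyticAt ℂ (fun s => ∏ j, ((p : ℂ) ^ expo F g s (natVec (D.gen i j)) - 1)) s :=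
  ⟨Finset.analyticAt_fun_sum _ fun _ _ => analyticAt_expo _ _,
    Finset.analyticAt_fun_prod _ fun _ _ => (analyticAt_expo _ _).sub analyticAt_const⟩

theorem meromorphicAt_closedS {δ : Set (Fin n → ℝ)} (D : SimplicialPartition δ) (s : ℂ) :
    MeromorphicAt (closedS F g D) s := by
  rw [show closedS F g D = _ from funext (closedS_eq_sum D)]
  exact MeromorphicAt.fun_sum fun i _ => (analyticAt_closedS_summands D i s).1.meromorphicAt.mul
    (analyticAt_closedS_summands D i s).2.meromorphicAt.inv

theorem analyticAt_closedS {δ : Set (Fin n → ℝ)} (D : SimplicialPartition δ) {s : ℂ}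
    (hs : ∀ i j, (p : ℂ) ^ expo F g s (natVec (D.gen i j)) - 1 ≠ 0) :
    AnalyticAt ℂ (closedS F g D) s := by
  rw [show closedS F g D = _ from funext (closedS_eq_sum D)]
  exact Finset.analyticAt_fun_sum _ fun i _ => (analyticAt_closedS_summands D i s).1.mul
    ((analyticAt_closedS_summands D i s).2.inv (Finset.prod_ne_zero_iff.2 fun j _ => hs i j))

theorem re_eq_zero_of_prime_cpow {z : ℂ} (h : (p : ℂ) ^ z - 1 = 0) : z.re = 0 := by
  have h1 := norm_prime_cpow (p := p) z
  rw [sub_eq_zero.1 h, norm_one] at h1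
  have hp := one_lt_prime_real (p := p)
  rcases lt_trichotomy z.re 0 with h2 | h2 | h2
  · exact absurd h1 (Real.rpow_lt_one_of_one_lt_of_neg hp h2).ne'
  · exact h2
  · exact absurd h1 (Real.one_lt_rpow hp h2).ne

theorem re_eq_of_expo (hF : F ≠ 0) (hg : g ≠ 0) {k : Fin n → ℕ} (hk : IsPrimitive k) {s : ℂ}
    (h : (p : ℂ) ^ expo F g s (natVec k) - 1 = 0) :
    mVal (mapNewton F) (natVec k) ≠ 0 ∧
      s.re = -((mVal (polyNewton g) (natVec k) + sigma (natVec k)) /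
            mVal (mapNewton F) (natVec k)) := by
  obtain ⟨a, b, ha, hb, hb', hab⟩ := exists_expo_natVec (F := F) (g := g) hF hg k
  have h0 := re_eq_zero_of_prime_cpow h
  rw [hab] at h0
  simp only [Complex.add_re, Complex.mul_re, Complex.natCast_re, Complex.natCast_im, zero_mul,
    sub_zero] at h0
  have hbpos : (0 : ℝ) < b := by exact_mod_cast hk.sum_pos.trans_le hb
  rw [ha, hb']
  have ha0 : (a : ℝ) ≠ 0 := by
    intro h
    rw [h, zero_mul] at h0
    linarith
  refine ⟨ha0, ?_⟩
  field_simp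
  linarith

end Continuation

end IgusaZeta
end

/-! ### The main theorem -/

open IgusaZeta
theorem mainTheorem3 (p n t : ℕ) [Fact p.Prime]
    [MeasurableSpace ℚ_[p]] [BorelSpace ℚ_[p]]
    (μ : MeasureTheory.Measure (Fin n → ℚ_[p])) [μ.IsAddHaarMeasure]
    (hμ : μ (integralBox p n) = 1)
    (hn : t + 1 ≤ n)
    (F : Fin t → MvPolynomial (Fin n) ℤ_[p]) (g : MvPolynomial (Fin n) ℤ_[p])
    (hF : ¬ ∃ c : Fin t → ℤ_[p], ∀ i, F i = MvPolynomial.C (c i))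
    (hF0 : ∀ i, MvPolynomial.eval 0 (F i) = 0)
    (hg : ¬ ∃ c : ℤ_[p], g = MvPolynomial.C c)
    (hg0 : MvPolynomial.eval 0 g = 0)
    (hgnd : NonDegenerated g)
    (hFnd : StronglyNonDegenerated F)
    (hFgnd : PairStronglyNonDegenerated F g) :
    -- the formula
    (pairPartition F g).Finite ∧
    (∀ s : ℂ, 0 < s.re →
      MeasureTheory.IntegrableOn (zetaIntegrand F g s) (integralBox p n) μ ∧
      (∀ δ ∈ pairPartition F g, Summable (STerm F g δ s)) ∧
      zeta μ F g s = ∑ᶠ δ ∈ pairPartition F g, L F g δ s * S F g δ s) ∧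
    -- the closed rational expressions for the `S_δ`
    (∀ δ ∈ pairPartition F g, ∃ D : SimplicialPartition δ,
      ∀ i j, IsRayGenerator (pairPartition F g) (D.gen i j)) ∧
    (∀ δ ∈ pairPartition F g, ∀ D : SimplicialPartition δ, ∀ s : ℂ, 0 < s.re →
      S F g δ s = closedS F g D s) ∧
    (∀ δ ∈ pairPartition F g, ∃ A B : Polynomial ℚ, ∀ s : ℂ, 0 < s.re →
      Polynomial.aeval ((p : ℂ) ^ (-s)) B ≠ 0 ∧
      S F g δ s = Polynomial.aeval ((p : ℂ) ^ (-s)) A / Polynomial.aeval ((p : ℂ) ^ (-s)) B) ∧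
    -- the meromorphic continuation and the real parts of its candidate poles
    (∃ Z : ℂ → ℂ, Meromorphic Z ∧ (∀ s : ℂ, 0 < s.re → Z s = zeta μ F g s) ∧
      ∀ s : ℂ, meromorphicOrderAt Z s < 0 →
        s.re = -(t : ℝ) ∨
        ∃ k : Fin n → ℕ, IsRayGenerator (pairPartition F g) k ∧
          mVal (mapNewton F) (natVec k) ≠ 0 ∧
          s.re = -((mVal (polyNewton g) (natVec k) + sigma (natVec k)) /
            mVal (mapNewton F) (natVec k))) := by
  have hF' : F ≠ 0 := by
    rintro rfl
    exact hF ⟨0, fun i => by simp⟩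
  have hg' : g ≠ 0 := by
    rintro rfl
    exact hg ⟨0, by simp⟩
  have ht : 0 < t := by
    -- An empty mapping would be constant, so `hF` forces `t ≥ 1`.
    rcases Nat.eq_zero_or_pos t with rfl | ht
    · exact absurd ⟨0, fun i => i.elim0⟩ hF
    · exact ht
  have hfin := pairPartition_finite (F := F) (g := g) hF' hg'
  have hD : ∀ δ ∈ pairPartition F g, ∃ D : SimplicialPartition δ,
      ∀ i j, IsRayGenerator (pairPartition F g) (D.gen i j) := fun δ hδ =>
    exists_simplicialPartition mapSupport_finite (mapSupport_nonempty hF') polySupport_finite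
      (polySupport_nonempty hg') hδ
  have hS : ∀ δ ∈ pairPartition F g, ∀ D : SimplicialPartition δ, ∀ s : ℂ, 0 < s.re →
      S F g δ s = closedS F g D s := fun δ hδ D s hs => S_eq_closedS hF' hg' hδ D hs
  have hz := fun (s : ℂ) (hs : 0 < s.re) =>
    integrableOn_and_zeta_eq hμ ht hn hF' hg' hgnd hFnd hFgnd hs
  refine ⟨hfin, fun s hs => ⟨(hz s hs).1, fun δ _ => summable_STerm hF' hg' hs.le δ, (hz s hs).2⟩,
    hD, hS, fun δ hδ => ?_, ?_⟩
  · obtain ⟨D, -⟩ := hD δ hδ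
    obtain ⟨A, B, h⟩ := isRationalIn_closedS hF' hg' D
    exact ⟨A, B, fun s hs => ⟨(h s hs).1, (hS δ hδ D s hs).trans (h s hs).2⟩⟩
  · choose D hDray using hD
    -- The continuation uses, for each cell, a partition generated by rays of `Δ_{F,g}`, so that
    -- only these rays enter the denominators.
    refine ⟨fun s => ∑ δ ∈ hfin.toFinset.attach,
      L F g δ.1 s * closedS F g (D δ.1 (hfin.mem_toFinset.1 δ.2)) s, fun s => ?_, fun s hs => ?_,
      fun s hs => ?_⟩
    · exact MeromorphicAt.fun_sum fun δ _ =>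
        (meromorphicAt_L δ.1 s).mul (meromorphicAt_closedS _ s)
    · rw [(hz s hs).2, finsum_mem_eq_finite_toFinset_sum _ hfin, ← Finset.sum_attach]
      refine Finset.sum_congr rfl fun δ _ => ?_
      rw [hS δ.1 (hfin.mem_toFinset.1 δ.2) (D δ.1 (hfin.mem_toFinset.1 δ.2)) s hs]
    · by_contra! hcon
      obtain ⟨h1, h2⟩ := hcon
      -- Away from the listed real parts no denominator vanishes, so the sum is analytic at `s` and
      -- its order there is nonnegative.
      refine not_le.2 hs (AnalyticAt.meromorphicOrderAt_nonneg ?_)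
      refine Finset.analyticAt_fun_sum _ fun δ _ => (analyticAt_L δ.1 fun h => h1 ?_).mul
        (analyticAt_closedS _ fun i j h => ?_)
      · have := re_eq_zero_of_prime_cpow h
        simp only [Complex.add_re, Complex.natCast_re] at this
        linarith
      · have hray := hDray δ.1 (hfin.mem_toFinset.1 δ.2) i j
        obtain ⟨h3, h4⟩ := re_eq_of_expo hF' hg' hray.1 h
        exact h2 _ hray h3 h4
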